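/- Let $-A$ be the generator of a bounded $C_0$-semigroup $(e^{-tA})_{t\ge 0}$ on a complex Banach space $X$, and put $M:=\sup_{t\ge 0}\|e^{-tA}\|<\infty$. The range of $A$ is not assumed to be dense. For $n\in\mathbb N$, $n\ge 1$, and $t>0$ the operator $1+\frac tn A$ has an everywhere defined bounded inverse, and we set $$\Delta_{n,t}(A):=\Bigl(1+\frac tn A\Bigr)^{-n}-e^{-tA}.$$ For a bounded complex Borel measure $\mu$ on $[0,\infty)$ let $\mathcal L\mu(z)=\int_{[0,\infty)}e^{-sz}\,\mu(ds)$ for $\operatorname{Re}z>0$, and $(\mathcal L\mu)(A)x:=\int_{[0,\infty)}e^{-sA}x\,\mu(ds)$ for $x\in X$. A holomorphic function $g$ on $\{\operatorname{Re}z>0\}$ is called regularizable if there is a function $e=\mathcal L\mu$ such that $eg=\mathcal L\nu$ for some bounded complex measure $\nu$ and $e(A)$ is injective. Then $g(A):=e(A)^{-1}(eg)(A)$, with domain $\operatorname{dom}(g(A))=\{x\in X:(eg)(A)x\in\operatorname{ran}(e(A))\}$; this does not depend on the choice of the regularizer $e$. A Stieltjes function is a function of the form $f(z)=a+\int_{[0,\infty)}\frac{\mu(d\tau)}{z+\tau}$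 with $a\ge 0$ and a positive Radon measure $\mu$ on $[0,\infty)$ satisfying $\int_{[0,\infty)}\frac{\mu(d\tau)}{1+\tau}<\infty$, considered together with its analytic extension to $\mathbb C\setminus(-\infty,0]$. Let $f=f_1f_2$ be a product of two Stieltjes functions, $f\ne 0$, and let $g=1/f$. Then $g$ is regularizable, and for every $x\in\operatorname{dom}(g(A))$, $$\|\Delta_{n,t}(A)x\|\le 12M\,\frac{\|g(A)x\|}{g(\sqrt n/t)},\qquad n\in\mathbb N,\ n\ge1,\ t>0.$$ In particular, for every $\alpha\in(0,2]$ the function $z^\alpha$ (principal branch) is regularizable and, with $A^\alpha:=(z^\alpha)(A)$, for every $x\in\operatorname{dom}(A^\alpha)$, $$\|\Delta_{n,t}(A)x\|\le 12M\,\|A^\alpha x\|\Bigl(\frac{t}{\sqrt n}\Bigr)^{\alpha},\qquad n\in\mathbb N,\ n\ge1,\ t>0.$$ -/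

import Mathlib

open Filter Topology MeasureTheory
open scoped NNReal ENNReal

/-- A bounded `C₀`-semigroup `(T t)_{t ≥ 0}` of bounded linear operators on `X`. -/
structure BoundedC0Semigroup (X : Type*) [NormedAddCommGroup X] [NormedSpace ℂ X] where
  /-- the operator `e^{-tA}` -/
  op : ℝ≥0 → X →L[ℂ] X
  map_zero : op 0 = ContinuousLinearMap.id ℂ X
  map_add : ∀ s t, op (s + t) = (op s).comp (op t)
  strongly_continuous : ∀ x, Continuous fun t => op t x
  bounded : BddAbove (Set.range fun t => ‖op t‖)

namespace BoundedC0Semigroup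

variable {X : Type*} [NormedAddCommGroup X] [NormedSpace ℂ X]

/-- `M = sup_{t ≥ 0} ‖T t‖`, finite by boundedness. -/
noncomputable def bound (T : BoundedC0Semigroup X) : ℝ := ⨆ t, ‖T.op t‖

theorem norm_op_le (T : BoundedC0Semigroup X) (t : ℝ≥0) : ‖T.op t‖ ≤ T.bound :=
  le_ciSup T.bounded t

theorem bound_nonneg (T : BoundedC0Semigroup X) : 0 ≤ T.bound :=
  (norm_nonneg _).trans (T.norm_op_le 0)

/-- `y` is the right derivative at `0` of the orbit of `x`. -/
def HasOrbitDeriv (T : BoundedC0Semigroup X) (x y : X) : Prop :=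
  Tendsto (fun h : ℝ≥0 => (h : ℂ)⁻¹ • (T.op h x - x)) (𝓝[>] 0) (𝓝 y)

theorem HasOrbitDeriv.unique {T : BoundedC0Semigroup X} {x y z : X}
    (hy : T.HasOrbitDeriv x y) (hz : T.HasOrbitDeriv x z) : y = z :=
  tendsto_nhds_unique hy hz

theorem HasOrbitDeriv.add {T : BoundedC0Semigroup X} {x y x' y' : X}
    (h : T.HasOrbitDeriv x y) (h' : T.HasOrbitDeriv x' y') :
    T.HasOrbitDeriv (x + x') (y + y') := by
  refine (Tendsto.add h h').congr fun s => ?_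
  rw [_root_.map_add, ← smul_add]
  congr 1
  abel

theorem HasOrbitDeriv.smul {T : BoundedC0Semigroup X} {x y : X} (c : ℂ)
    (h : T.HasOrbitDeriv x y) : T.HasOrbitDeriv (c • x) (c • y) := by
  refine (Tendsto.const_smul h c).congr fun s => ?_
  rw [_root_.map_smul, ← smul_sub, smul_comm]

theorem hasOrbitDeriv_zero (T : BoundedC0Semigroup X) : T.HasOrbitDeriv 0 0 := by
  simp [HasOrbitDeriv]

/-- The infinitesimal generator of the semigroup, with its maximal domain. -/
noncomputable def generator (T : BoundedC0Semigroup X) : X →ₗ.[ℂ] X where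
  domain :=
    { carrier := {x | ∃ y, T.HasOrbitDeriv x y}
      add_mem' := fun ⟨_, h⟩ ⟨_, h'⟩ => ⟨_, h.add h'⟩
      zero_mem' := ⟨0, T.hasOrbitDeriv_zero⟩
      smul_mem' := fun c _ ⟨_, h⟩ => ⟨_, h.smul c⟩ }
  toFun :=
    { toFun := fun x => Classical.choose x.2
      map_add' := fun x x' => (Classical.choose_spec (x + x').2).unique
        ((Classical.choose_spec x.2).add (Classical.choose_spec x'.2))
      map_smul' := fun c x => (Classical.choose_spec (c • x).2).unique
        ((Classical.choose_spec x.2).smul c) }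

end BoundedC0Semigroup

section BoundedInverse

variable {X : Type*} [NormedAddCommGroup X] [NormedSpace ℂ X]

/-- `R` is an everywhere defined bounded two-sided inverse of the (unbounded) operator `B`. -/
def IsBoundedInverse (B : X →ₗ.[ℂ] X) (R : X →L[ℂ] X) : Prop :=
  (∀ x, ∃ h : R x ∈ B.domain, B ⟨R x, h⟩ = x) ∧ ∀ y : B.domain, R (B y) = y

open Classical in
/-- `B⁻¹`, if `B` has an everywhere defined bounded inverse (which is then unique). -/
noncomputable def boundedInverse (B : X →ₗ.[ℂ] X) : X →L[ℂ] X :=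
  if h : ∃ R, IsBoundedInverse B R then h.choose else 0

/-- The operator `1 + h A`, with domain `dom A`. -/
noncomputable def onePlus (h : ℝ) (A : X →ₗ.[ℂ] X) : X →ₗ.[ℂ] X :=
  LinearMap.id.toPMap ⊤ + (h : ℂ) • A

/-- `E_{n,t}(A) = (1 + (t/n) A)^{-n}`. -/
noncomputable def eulerApprox (A : X →ₗ.[ℂ] X) (n : ℕ) (t : ℝ≥0) : X →L[ℂ] X :=
  boundedInverse (onePlus ((t : ℝ) / n) A) ^ n

end BoundedInverse

section ComplexMeasures

theorem complexMeasure_variation_finite (μ : ComplexMeasure ℝ≥0) :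
    IsFiniteMeasure μ.variation := by
  have h : μ.variation ≤ (ComplexMeasure.re μ).totalVariation +
      (ComplexMeasure.im μ).totalVariation := by
    refine VectorMeasure.variation_le_of_forall_enorm_le fun s _ => ?_
    have h1 : ‖μ s‖ₑ ≤ ‖ComplexMeasure.re μ s‖ₑ + ‖ComplexMeasure.im μ s‖ₑ := by
      simp only [← ofReal_norm]
      rw [← ENNReal.ofReal_add (norm_nonneg _) (norm_nonneg _)]
      exact ENNReal.ofReal_le_ofReal (Complex.norm_le_abs_re_add_abs_im (μ s))
    refine h1.trans ?_
    rw [Measure.add_apply]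
    exact add_le_add (SignedMeasure.enorm_le_totalVariation _ _)
      (SignedMeasure.enorm_le_totalVariation _ _)
  have : IsFiniteMeasure ((ComplexMeasure.re μ).totalVariation +
      (ComplexMeasure.im μ).totalVariation) := by
    unfold SignedMeasure.totalVariation
    infer_instance
  exact isFiniteMeasure_of_le _ h

/-- The Laplace transform `(ℒ μ)(z) = ∫_{[0,∞)} e^{-sz} μ(ds)` of a bounded complex measure. -/
noncomputable def laplaceTransform (μ : ComplexMeasure ℝ≥0) (z : ℂ) : ℂ :=
  VectorMeasure.integral μ (fun s : ℝ≥0 => Complex.exp (-((s : ℂ) * z)))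
    (ContinuousLinearMap.mul ℝ ℂ)

/-- The pairing `(x, w) ↦ w • x`, used to integrate an `X`-valued function against a complex
measure. -/
noncomputable def smulPairing (X : Type*) [NormedAddCommGroup X] [NormedSpace ℂ X] :
    X →L[ℝ] ℂ →L[ℝ] X :=
  (ContinuousLinearMap.lsmul ℝ ℂ).flip

end ComplexMeasures

namespace BoundedC0Semigroup

variable {X : Type*} [NormedAddCommGroup X] [NormedSpace ℂ X]

theorem norm_orbit_le (T : BoundedC0Semigroup X) (s : ℝ≥0) (x : X) :
    ‖T.op s x‖ ≤ T.bound * ‖x‖ :=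
  ((T.op s).le_opNorm x).trans (mul_le_mul_of_nonneg_right (T.norm_op_le s) (norm_nonneg x))

theorem integrable_orbit (T : BoundedC0Semigroup X) (μ : ComplexMeasure ℝ≥0) (x : X) :
    VectorMeasure.Integrable μ (fun s => T.op s x) := by
  have := complexMeasure_variation_finite μ
  exact Integrable.of_bound (C := T.bound * ‖x‖)
    (T.strongly_continuous x).aestronglyMeasurable (ae_of_all _ fun s => T.norm_orbit_le s x)

/-- The Hille–Phillips calculus: the bounded operator
`(ℒ μ)(A) x = ∫_{[0,∞)} e^{-sA} x μ(ds)`. -/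
noncomputable def hillePhillips (T : BoundedC0Semigroup X) (μ : ComplexMeasure ℝ≥0) :
    X →L[ℂ] X :=
  LinearMap.mkContinuous
    { toFun := fun x => VectorMeasure.integral μ (fun s => T.op s x) (smulPairing X)
      map_add' := fun x y => by
        simp only [_root_.map_add]
        exact VectorMeasure.integral_fun_add (T.integrable_orbit μ x) (T.integrable_orbit μ y)
      map_smul' := fun c x => by
        simp only [_root_.map_smul, RingHom.id_apply]
        refine setToFun_smul (𝕜 := ℂ) _ (fun c s x => ?_) c (fun s => T.op s x)
        change μ s • (c • x) = c • (μ s • x)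
        exact smul_comm _ _ _ }
    (T.bound * ‖smulPairing X‖ * μ.variation.real Set.univ) fun x => by
      have := complexMeasure_variation_finite μ
      refine (VectorMeasure.norm_integral_le_of_norm_le_const
        (ae_of_all _ fun s => T.norm_orbit_le s x)).trans (le_of_eq ?_)
      ring

/-- A regularizer for `f` in the extended Hille–Phillips calculus: `f` is holomorphic on the open
right half-plane, `e = ℒ μ` and `e f = ℒ ν` there for bounded complex measures `μ`, `ν` on
`[0,∞)`, and the bounded operator `e(A)` is injective. -/
structure Regularizer (T : BoundedC0Semigroup X) (f : ℂ → ℂ) where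
  /-- the measure whose Laplace transform is `e` -/
  μ : ComplexMeasure ℝ≥0
  /-- the measure whose Laplace transform is `e f` -/
  ν : ComplexMeasure ℝ≥0
  holomorphic : DifferentiableOn ℂ f {z | 0 < z.re}
  laplace_eq : ∀ z : ℂ, 0 < z.re → laplaceTransform ν z = laplaceTransform μ z * f z
  injective : Function.Injective (T.hillePhillips μ)

/-- The operator `f(A) = e(A)⁻¹ (e f)(A)` of the extended Hille–Phillips calculus, with domain
`{x | (e f)(A) x ∈ ran e(A)}`, computed with the given regularizer `e`. -/
noncomputable def Regularizer.apply {T : BoundedC0Semigroup X} {f : ℂ → ℂ}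
    (R : T.Regularizer f) : X →ₗ.[ℂ] X where
  domain := (LinearMap.range (T.hillePhillips R.μ).toLinearMap).comap
    (T.hillePhillips R.ν).toLinearMap
  toFun := (LinearEquiv.ofInjective (T.hillePhillips R.μ).toLinearMap R.injective).symm.toLinearMap
    ∘ₗ (T.hillePhillips R.ν).toLinearMap.restrict (fun _ hx => hx)

/-- The defining property of `f(A)`: `y = f(A) x` iff `e(A) y = (e f)(A) x`. -/
theorem Regularizer.apply_eq_iff {T : BoundedC0Semigroup X} {f : ℂ → ℂ}
    (R : T.Regularizer f) (x : R.apply.domain) (y : X) :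
    R.apply x = y ↔ T.hillePhillips R.μ y = T.hillePhillips R.ν x := by
  change (LinearEquiv.ofInjective (T.hillePhillips R.μ).toLinearMap R.injective).symm
    ⟨T.hillePhillips R.ν x, x.2⟩ = y ↔ _
  rw [LinearEquiv.symm_apply_eq, Subtype.ext_iff]
  exact eq_comm

end BoundedC0Semigroup

/-- Stieltjes functions, with their analytic extension to `ℂ ∖ (-∞, 0]`:
`f z = a + ∫_{[0,∞)} μ(dτ) / (z + τ)` with `a ≥ 0` and a positive measure `μ` such that
`∫ μ(dτ) / (1 + τ) < ∞` (in particular `μ` is finite on compact sets, that is, Radon). Only the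
values of `f` on `ℂ ∖ (-∞, 0]` are relevant. -/
def IsStieltjes (f : ℂ → ℂ) : Prop :=
  ∃ (a : ℝ≥0) (μ : Measure ℝ≥0), Integrable (fun τ : ℝ≥0 => (1 + (τ : ℝ))⁻¹) μ ∧
    ∀ z ∈ Complex.slitPlane, f z = ((a : ℝ) : ℂ) + ∫ τ : ℝ≥0, (z + ((τ : ℝ) : ℂ))⁻¹ ∂μ

/-- Products `f = f₁ f₂` of two Stieltjes functions. -/
def IsStieltjesProduct (f : ℂ → ℂ) : Prop :=
  ∃ f₁ f₂ : ℂ → ℂ, IsStieltjes f₁ ∧ IsStieltjes f₂ ∧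
    ∀ z ∈ Complex.slitPlane, f z = f₁ z * f₂ z

/-- Such functions are real and nonnegative on `(0,∞)`. -/
theorem IsStieltjes.eq_nonneg_ofReal {f : ℂ → ℂ} (hf : IsStieltjes f) {r : ℝ} (hr : 0 < r) :
    ∃ c : ℝ, 0 ≤ c ∧ f r = c := by
  obtain ⟨a, μ, -, h⟩ := hf
  refine ⟨a + ∫ τ : ℝ≥0, (r + (τ : ℝ))⁻¹ ∂μ, ?_, ?_⟩
  · exact add_nonneg a.2 (integral_nonneg fun τ => by positivity)
  · rw [h _ (Or.inl (by simpa using hr)), Complex.ofReal_add, ← integral_complex_ofReal]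
    simp

/-! The resolvent `(1 + hA)⁻¹` is the average of the semigroup against the exponential distribution
of mean `h`. Hence `(1 + (t/n)A)⁻ⁿ` is the average against a gamma distribution `p` of mean `t` and
variance `t²/n`, and `Δ_{n,t}(A)` is the average against `p - δ_t`. If `(ℒp - e^{-tz}) f = ℒν`, then
`f g = 1` gives `ℒp - e^{-tz} = ℒν · g`. The calculus turns this into `Δ_{n,t}(A) x = ν(A) g(A) x`
(`Regularizer.average_apply_eq`), so the norm is at most `M ‖ν‖ ‖g(A)x‖`. The rate is therefore a
bound on the mass of `ν`.

Put `c = √n/t`, so that `p` has standard deviation `1/c`. Taylor expansion of `s ↦ e^{-sz}` at the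
mean `t` shows that `(ℒp - e^{-tz})/z^j` is a Laplace transform of mass at most `2`, `c⁻¹`, `c⁻²/2`
for `j = 0, 1, 2`. Splitting the spectral measure of a Stieltjes function at `c` writes it as `u +
v`, with `u` of mass at most `2U`, `z v` of mass at most `4cV`, and `U + V` its value at `c`
(`IsStieltjes.exists_split`). Expanding `(u₁ + v₁)(u₂ + v₂)` and pairing each `v` with one power
`z⁻¹` gives every term the same constant: the mass of `ν` is at most `8 f(c)`.

For regularizability it suffices that `(1+z)⁻³/f` is a Laplace transform for each nonzero Stieltjes
`f`; then `(1+z)⁻⁶` regularizes `g`, and `(1+A)⁻⁶` is always injective, whatever the range of `A`.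
Truncate `f` to `f_N = (N+z)⁻¹ ∑ u_n wⁿ`, where `w = N/(N+z)` and the `u_n` are Hausdorff moments,
hence log-convex and decreasing. Kaluza's theorem gives `1/∑ u_n wⁿ = (1 - ∑ ψ_k w^{k+1})/u_0` with
`ψ_k ≥ 0` and `∑ ψ_k ≤ 1`. This makes `(1+z)⁻¹/f_N` a Laplace transform of mass at most `12/f_N(1)`,
and a telescoping series passes to the limit (`LaplaceBound.of_approx`).

Finally `z^{-α}` is the square of `z^{-α/2}`, which is Stieltjes for `0 < α ≤ 2`. -/

/-! ### Laplace transforms of finite positive measures and their uniqueness -/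

section Laplace

/-- The Laplace transform of a positive measure on `[0,∞)`. -/
noncomputable def laplace (p : Measure ℝ≥0) (z : ℂ) : ℂ :=
  ∫ s : ℝ≥0, Complex.exp (-((s : ℂ) * z)) ∂p

theorem continuous_exp_neg_mul (z : ℂ) :
    Continuous fun s : ℝ≥0 => Complex.exp (-((s : ℂ) * z)) := by fun_prop

theorem norm_exp_neg_mul_le {z : ℂ} (hz : 0 ≤ z.re) (s : ℝ≥0) :
    ‖Complex.exp (-((s : ℂ) * z))‖ ≤ 1 := by
  rw [Complex.norm_exp, Real.exp_le_one_iff]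
  simpa using mul_nonneg s.2 hz

theorem integrable_exp_neg_mul (p : Measure ℝ≥0) [IsFiniteMeasure p] {z : ℂ} (hz : 0 ≤ z.re) :
    Integrable (fun s : ℝ≥0 => Complex.exp (-((s : ℂ) * z))) p :=
  Integrable.of_bound (continuous_exp_neg_mul z).aestronglyMeasurable 1
    (ae_of_all _ fun s => norm_exp_neg_mul_le hz s)

theorem norm_laplace_le (p : Measure ℝ≥0) [IsFiniteMeasure p] {z : ℂ} (hz : 0 ≤ z.re) :
    ‖laplace p z‖ ≤ p.real Set.univ := by
  simpa [laplace] using norm_integral_le_of_norm_le_const (μ := p)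
    (ae_of_all _ fun s => norm_exp_neg_mul_le hz s)

theorem laplace_add (p q : Measure ℝ≥0) [IsFiniteMeasure p] [IsFiniteMeasure q] {z : ℂ}
    (hz : 0 ≤ z.re) : laplace (p + q) z = laplace p z + laplace q z :=
  integral_add_measure (integrable_exp_neg_mul p hz) (integrable_exp_neg_mul q hz)

theorem laplace_conv (p q : Measure ℝ≥0) [IsFiniteMeasure p] [IsFiniteMeasure q] {z : ℂ}
    (hz : 0 ≤ z.re) : laplace (p.conv q) z = laplace p z * laplace q z := by
  rw [laplace, integral_conv (integrable_exp_neg_mul _ hz), laplace, laplace,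
    ← integral_mul_const]
  refine integral_congr_ae (ae_of_all _ fun s => ?_)
  simp only
  rw [← integral_const_mul]
  refine integral_congr_ae (ae_of_all _ fun r => ?_)
  simp only [← Complex.exp_add]
  congr 1
  push_cast
  ring

theorem laplace_smul (c : ℝ≥0) (p : Measure ℝ≥0) (z : ℂ) :
    laplace (c • p) z = c * laplace p z := by
  rw [laplace, integral_smul_nnreal_measure]
  rfl

theorem laplace_dirac (t : ℝ≥0) (z : ℂ) :
    laplace (Measure.dirac t) z = Complex.exp (-((t : ℂ) * z)) := by
  simp [laplace]

theorem laplace_map {Ω : Type*} [MeasurableSpace Ω] (P : Measure Ω) {φ : Ω → ℝ≥0}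
    (hφ : Measurable φ) (z : ℂ) :
    laplace (P.map φ) z = ∫ ω, Complex.exp (-((φ ω : ℂ) * z)) ∂P :=
  integral_map hφ.aemeasurable (continuous_exp_neg_mul z).aestronglyMeasurable

/-- On the real axis the Laplace transform is real. -/
theorem laplace_ofReal_im (p : Measure ℝ≥0) (r : ℝ) : (laplace p r).im = 0 := by
  have : laplace p r = ((∫ s : ℝ≥0, Real.exp (-((s : ℝ) * r)) ∂p : ℝ) : ℂ) := by
    rw [laplace, ← integral_complex_ofReal]
    simp
  rw [this, Complex.ofReal_im]

/-- The exponential `s ↦ e^{-s}` as a bounded continuous function on `[0,∞)`. -/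
noncomputable def expNegBounded : BoundedContinuousFunction ℝ≥0 ℝ :=
  BoundedContinuousFunction.ofNormedAddCommGroup (fun s : ℝ≥0 => Real.exp (-(s : ℝ)))
    (by fun_prop) 1 fun s => by
      rw [Real.norm_eq_abs, Real.abs_exp]
      exact Real.exp_le_one_iff.2 (by simp)

/-- A finite measure on `[0,∞)` is determined by its Laplace transform on the positive axis. -/
theorem eq_of_laplace_eq (p q : Measure ℝ≥0) [IsFiniteMeasure p] [IsFiniteMeasure q]
    (h : ∀ r : ℝ, 0 < r → laplace p r = laplace q r) : p = q := by
  have key : ∀ r : ℝ, 0 < r →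
      ∫ s : ℝ≥0, Real.exp (-((s : ℝ) * r)) ∂p = ∫ s : ℝ≥0, Real.exp (-((s : ℝ) * r)) ∂q := by
    intro r hr
    have := h r hr
    simp only [laplace] at this
    have e : ∀ s : ℝ≥0, Complex.exp (-((s : ℂ) * (r : ℂ))) =
        ((Real.exp (-((s : ℝ) * r)) : ℝ) : ℂ) := fun s => by simp
    simp only [e] at this
    rw [integral_complex_ofReal, integral_complex_ofReal] at this
    exact_mod_cast this
  -- The hypothesis covers only `r > 0`; equality of the total masses, the value at `r = 0`, is
  -- recovered from `r = 1/(k+1) → 0`.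
  have lim : ∀ ρ : Measure ℝ≥0, IsFiniteMeasure ρ →
      Tendsto (fun k : ℕ => ∫ s : ℝ≥0, Real.exp (-((s : ℝ) * (1 / ((k : ℝ) + 1)))) ∂ρ) atTop
        (𝓝 (∫ _ : ℝ≥0, (1 : ℝ) ∂ρ)) := by
    intro ρ _
    refine tendsto_integral_of_dominated_convergence (fun _ => 1)
      (fun k => (by fun_prop : Continuous _).aestronglyMeasurable) (integrable_const _)
      (fun k => ae_of_all _ fun s => ?_) (ae_of_all _ fun s => ?_)
    · rw [Real.norm_eq_abs, Real.abs_exp, Real.exp_le_one_iff]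
      have : 0 ≤ (s : ℝ) * (1 / ((k : ℝ) + 1)) := by positivity
      linarith
    · have h1 : Tendsto (fun k : ℕ => -((s : ℝ) * (1 / ((k : ℝ) + 1)))) atTop
          (𝓝 (-((s : ℝ) * 0))) :=
        (tendsto_one_div_add_atTop_nhds_zero_nat.const_mul _).neg
      simpa [Function.comp_def] using (Real.continuous_exp.tendsto _).comp h1
  have key0 : ∫ _ : ℝ≥0, (1 : ℝ) ∂p = ∫ _ : ℝ≥0, (1 : ℝ) ∂q := by
    refine tendsto_nhds_unique ((lim p inferInstance).congr fun k => ?_) (lim q inferInstance)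
    exact key _ (by positivity)
  have pow : ∀ k : ℕ, ∫ s : ℝ≥0, (expNegBounded s) ^ k ∂p = ∫ s : ℝ≥0, (expNegBounded s) ^ k ∂q := by
    intro k
    have e : ∀ s : ℝ≥0, (expNegBounded s) ^ k = Real.exp (-((s : ℝ) * k)) := by
      intro s
      change Real.exp (-(s : ℝ)) ^ k = _
      rw [← Real.exp_nat_mul]
      ring_nf
    rcases Nat.eq_zero_or_pos k with rfl | hk
    · simpa using key0
    · simp only [e]
      exact key k (by exact_mod_cast hk)
  -- The polynomials in `e^{-s}` separate points, and such a subalgebra of bounded continuous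
  -- functions determines a finite measure on a Polish space. By linearity only the monomials
  -- `e^{-ks}` have to be compared.
  let S : Subalgebra ℝ (BoundedContinuousFunction ℝ≥0 ℝ) := Algebra.adjoin ℝ {expNegBounded}
  have hint : ∀ (ρ : Measure ℝ≥0) (_ : IsFiniteMeasure ρ) (g : BoundedContinuousFunction ℝ≥0 ℝ),
      Integrable g ρ := fun ρ _ g => g.integrable ρ
  let A : StarSubalgebra ℝ (BoundedContinuousFunction ℝ≥0 ℝ) :=
    { S with
      star_mem' := fun {a} ha => by
        have h : star a = a := by ext; simp
        rw [h]
        exact ha }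
  refine ext_of_forall_mem_subalgebra_integral_eq_of_polish (𝕜 := ℝ) (A := A) ?_ ?_
  · intro x y hxy
    refine ⟨expNegBounded, ⟨_, ⟨expNegBounded, Algebra.subset_adjoin rfl, rfl⟩, rfl⟩, ?_⟩
    intro hc
    have := Real.exp_injective hc
    exact hxy (by simpa using this)
  · intro g hg
    have hg' : g ∈ Algebra.adjoin ℝ {expNegBounded} := hg
    rw [Algebra.adjoin_singleton_eq_range_aeval] at hg'
    obtain ⟨P, rfl⟩ := hg'
    induction P using Polynomial.induction_on' with
    | add P Q hP hQ =>
      have hm : ∀ P : Polynomial ℝ, (Polynomial.aeval expNegBounded) P ∈ A := by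
        intro P
        have : (Polynomial.aeval expNegBounded) P ∈ Algebra.adjoin ℝ {expNegBounded} := by
          rw [Algebra.adjoin_singleton_eq_range_aeval]; exact ⟨P, rfl⟩
        exact this
      have e : ∀ x, ((Polynomial.aeval expNegBounded).toRingHom (P + Q)) x =
          ((Polynomial.aeval expNegBounded).toRingHom P) x +
            ((Polynomial.aeval expNegBounded).toRingHom Q) x := by
        intro x; rw [map_add]; rfl
      simp only [e]
      rw [integral_add (hint p inferInstance _) (hint p inferInstance _),
        integral_add (hint q inferInstance _) (hint q inferInstance _), hP (hm P), hQ (hm Q)]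
    | monomial k c =>
      have e : ∀ x, ((Polynomial.aeval expNegBounded).toRingHom (Polynomial.monomial k c)) x =
          c * (expNegBounded x) ^ k := by
        intro x
        change (Polynomial.aeval expNegBounded (Polynomial.monomial k c)) x = _
        rw [Polynomial.aeval_monomial]
        simp [Algebra.algebraMap_eq_smul_one]
      simp only [e, integral_const_mul, pow]

end Laplace

/-! ### Averages of the semigroup -/

namespace BoundedC0Semigroup

variable {X : Type*} [NormedAddCommGroup X] [NormedSpace ℂ X]

theorem integrable_op (T : BoundedC0Semigroup X) (p : Measure ℝ≥0) [IsFiniteMeasure p] (x : X) :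
    Integrable (fun s => T.op s x) p :=
  Integrable.of_bound (T.strongly_continuous x).aestronglyMeasurable (T.bound * ‖x‖)
    (ae_of_all _ fun s => T.norm_orbit_le s x)

/-- The average `∫ T(s) x p(ds)` of a bounded semigroup with respect to a finite measure. -/
noncomputable def average (T : BoundedC0Semigroup X) (p : Measure ℝ≥0) [IsFiniteMeasure p] :
    X →L[ℂ] X :=
  LinearMap.mkContinuous
    { toFun := fun x => ∫ s, T.op s x ∂p
      map_add' := fun x y => by
        simp only [_root_.map_add]
        exact integral_add (T.integrable_op p x) (T.integrable_op p y)
      map_smul' := fun c x => by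
        simp only [_root_.map_smul, RingHom.id_apply]
        exact integral_smul c _ }
    (T.bound * p.real Set.univ) fun x => by
      refine (norm_integral_le_of_norm_le_const
        (ae_of_all _ fun s => T.norm_orbit_le s x)).trans (le_of_eq ?_)
      ring

theorem average_apply (T : BoundedC0Semigroup X) (p : Measure ℝ≥0) [IsFiniteMeasure p] (x : X) :
    T.average p x = ∫ s, T.op s x ∂p := rfl

theorem norm_average_apply_le (T : BoundedC0Semigroup X) (p : Measure ℝ≥0) [IsFiniteMeasure p]
    (x : X) : ‖T.average p x‖ ≤ T.bound * p.real Set.univ * ‖x‖ :=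
  (norm_integral_le_of_norm_le_const
    (ae_of_all _ fun s => T.norm_orbit_le s x)).trans (le_of_eq (by ring))

theorem average_add (T : BoundedC0Semigroup X) (p q : Measure ℝ≥0) [IsFiniteMeasure p]
    [IsFiniteMeasure q] (x : X) : T.average (p + q) x = T.average p x + T.average q x :=
  integral_add_measure (T.integrable_op p x) (T.integrable_op q x)

theorem average_dirac [CompleteSpace X] (T : BoundedC0Semigroup X) (t : ℝ≥0) (x : X) :
    T.average (Measure.dirac t) x = T.op t x := by
  simp [average_apply]

/-- Fubini and the semigroup law: this is the multiplicativity of the calculus. -/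
theorem average_conv [CompleteSpace X] (T : BoundedC0Semigroup X) (p q : Measure ℝ≥0)
    [IsFiniteMeasure p] [IsFiniteMeasure q] (x : X) :
    T.average (p.conv q) x = T.average p (T.average q x) := by
  rw [average_apply, integral_conv (T.integrable_op _ x), average_apply]
  refine integral_congr_ae (ae_of_all _ fun s => ?_)
  simp only [T.map_add, ContinuousLinearMap.comp_apply]
  exact (T.op s).integral_comp_comm (T.integrable_op q x)

end BoundedC0Semigroup

/-! ### Integrals against complex measures in terms of positive measures -/

section ComplexMeasureIntegral

variable {E : Type*} [NormedAddCommGroup E] [NormedSpace ℂ E] [CompleteSpace E]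

/-- A complex measure `μ = a - b + i (c - d)` is integrated by integrating against the finite
positive measures `a`, `b`, `c`, `d`. -/
theorem integral_smulPairing (μ : ComplexMeasure ℝ≥0) (a b c d : Measure ℝ≥0)
    [IsFiniteMeasure a] [IsFiniteMeasure b] [IsFiniteMeasure c] [IsFiniteMeasure d]
    (h : ∀ s, MeasurableSet s →
      μ s = ((a.real s - b.real s : ℝ) : ℂ) + Complex.I * ((c.real s - d.real s : ℝ) : ℂ))
    {f : ℝ≥0 → E} (hf : StronglyMeasurable f) {C : ℝ} (hC : ∀ s, ‖f s‖ ≤ C) :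
    VectorMeasure.integral μ f (smulPairing E) =
      (∫ s, f s ∂a - ∫ s, f s ∂b) + Complex.I • (∫ s, f s ∂c - ∫ s, f s ∂d) := by
  classical
  have hfin := complexMeasure_variation_finite μ
  have int : ∀ (ρ : Measure ℝ≥0) [IsFiniteMeasure ρ] (g : SimpleFunc ℝ≥0 E), Integrable g ρ :=
    fun ρ _ g => g.integrable_of_isFiniteMeasure
  -- Both sides are additive in the integrand, so for simple functions the claim reduces to
  -- indicators, where it is `h`. Approximation with the common bound `C` then gives the general
  -- case by dominated convergence on both sides.
  have simple : ∀ g : SimpleFunc ℝ≥0 E, VectorMeasure.integral μ g (smulPairing E) =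
      (∫ s, g s ∂a - ∫ s, g s ∂b) + Complex.I • (∫ s, g s ∂c - ∫ s, g s ∂d) := by
    intro g
    induction g using SimpleFunc.induction with
    | const x hs =>
      rename_i s
      rw [SimpleFunc.coe_piecewise, SimpleFunc.coe_const, SimpleFunc.coe_const,
        Function.const_zero, Set.piecewise_eq_indicator]
      simp only [VectorMeasure.integral_eq_setToFun]
      have := setToFun_indicator_const
        (dominatedFinMeasAdditive_cbmApplyMeasure μ (smulPairing E)) hs (measure_ne_top _ _) x
      refine this.trans ?_
      have hx : (VectorMeasure.transpose μ (smulPairing E)) s x =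
          (((a.real s - b.real s : ℝ) : ℂ) + Complex.I * ((c.real s - d.real s : ℝ) : ℂ)) • x := by
        rw [← h s hs]
        rfl
      rw [hx]
      change _ = (∫ r, s.indicator (fun _ => x) r ∂a - ∫ r, s.indicator (fun _ => x) r ∂b) +
        Complex.I • (∫ r, s.indicator (fun _ => x) r ∂c - ∫ r, s.indicator (fun _ => x) r ∂d)
      simp only [integral_indicator_const _ hs]
      rw [add_smul, Complex.coe_smul, mul_smul, Complex.coe_smul, sub_smul, sub_smul]
    | add _ hf hg =>
      rename_i f g _
      simp only [SimpleFunc.coe_add]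
      rw [VectorMeasure.integral_add (int _ f) (int _ g), hf, hg]
      simp only [Pi.add_apply]
      rw [integral_add (int a f) (int a g), integral_add (int b f) (int b g),
        integral_add (int c f) (int c g), integral_add (int d f) (int d g)]
      simp only [smul_sub, smul_add]
      abel
  have hC0 : 0 ≤ C := (norm_nonneg _).trans (hC 0)
  let g := hf.approxBounded C
  have gC : ∀ n s, ‖g n s‖ ≤ C := fun n s => hf.norm_approxBounded_le hC0 n s
  have glim : ∀ s, Tendsto (fun n => g n s) atTop (𝓝 (f s)) := fun s =>
    hf.tendsto_approxBounded_of_norm_le (hC s)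
  have lim : ∀ (ρ : Measure ℝ≥0) [IsFiniteMeasure ρ],
      Tendsto (fun n => ∫ s, g n s ∂ρ) atTop (𝓝 (∫ s, f s ∂ρ)) := fun ρ _ =>
    tendsto_integral_of_dominated_convergence (fun _ => C)
      (fun n => (g n).stronglyMeasurable.aestronglyMeasurable) (integrable_const _)
      (fun n => ae_of_all _ (gC n)) (ae_of_all _ glim)
  have lhs : Tendsto (fun n => VectorMeasure.integral μ (g n) (smulPairing E)) atTop
      (𝓝 (VectorMeasure.integral μ f (smulPairing E))) :=
    VectorMeasure.tendsto_integral_of_dominated_convergence (fun _ => C)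
      (fun n => (g n).stronglyMeasurable.aestronglyMeasurable) (integrable_const _)
      (fun n => ae_of_all _ (gC n)) (ae_of_all _ glim)
  refine tendsto_nhds_unique lhs ?_
  simp only [simple]
  exact ((lim a).sub (lim b)).add (((lim c).sub (lim d)).const_smul _)

theorem ComplexMeasure.exists_decomposition (μ : ComplexMeasure ℝ≥0) :
    ∃ (a b c d : Measure ℝ≥0) (_ : IsFiniteMeasure a) (_ : IsFiniteMeasure b)
      (_ : IsFiniteMeasure c) (_ : IsFiniteMeasure d), ∀ s, MeasurableSet s →
      μ s = ((a.real s - b.real s : ℝ) : ℂ) + Complex.I * ((c.real s - d.real s : ℝ) : ℂ) := by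
  refine ⟨(ComplexMeasure.re μ).toJordanDecomposition.posPart,
    (ComplexMeasure.re μ).toJordanDecomposition.negPart,
    (ComplexMeasure.im μ).toJordanDecomposition.posPart,
    (ComplexMeasure.im μ).toJordanDecomposition.negPart,
    inferInstance, inferInstance, inferInstance, inferInstance, fun s hs => ?_⟩
  rw [← SignedMeasure.apply_eq_posPart_real_sub_negPart_real _ hs,
    ← SignedMeasure.apply_eq_posPart_real_sub_negPart_real _ hs]
  apply Complex.ext
  · simp only [Complex.add_re, Complex.ofReal_re, Complex.mul_re, Complex.I_re, Complex.I_im,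
      Complex.ofReal_im]
    ring_nf
    rfl
  · simp only [Complex.add_im, Complex.ofReal_re, Complex.mul_im, Complex.I_re, Complex.I_im,
      Complex.ofReal_im]
    ring_nf
    rfl

theorem laplaceTransform_eq (μ : ComplexMeasure ℝ≥0) (a b c d : Measure ℝ≥0)
    [IsFiniteMeasure a] [IsFiniteMeasure b] [IsFiniteMeasure c] [IsFiniteMeasure d]
    (h : ∀ s, MeasurableSet s →
      μ s = ((a.real s - b.real s : ℝ) : ℂ) + Complex.I * ((c.real s - d.real s : ℝ) : ℂ))
    {z : ℂ} (hz : 0 ≤ z.re) :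
    laplaceTransform μ z =
      (laplace a z - laplace b z) + Complex.I * (laplace c z - laplace d z) := by
  have hB : ContinuousLinearMap.mul ℝ ℂ = smulPairing ℂ := by
    ext x y
    simp [smulPairing, mul_comm]
  rw [laplaceTransform, hB, integral_smulPairing μ a b c d h
    (continuous_exp_neg_mul z).stronglyMeasurable (norm_exp_neg_mul_le hz)]
  rfl

theorem BoundedC0Semigroup.hillePhillips_eq (T : BoundedC0Semigroup E) (μ : ComplexMeasure ℝ≥0)
    (a b c d : Measure ℝ≥0)
    [IsFiniteMeasure a] [IsFiniteMeasure b] [IsFiniteMeasure c] [IsFiniteMeasure d]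
    (h : ∀ s, MeasurableSet s →
      μ s = ((a.real s - b.real s : ℝ) : ℂ) + Complex.I * ((c.real s - d.real s : ℝ) : ℂ))
    (x : E) :
    T.hillePhillips μ x =
      (T.average a x - T.average b x) + Complex.I • (T.average c x - T.average d x) :=
  integral_smulPairing μ a b c d h (T.strongly_continuous x).stronglyMeasurable
    (T.norm_orbit_le · x)

/-- The difference of two finite positive measures, as a complex measure. -/
noncomputable def complexMeasureSub (p q : Measure ℝ≥0) [IsFiniteMeasure p] [IsFiniteMeasure q] :
    ComplexMeasure ℝ≥0 :=
  (p.toSignedMeasure - q.toSignedMeasure).toComplexMeasure 0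

theorem complexMeasureSub_apply (p q : Measure ℝ≥0) [IsFiniteMeasure p] [IsFiniteMeasure q]
    (s : Set ℝ≥0) (hs : MeasurableSet s) : complexMeasureSub p q s =
      ((p.real s - q.real s : ℝ) : ℂ) + Complex.I *
        (((0 : Measure ℝ≥0).real s - (0 : Measure ℝ≥0).real s : ℝ) : ℂ) := by
  rw [complexMeasureSub, SignedMeasure.toComplexMeasure_apply, Measure.toSignedMeasure_sub_apply hs]
  apply Complex.ext <;> simp

theorem laplaceTransform_complexMeasureSub (p q : Measure ℝ≥0) [IsFiniteMeasure p]
    [IsFiniteMeasure q] {z : ℂ} (hz : 0 ≤ z.re) :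
    laplaceTransform (complexMeasureSub p q) z = laplace p z - laplace q z := by
  rw [laplaceTransform_eq _ p q 0 0 (complexMeasureSub_apply p q) hz]
  simp

theorem BoundedC0Semigroup.hillePhillips_complexMeasureSub (T : BoundedC0Semigroup E)
    (p q : Measure ℝ≥0) [IsFiniteMeasure p] [IsFiniteMeasure q] (x : E) :
    T.hillePhillips (complexMeasureSub p q) x = T.average p x - T.average q x := by
  rw [T.hillePhillips_eq _ p q 0 0 (complexMeasureSub_apply p q)]
  simp

end ComplexMeasureIntegral

/-! ### From identities of Laplace transforms to identities of operators -/

namespace BoundedC0Semigroup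

variable {X : Type*} [NormedAddCommGroup X] [NormedSpace ℂ X] [CompleteSpace X]

/-- An identity `(p₁ - p₂)^ (a - b)^ = (q₁ - q₂)^ (c - d)^` between Laplace transforms carries over
to the averages of the semigroup. -/
theorem average_mul_eq (T : BoundedC0Semigroup X) (p₁ p₂ q₁ q₂ a b c d : Measure ℝ≥0)
    [IsFiniteMeasure p₁] [IsFiniteMeasure p₂] [IsFiniteMeasure q₁] [IsFiniteMeasure q₂]
    [IsFiniteMeasure a] [IsFiniteMeasure b] [IsFiniteMeasure c] [IsFiniteMeasure d]
    (h : ∀ r : ℝ, 0 < r → (laplace p₁ r - laplace p₂ r) * (laplace a r - laplace b r) =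
      (laplace q₁ r - laplace q₂ r) * (laplace c r - laplace d r)) (x : X) :
    (T.average p₁ - T.average p₂) (T.average a x - T.average b x) =
      (T.average q₁ - T.average q₂) (T.average c x - T.average d x) := by
  -- With the negative terms moved across, both sides are positive measures and uniqueness of the
  -- Laplace transform applies.
  have e : p₁.conv a + p₂.conv b + (q₁.conv d + q₂.conv c) =
      q₁.conv c + q₂.conv d + (p₁.conv b + p₂.conv a) := by
    refine eq_of_laplace_eq _ _ fun r hr => ?_
    have hr' : 0 ≤ ((r : ℝ) : ℂ).re := by simpa using hr.le
    simp only [laplace_add _ _ hr', laplace_conv _ _ hr']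
    linear_combination h r hr
  have e' : T.average (p₁.conv a + p₂.conv b + (q₁.conv d + q₂.conv c)) x =
      T.average (q₁.conv c + q₂.conv d + (p₁.conv b + p₂.conv a)) x := by
    simp only [average_apply]
    rw [e]
  simp only [average_add, average_conv] at e'
  simp only [sub_apply, _root_.map_sub]
  rw [← sub_eq_zero] at e' ⊢
  rw [← e']
  abel

/-- If `(q₁ - q₂)^ g = (p₁ - p₂)^` pointwise and `R` regularizes `g`, then
`(q₁ - q₂)(A) x = (p₁ - p₂)(A) g(A)⁻¹`-type identities hold on `dom g(A)`. -/
theorem Regularizer.average_apply_eq {T : BoundedC0Semigroup X} {g : ℂ → ℂ} (R : T.Regularizer g)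
    (p₁ p₂ q₁ q₂ : Measure ℝ≥0) [IsFiniteMeasure p₁] [IsFiniteMeasure p₂] [IsFiniteMeasure q₁]
    [IsFiniteMeasure q₂]
    (h : ∀ r : ℝ, 0 < r → (laplace p₁ r - laplace p₂ r) * g r = laplace q₁ r - laplace q₂ r)
    (x : R.apply.domain) :
    T.average q₁ x - T.average q₂ x = (T.average p₁ - T.average p₂) (R.apply x) := by
  obtain ⟨a, b, c, d, _, _, _, _, hμ⟩ := ComplexMeasure.exists_decomposition R.μ
  obtain ⟨a', b', c', d', _, _, _, _, hν⟩ := ComplexMeasure.exists_decomposition R.ν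
  -- On the real axis the transforms of positive measures are real, so the complex identity `p̂ ν̂ =
  -- q̂ μ̂` splits into one for the real parts and one for the imaginary parts of `μ` and `ν`.
  have key : ∀ r : ℝ, 0 < r →
      (laplace p₁ r - laplace p₂ r) * (laplace a' r - laplace b' r) =
        (laplace q₁ r - laplace q₂ r) * (laplace a r - laplace b r) ∧
      (laplace p₁ r - laplace p₂ r) * (laplace c' r - laplace d' r) =
        (laplace q₁ r - laplace q₂ r) * (laplace c r - laplace d r) := by
    intro r hr
    have hr' : 0 ≤ ((r : ℝ) : ℂ).re := by simpa using hr.le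
    have h1 := R.laplace_eq r (by simpa using hr)
    rw [laplaceTransform_eq _ _ _ _ _ hμ hr', laplaceTransform_eq _ _ _ _ _ hν hr'] at h1
    have h2 : (laplace p₁ r - laplace p₂ r) *
        ((laplace a' r - laplace b' r) + Complex.I * (laplace c' r - laplace d' r)) =
        (laplace q₁ r - laplace q₂ r) *
        ((laplace a r - laplace b r) + Complex.I * (laplace c r - laplace d r)) := by
      rw [h1, ← h r hr]
      ring
    have re := congrArg Complex.re h2
    have im := congrArg Complex.im h2
    simp only [Complex.mul_re, Complex.mul_im, Complex.add_re, Complex.add_im, Complex.sub_re,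
      Complex.sub_im, Complex.I_re, Complex.I_im, laplace_ofReal_im] at re im
    constructor <;> apply Complex.ext <;>
      simp only [Complex.mul_re, Complex.mul_im, Complex.sub_re, Complex.sub_im,
        laplace_ofReal_im] <;> linarith
  -- With `y = g(A) x`: `μ(A) q(A) x = q(A) μ(A) x = p(A) ν(A) x = p(A) μ(A) y = μ(A) p(A) y`, and
  -- `μ(A)` is cancelled. This works for any regularizer, so independence of its choice is not
  -- needed.
  apply R.injective
  have hR := (R.apply_eq_iff x _).1 rfl
  have k1 := T.average_mul_eq p₁ p₂ q₁ q₂ a' b' a b fun r hr => (key r hr).1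
  have k2 := T.average_mul_eq p₁ p₂ q₁ q₂ c' d' c d fun r hr => (key r hr).2
  have comm1 : ∀ y, (T.average p₁ - T.average p₂) (T.average a y - T.average b y) =
      (T.average a - T.average b) (T.average p₁ y - T.average p₂ y) :=
    T.average_mul_eq p₁ p₂ a b a b p₁ p₂ fun r _ => mul_comm _ _
  have comm2 : ∀ y, (T.average p₁ - T.average p₂) (T.average c y - T.average d y) =
      (T.average c - T.average d) (T.average p₁ y - T.average p₂ y) :=
    T.average_mul_eq p₁ p₂ c d c d p₁ p₂ fun r _ => mul_comm _ _
  have comm3 : ∀ y, (T.average q₁ - T.average q₂) (T.average a y - T.average b y) =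
      (T.average a - T.average b) (T.average q₁ y - T.average q₂ y) :=
    T.average_mul_eq q₁ q₂ a b a b q₁ q₂ fun r _ => mul_comm _ _
  have comm4 : ∀ y, (T.average q₁ - T.average q₂) (T.average c y - T.average d y) =
      (T.average c - T.average d) (T.average q₁ y - T.average q₂ y) :=
    T.average_mul_eq q₁ q₂ c d c d q₁ q₂ fun r _ => mul_comm _ _
  have hμ' : ∀ y, T.hillePhillips R.μ y =
      (T.average a - T.average b) y + Complex.I • (T.average c - T.average d) y :=
    fun y => T.hillePhillips_eq _ _ _ _ _ hμ y
  rw [T.hillePhillips_eq _ _ _ _ _ hν] at hR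
  have hR2 := congrArg (T.average p₁ - T.average p₂) hR
  rw [hμ', _root_.map_add, _root_.map_add, _root_.map_smul, _root_.map_smul, k1, k2] at hR2
  rw [hμ', hμ', ← comm3, ← comm4]
  simp only [sub_apply] at hR2 comm1 comm2 ⊢
  rw [← comm1, ← comm2, hR2]

/-- A quotient of differences of finite measures is regularizable as soon as the denominator is
injective. -/
noncomputable def Regularizer.ofMeasures (T : BoundedC0Semigroup X) {g : ℂ → ℂ}
    (hg : DifferentiableOn ℂ g {z | 0 < z.re}) (p₁ p₂ q₁ q₂ : Measure ℝ≥0) [IsFiniteMeasure p₁]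
    [IsFiniteMeasure p₂] [IsFiniteMeasure q₁] [IsFiniteMeasure q₂]
    (h : ∀ z : ℂ, 0 < z.re →
      laplace q₁ z - laplace q₂ z = (laplace p₁ z - laplace p₂ z) * g z)
    (hinj : Function.Injective fun x => T.average p₁ x - T.average p₂ x) : T.Regularizer g where
  μ := complexMeasureSub p₁ p₂
  ν := complexMeasureSub q₁ q₂
  holomorphic := hg
  laplace_eq z hz := by
    rw [laplaceTransform_complexMeasureSub _ _ hz.le, laplaceTransform_complexMeasureSub _ _ hz.le,
      h z hz]
  injective := by
    convert hinj using 1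
    exact funext fun x => T.hillePhillips_complexMeasureSub p₁ p₂ x

end BoundedC0Semigroup

/-! ### The algebra of Laplace transforms with a mass bound -/

section LaplaceBound

/-- `F` is, on the open right half-plane, the Laplace transform of a difference of two finite
positive measures of joint mass at most `C`. -/
def LaplaceBound (F : ℂ → ℂ) (C : ℝ) : Prop :=
  ∃ (p q : Measure ℝ≥0) (_ : IsFiniteMeasure p) (_ : IsFiniteMeasure q),
    p.real Set.univ + q.real Set.univ ≤ C ∧ ∀ z : ℂ, 0 < z.re → F z = laplace p z - laplace q z

namespace LaplaceBound

variable {F G : ℂ → ℂ} {C D : ℝ}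

theorem nonneg (h : LaplaceBound F C) : 0 ≤ C := by
  obtain ⟨p, q, _, _, hC, -⟩ := h
  exact (add_nonneg measureReal_nonneg measureReal_nonneg).trans hC

theorem norm_le (h : LaplaceBound F C) {z : ℂ} (hz : 0 < z.re) : ‖F z‖ ≤ C := by
  obtain ⟨p, q, _, _, hC, hF⟩ := h
  rw [hF z hz]
  exact (norm_sub_le _ _).trans
    ((add_le_add (norm_laplace_le p hz.le) (norm_laplace_le q hz.le)).trans hC)

theorem mono (h : LaplaceBound F C) (hCD : C ≤ D) : LaplaceBound F D := by
  obtain ⟨p, q, hp, hq, hC, hF⟩ := h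
  exact ⟨p, q, hp, hq, hC.trans hCD, hF⟩

theorem congr (h : LaplaceBound F C) (hFG : ∀ z : ℂ, 0 < z.re → F z = G z) :
    LaplaceBound G C := by
  obtain ⟨p, q, hp, hq, hC, hF⟩ := h
  exact ⟨p, q, hp, hq, hC, fun z hz => (hFG z hz).symm.trans (hF z hz)⟩

theorem add (hF : LaplaceBound F C) (hG : LaplaceBound G D) :
    LaplaceBound (fun z => F z + G z) (C + D) := by
  obtain ⟨p, q, _, _, hC, hF⟩ := hF
  obtain ⟨p', q', _, _, hD, hG⟩ := hG
  refine ⟨p + p', q + q', inferInstance, inferInstance, ?_, fun z hz => ?_⟩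
  · rw [measureReal_add_apply, measureReal_add_apply]
    linarith
  · beta_reduce
    rw [hF z hz, hG z hz, laplace_add _ _ hz.le, laplace_add _ _ hz.le]
    ring

theorem neg (hF : LaplaceBound F C) : LaplaceBound (fun z => -F z) C := by
  obtain ⟨p, q, hp, hq, hC, hF⟩ := hF
  refine ⟨q, p, hq, hp, (add_comm _ _).trans_le hC, fun z hz => ?_⟩
  beta_reduce
  rw [hF z hz]
  ring

theorem sub (hF : LaplaceBound F C) (hG : LaplaceBound G D) :
    LaplaceBound (fun z => F z - G z) (C + D) :=
  (hF.add hG.neg).congr fun _ _ => (sub_eq_add_neg _ _).symm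

theorem smul_of_nonneg (hF : LaplaceBound F C) {c : ℝ} (hc : 0 ≤ c) :
    LaplaceBound (fun z => (c : ℂ) * F z) (c * C) := by
  obtain ⟨p, q, _, _, hC, hF⟩ := hF
  lift c to ℝ≥0 using hc
  refine ⟨c • p, c • q, inferInstance, inferInstance, ?_, fun z hz => ?_⟩
  · simp only [measureReal_nnreal_smul_apply]
    rw [← mul_add]
    exact mul_le_mul_of_nonneg_left hC c.2
  · beta_reduce
    rw [hF z hz, laplace_smul, laplace_smul]
    ring

theorem measureReal_conv_univ (p q : Measure ℝ≥0) [IsFiniteMeasure p] [IsFiniteMeasure q] :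
    (p.conv q).real Set.univ = p.real Set.univ * q.real Set.univ := by
  rw [Measure.conv, measureReal_def, Measure.map_apply (by fun_prop) MeasurableSet.univ,
    Set.preimage_univ, ← Set.univ_prod_univ, Measure.prod_prod, ENNReal.toReal_mul]
  rfl

/-- The convolution `(p - q) * (p' - q')` is sorted by sign; masses multiply. -/
theorem mul (hF : LaplaceBound F C) (hG : LaplaceBound G D) :
    LaplaceBound (fun z => F z * G z) (C * D) := by
  have hC0 := hF.nonneg
  obtain ⟨p, q, _, _, hC, hF⟩ := hF
  obtain ⟨p', q', _, _, hD, hG⟩ := hG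
  refine ⟨p.conv p' + q.conv q', p.conv q' + q.conv p', inferInstance, inferInstance, ?_,
    fun z hz => ?_⟩
  · rw [measureReal_add_apply, measureReal_add_apply]
    simp only [measureReal_conv_univ]
    calc _ = (p.real Set.univ + q.real Set.univ) * (p'.real Set.univ + q'.real Set.univ) := by ring
      _ ≤ _ := mul_le_mul hC hD (by positivity) hC0
  · beta_reduce
    rw [laplace_add _ _ hz.le, laplace_add _ _ hz.le, laplace_conv _ _ hz.le,
      laplace_conv _ _ hz.le, laplace_conv _ _ hz.le, laplace_conv _ _ hz.le, hF z hz, hG z hz]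
    ring

theorem exp_neg_mul (t : ℝ≥0) : LaplaceBound (fun z => Complex.exp (-((t : ℂ) * z))) 1 := by
  refine ⟨Measure.dirac t, 0, inferInstance, inferInstance, by simp, fun z _ => ?_⟩
  rw [laplace_dirac]
  simp [laplace]

theorem one : LaplaceBound (fun _ => 1) 1 :=
  (exp_neg_mul 0).congr fun z _ => by simp

theorem const {c : ℝ} (hc : 0 ≤ c) : LaplaceBound (fun _ => (c : ℂ)) c := by
  simpa using one.smul_of_nonneg hc

theorem zero : LaplaceBound (fun _ => 0) 0 := by
  simpa using const le_rfl

theorem pow (hF : LaplaceBound F C) (n : ℕ) : LaplaceBound (fun z => F z ^ n) (C ^ n) := by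
  induction n with
  | zero => simpa using one
  | succ n ih => simpa only [pow_succ] using ih.mul hF

theorem finset_sum {ι : Type*} (s : Finset ι) {F : ι → ℂ → ℂ} {C : ι → ℝ}
    (h : ∀ i ∈ s, LaplaceBound (F i) (C i)) :
    LaplaceBound (fun z => ∑ i ∈ s, F i z) (∑ i ∈ s, C i) := by
  classical
  induction s using Finset.induction_on with
  | empty => simpa using zero
  | insert i s hi ih =>
    simp only [Finset.sum_insert hi]
    exact (h i (Finset.mem_insert_self i s)).add
      (ih fun j hj => h j (Finset.mem_insert_of_mem hj))

/-- Summable masses make the sums of the positive and of the negative parts finite measures. This is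
the only form of completeness needed: limits are taken as telescoping series. -/
theorem hasSum {F : ℕ → ℂ → ℂ} {C : ℕ → ℝ} (h : ∀ k, LaplaceBound (F k) (C k))
    (hC : Summable C) (hG : ∀ z : ℂ, 0 < z.re → HasSum (fun k => F k z) (G z)) :
    LaplaceBound G (∑' k, C k) := by
  choose p q hp hq hpq hF using h
  have hpC : Summable fun k => (p k).real Set.univ :=
    hC.of_nonneg_of_le (fun _ => measureReal_nonneg) fun k =>
      (le_add_of_nonneg_right measureReal_nonneg).trans (hpq k)
  have hqC : Summable fun k => (q k).real Set.univ :=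
    hC.of_nonneg_of_le (fun _ => measureReal_nonneg) fun k =>
      (le_add_of_nonneg_left measureReal_nonneg).trans (hpq k)
  have mass : ∀ r : ℕ → Measure ℝ≥0, (∀ k, IsFiniteMeasure (r k)) →
      Summable (fun k => (r k).real Set.univ) →
      (Measure.sum r) Set.univ = ENNReal.ofReal (∑' k, (r k).real Set.univ) := by
    intro r _ hr
    rw [Measure.sum_apply _ MeasurableSet.univ,
      ENNReal.ofReal_tsum_of_nonneg (fun _ => measureReal_nonneg) hr]
    exact tsum_congr fun k => (ofReal_measureReal (measure_ne_top _ _)).symm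
  have hpf : IsFiniteMeasure (Measure.sum p) := ⟨by rw [mass p hp hpC]; exact ENNReal.ofReal_lt_top⟩
  have hqf : IsFiniteMeasure (Measure.sum q) := ⟨by rw [mass q hq hqC]; exact ENNReal.ofReal_lt_top⟩
  refine ⟨Measure.sum p, Measure.sum q, hpf, hqf, ?_, fun z hz => ?_⟩
  · rw [measureReal_def, measureReal_def, mass p hp hpC, mass q hq hqC,
      ENNReal.toReal_ofReal (tsum_nonneg fun _ => measureReal_nonneg),
      ENNReal.toReal_ofReal (tsum_nonneg fun _ => measureReal_nonneg), ← hpC.tsum_add hqC]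
    exact (hpC.add hqC).tsum_le_tsum hpq hC
  · have h1 : HasSum (fun k => laplace (p k) z) (laplace (Measure.sum p) z) :=
      hasSum_integral_measure (integrable_exp_neg_mul _ hz.le)
    have h2 : HasSum (fun k => laplace (q k) z) (laplace (Measure.sum q) z) :=
      hasSum_integral_measure (integrable_exp_neg_mul _ hz.le)
    refine (hG z hz).unique ((h1.sub h2).congr_fun ?_)
    exact fun k => hF k z hz

/-- Signed mixtures of exponentials. -/
theorem integral_mul_exp {Ω : Type*} [MeasurableSpace Ω] {P : Measure Ω} {w : Ω → ℝ}
    (hw : Measurable w) (hwi : Integrable w P) {φ : Ω → ℝ≥0} (hφ : Measurable φ) :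
    LaplaceBound (fun z => ∫ ω, (w ω : ℂ) * Complex.exp (-((φ ω : ℂ) * z)) ∂P) (∫ ω, |w ω| ∂P) := by
  -- The two measures are the images under `φ` of `P` weighted with the positive and the negative
  -- part of `w`.
  have fin : ∀ v : Ω → ℝ, Integrable v P →
      IsFiniteMeasure (P.withDensity fun ω => ((v ω).toNNReal : ℝ≥0∞)) :=
    fun v hv => isFiniteMeasure_withDensity_ofReal hv.2
  have f1 := fin w hwi
  have f2 := fin (fun ω => -w ω) hwi.neg
  have mass : ∀ v : Ω → ℝ, Measurable v → Integrable v P →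
      ((P.withDensity fun ω => ((v ω).toNNReal : ℝ≥0∞)).map φ).real Set.univ =
        ∫ ω, ((v ω).toNNReal : ℝ) ∂P := by
    intro v hv hvi
    have := fin v hvi
    rw [measureReal_def, Measure.map_apply hφ MeasurableSet.univ, Set.preimage_univ,
      ← measureReal_def]
    have := integral_withDensity_eq_integral_smul (μ := P) hv.real_toNNReal (fun _ => (1 : ℝ))
    simpa [NNReal.smul_def] using this
  have lap : ∀ v : Ω → ℝ, Measurable v → ∀ z,
      laplace ((P.withDensity fun ω => ((v ω).toNNReal : ℝ≥0∞)).map φ) z =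
        ∫ ω, (((v ω).toNNReal : ℝ) : ℂ) * Complex.exp (-((φ ω : ℂ) * z)) ∂P := by
    intro v hv z
    rw [laplace_map _ hφ, integral_withDensity_eq_integral_smul hv.real_toNNReal]
    rfl
  have split : ∀ a : ℝ, ((a.toNNReal : ℝ) : ℂ) - (((-a).toNNReal : ℝ) : ℂ) = (a : ℂ) := by
    intro a
    rw [← Complex.ofReal_sub]
    congr 1
    simp [max_zero_sub_max_neg_zero_eq_self]
  have int : ∀ v : Ω → ℝ, Measurable v → Integrable v P → ∀ z : ℂ, 0 < z.re → Integrable (fun ω =>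
      (((v ω).toNNReal : ℝ) : ℂ) * Complex.exp (-((φ ω : ℂ) * z))) P := by
    intro v hv hvi z hz
    refine hvi.norm.mono' (Measurable.aestronglyMeasurable (by fun_prop)) (ae_of_all _ fun ω => ?_)
    rw [norm_mul, Complex.norm_real]
    refine (mul_le_of_le_one_right (norm_nonneg _) (norm_exp_neg_mul_le hz.le _)).trans ?_
    rw [Real.norm_of_nonneg (NNReal.coe_nonneg _), Real.coe_toNNReal']
    exact max_le (le_abs_self _) (abs_nonneg _)
  refine ⟨(P.withDensity fun ω => ((w ω).toNNReal : ℝ≥0∞)).map φ,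
    (P.withDensity fun ω => ((-w ω).toNNReal : ℝ≥0∞)).map φ,
    Measure.isFiniteMeasure_map _ φ, Measure.isFiniteMeasure_map _ φ, ?_, fun z hz => ?_⟩
  · rw [mass w hw hwi, mass (fun ω => -w ω) hw.neg hwi.neg, ← integral_add]
    · refine (integral_congr_ae (ae_of_all _ fun ω => ?_)).le
      simp only [Real.coe_toNNReal']
      rcases le_total 0 (w ω) with h | h
      · simp [h, abs_of_nonneg]
      · simp [h, abs_of_nonpos]
    · exact hwi.real_toNNReal
    · exact hwi.neg.real_toNNReal
  · rw [lap w hw, lap (fun ω => -w ω) hw.neg, ← integral_sub (int w hw hwi z hz)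
      (int (fun ω => -w ω) hw.neg hwi.neg z hz)]
    refine integral_congr_ae (ae_of_all _ fun ω => ?_)
    simp only
    rw [← sub_mul, split]

end LaplaceBound

/-- The standard exponential distribution on `[0,∞)`. -/
noncomputable def stdExp : Measure ℝ≥0 :=
  ((volume.restrict (Set.Ioi (0 : ℝ))).withDensity
    fun x => ((Real.exp (-x)).toNNReal : ℝ≥0∞)).map Real.toNNReal

theorem integral_stdExp {E : Type*} [NormedAddCommGroup E] [NormedSpace ℝ E] {f : ℝ≥0 → E}
    (hf : StronglyMeasurable f) :
    ∫ s, f s ∂stdExp = ∫ x in Set.Ioi (0 : ℝ), Real.exp (-x) • f x.toNNReal := by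
  rw [stdExp, integral_map measurable_real_toNNReal.aemeasurable hf.aestronglyMeasurable,
    integral_withDensity_eq_integral_smul (by fun_prop)]
  refine integral_congr_ae (ae_of_all _ fun x => ?_)
  simp only [NNReal.smul_def]
  rw [Real.coe_toNNReal _ (Real.exp_pos _).le]

instance : IsProbabilityMeasure stdExp := by
  refine @Measure.isProbabilityMeasure_map _ _ _ _ _ ⟨?_⟩ _ measurable_real_toNNReal.aemeasurable
  rw [withDensity_apply _ MeasurableSet.univ, Measure.restrict_univ]
  change ∫⁻ x in Set.Ioi (0 : ℝ), ENNReal.ofReal (Real.exp (-x)) = 1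
  rw [← ofReal_integral_eq_lintegral_ofReal, integral_exp_neg_Ioi_zero, ENNReal.ofReal_one]
  · exact integrableOn_exp_neg_Ioi 0
  · exact ae_of_all _ fun x => (Real.exp_pos _).le

theorem laplace_stdExp {w : ℂ} (hw : 0 ≤ w.re) : laplace stdExp w = (1 + w)⁻¹ := by
  rw [laplace, integral_stdExp (continuous_exp_neg_mul w).stronglyMeasurable]
  have : ∀ x ∈ Set.Ioi (0 : ℝ), Real.exp (-x) • Complex.exp (-(((x.toNNReal : ℝ≥0) : ℂ) * w)) =
      Complex.exp (-(1 + w) * x) := by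
    intro x hx
    rw [Complex.real_smul, Complex.ofReal_exp, ← Complex.exp_add]
    congr 1
    have : ((x.toNNReal : ℝ≥0) : ℂ) = (x : ℂ) := by
      have := Real.coe_toNNReal x (le_of_lt hx)
      exact_mod_cast this
    rw [this]
    push_cast
    ring
  rw [setIntegral_congr_fun measurableSet_Ioi this,
    integral_exp_mul_complex_Ioi (by simp; linarith), Complex.ofReal_zero, mul_zero,
    Complex.exp_zero, neg_div_neg_eq, one_div]

/-- Mixtures of the functions `τ / (τ + z)`. -/
theorem LaplaceBound.integral_div_add (P : Measure ℝ≥0) [IsFiniteMeasure P] (hP : P {0} = 0) :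
    LaplaceBound (fun z => ∫ τ : ℝ≥0, (τ : ℂ) / (τ + z) ∂P) (P.real Set.univ) := by
  -- For a standard exponential variable `S`, `τ/(τ+z)` is the expectation of `e^{-(S/τ)z}`. At `τ =
  -- 0` the quotient has the default value `0`, but `hP` makes that point negligible.
  have h := LaplaceBound.integral_mul_exp (P := P.prod stdExp) (w := fun _ => 1) measurable_const
    (integrable_const _) (φ := fun ω => ω.2 / ω.1) (by fun_prop)
  simp only [abs_one, integral_const, smul_eq_mul, mul_one, Complex.ofReal_one, one_mul] at h
  refine (h.mono (le_of_eq ?_)).congr fun z hz => ?_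
  · rw [← Set.univ_prod_univ, measureReal_prod_prod]
    simp
  · rw [integral_prod]
    · have : ∀ᵐ τ ∂P, τ ≠ 0 := by
        rw [ae_iff]
        simpa using hP
      refine integral_congr_ae (this.mono fun τ hτ => ?_)
      have hτ' : (0 : ℝ) < τ := NNReal.coe_pos.2 (pos_iff_ne_zero.2 hτ)
      have hτc : ((τ : ℝ) : ℂ) ≠ 0 := by exact_mod_cast hτ'.ne'
      have e : ∀ s : ℝ≥0, Complex.exp (-(((s / τ : ℝ≥0) : ℂ) * z)) =
          Complex.exp (-((s : ℂ) * (z / τ))) := by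
        intro s
        congr 1
        push_cast
        ring
      simp only [e]
      have hre : 0 ≤ (z / (τ : ℂ)).re := by
        have : (z / ((τ : ℝ) : ℂ)).re = z.re / τ := Complex.div_ofReal_re _ _
        rw [this]
        positivity
      refine (laplace_stdExp hre).trans ?_
      have hne : ((τ : ℝ) : ℂ) + z ≠ 0 := by
        intro h0
        have := congrArg Complex.re h0
        simp at this
        linarith
      field_simp
    · refine Integrable.of_bound (C := 1) (Measurable.aestronglyMeasurable (by fun_prop))
        (ae_of_all _ fun ω => norm_exp_neg_mul_le hz.le _)

end LaplaceBound

/-! ### Exponential and gamma distributions: transform, mean, variance -/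

section GammaDistribution

/-- The exponential distribution with mean `h`. -/
noncomputable def expDist (h : ℝ≥0) : Measure ℝ≥0 := stdExp.map fun s => h * s

instance (h : ℝ≥0) : IsProbabilityMeasure (expDist h) :=
  Measure.isProbabilityMeasure_map (by fun_prop)

/-- The `n`-fold convolution power of the exponential distribution with mean `h`. -/
noncomputable def gammaDist (h : ℝ≥0) : ℕ → Measure ℝ≥0
  | 0 => Measure.dirac 0
  | n + 1 => (expDist h).conv (gammaDist h n)

instance instIsProbabilityMeasureGammaDist (h : ℝ≥0) : ∀ n, IsProbabilityMeasure (gammaDist h n)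
  | 0 => inferInstanceAs (IsProbabilityMeasure (Measure.dirac 0))
  | n + 1 => by
    have := instIsProbabilityMeasureGammaDist h n
    exact inferInstanceAs (IsProbabilityMeasure ((expDist h).conv (gammaDist h n)))

theorem laplace_expDist (h : ℝ≥0) {z : ℂ} (hz : 0 ≤ z.re) :
    laplace (expDist h) z = (1 + h * z)⁻¹ := by
  have hw : 0 ≤ ((h : ℂ) * z).re := by simpa using mul_nonneg h.2 hz
  rw [expDist, laplace_map _ (by fun_prop), ← laplace_stdExp hw, laplace]
  refine integral_congr_ae (ae_of_all _ fun s => ?_)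
  simp only
  congr 1
  push_cast
  ring

theorem laplace_gammaDist (h : ℝ≥0) (n : ℕ) {z : ℂ} (hz : 0 ≤ z.re) :
    laplace (gammaDist h n) z = (1 + h * z)⁻¹ ^ n := by
  induction n with
  | zero => simp [gammaDist, laplace_dirac]
  | succ n ih => rw [gammaDist, laplace_conv _ _ hz, ih, laplace_expDist h hz, pow_succ']

/-- A probability measure on `[0,∞)` with mean `m` and variance `v`. -/
structure HasMeanVariance (p : Measure ℝ≥0) (m v : ℝ) : Prop where
  integrable : Integrable (fun s : ℝ≥0 => (s : ℝ)) p
  integrable_sq : Integrable (fun s : ℝ≥0 => (s : ℝ) ^ 2) p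
  mean : ∫ s : ℝ≥0, (s : ℝ) ∂p = m
  sq : ∫ s : ℝ≥0, (s : ℝ) ^ 2 ∂p = v + m ^ 2

theorem HasMeanVariance.conv {p q : Measure ℝ≥0} [IsProbabilityMeasure p] [IsProbabilityMeasure q]
    {m v m' v' : ℝ} (hp : HasMeanVariance p m v) (hq : HasMeanVariance q m' v') :
    HasMeanVariance (p.conv q) (m + m') (v + v') := by
  have hm : Measurable fun x : ℝ≥0 × ℝ≥0 => x.1 + x.2 := by fun_prop
  have c1 : Integrable (fun ω : ℝ≥0 × ℝ≥0 => (ω.1 : ℝ)) (p.prod q) := hp.integrable.comp_fst q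
  have c2 : Integrable (fun ω : ℝ≥0 × ℝ≥0 => (ω.2 : ℝ)) (p.prod q) := hq.integrable.comp_snd p
  have c3 : Integrable (fun ω : ℝ≥0 × ℝ≥0 => (ω.1 : ℝ) ^ 2) (p.prod q) :=
    hp.integrable_sq.comp_fst q
  have c4 : Integrable (fun ω : ℝ≥0 × ℝ≥0 => (ω.2 : ℝ) ^ 2) (p.prod q) :=
    hq.integrable_sq.comp_snd p
  have c5 : Integrable (fun ω : ℝ≥0 × ℝ≥0 => 2 * ((ω.1 : ℝ) * (ω.2 : ℝ))) (p.prod q) :=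
    (hp.integrable.mul_prod hq.integrable).const_mul 2
  have c35 : Integrable (fun ω : ℝ≥0 × ℝ≥0 => (ω.1 : ℝ) ^ 2 + 2 * ((ω.1 : ℝ) * (ω.2 : ℝ)))
      (p.prod q) := c3.add c5
  have e : (fun ω : ℝ≥0 × ℝ≥0 => ((ω.1 + ω.2 : ℝ≥0) : ℝ) ^ 2) =
      fun ω => (ω.1 : ℝ) ^ 2 + 2 * ((ω.1 : ℝ) * (ω.2 : ℝ)) + (ω.2 : ℝ) ^ 2 := by
    funext ω
    push_cast
    ring
  have m1 : AEStronglyMeasurable (fun s : ℝ≥0 => (s : ℝ))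
      ((p.prod q).map fun x : ℝ≥0 × ℝ≥0 => x.1 + x.2) :=
    Measurable.aestronglyMeasurable (by fun_prop)
  have m2 : AEStronglyMeasurable (fun s : ℝ≥0 => (s : ℝ) ^ 2)
      ((p.prod q).map fun x : ℝ≥0 × ℝ≥0 => x.1 + x.2) :=
    Measurable.aestronglyMeasurable (by fun_prop)
  refine ⟨?_, ?_, ?_, ?_⟩
  · rw [Measure.conv, integrable_map_measure m1 hm.aemeasurable]
    exact (c1.add c2).congr (ae_of_all _ fun ω => by simp)
  · rw [Measure.conv, integrable_map_measure m2 hm.aemeasurable, Function.comp_def, e]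
    exact c35.add c4
  · rw [Measure.conv, integral_map hm.aemeasurable m1]
    simp only [NNReal.coe_add]
    rw [integral_add c1 c2, integral_fun_fst (fun s : ℝ≥0 => (s : ℝ)),
      integral_fun_snd (fun s : ℝ≥0 => (s : ℝ)), hp.mean, hq.mean]
    simp
  · rw [Measure.conv, integral_map hm.aemeasurable m2, e, integral_add c35 c4, integral_add c3 c5, integral_fun_fst (fun s : ℝ≥0 => (s : ℝ) ^ 2),
      integral_fun_snd (fun s : ℝ≥0 => (s : ℝ) ^ 2), integral_const_mul,
      integral_prod_mul (fun s : ℝ≥0 => (s : ℝ)) (fun s : ℝ≥0 => (s : ℝ)), hp.mean, hq.mean,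
      hp.sq, hq.sq]
    simp
    ring

theorem integral_pow_mul_exp_neg (k : ℕ) :
    ∫ x in Set.Ioi (0 : ℝ), Real.exp (-x) * x ^ k = (k.factorial : ℝ) := by
  rw [← Real.Gamma_nat_eq_factorial, Real.Gamma_eq_integral (by positivity)]
  refine setIntegral_congr_fun measurableSet_Ioi fun x _ => ?_
  simp

theorem integral_pow_stdExp (k : ℕ) : ∫ s : ℝ≥0, (s : ℝ) ^ k ∂stdExp = (k.factorial : ℝ) := by
  rw [integral_stdExp (by fun_prop : Continuous _).stronglyMeasurable, ← integral_pow_mul_exp_neg]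
  refine setIntegral_congr_fun measurableSet_Ioi fun x hx => ?_
  simp [Real.coe_toNNReal x (le_of_lt hx)]

theorem integrable_pow_stdExp (k : ℕ) : Integrable (fun s : ℝ≥0 => (s : ℝ) ^ k) stdExp := by
  -- A non-integrable function has integral `0` by convention, so the nonzero value `k!` certifies
  -- integrability.
  refine Integrable.of_integral_ne_zero ?_
  rw [integral_pow_stdExp]
  positivity

theorem hasMeanVariance_expDist (h : ℝ≥0) : HasMeanVariance (expDist h) h (h ^ 2) := by
  have hm : Measurable fun s : ℝ≥0 => h * s := by fun_prop
  have i1 := (integrable_pow_stdExp 1).const_mul (h : ℝ)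
  have i2 := (integrable_pow_stdExp 2).const_mul ((h : ℝ) ^ 2)
  have m1 : AEStronglyMeasurable (fun s : ℝ≥0 => (s : ℝ)) (stdExp.map fun s => h * s) :=
    Measurable.aestronglyMeasurable (by fun_prop)
  have m2 : AEStronglyMeasurable (fun s : ℝ≥0 => (s : ℝ) ^ 2) (stdExp.map fun s => h * s) :=
    Measurable.aestronglyMeasurable (by fun_prop)
  refine ⟨?_, ?_, ?_, ?_⟩
  · rw [expDist, integrable_map_measure m1 hm.aemeasurable]
    simpa [Function.comp_def] using i1
  · rw [expDist, integrable_map_measure m2 hm.aemeasurable]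
    simpa [Function.comp_def, mul_pow] using i2
  · rw [expDist, integral_map hm.aemeasurable m1]
    simp only [NNReal.coe_mul, integral_const_mul]
    have := integral_pow_stdExp 1
    simp only [pow_one] at this
    simp [this]
  · rw [expDist, integral_map hm.aemeasurable m2]
    simp only [NNReal.coe_mul, mul_pow, integral_const_mul, integral_pow_stdExp]
    norm_num
    ring

theorem hasMeanVariance_gammaDist (h : ℝ≥0) (n : ℕ) :
    HasMeanVariance (gammaDist h n) (n * h) (n * h ^ 2) := by
  induction n with
  | zero =>
    refine ⟨?_, ?_, ?_, ?_⟩ <;> simp [gammaDist, integrable_dirac]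
  | succ n ih =>
    have := (hasMeanVariance_expDist h).conv ih
    have e1 : ((n + 1 : ℕ) : ℝ) * h = h + n * h := by push_cast; ring
    have e2 : ((n + 1 : ℕ) : ℝ) * (h : ℝ) ^ 2 = (h : ℝ) ^ 2 + n * (h : ℝ) ^ 2 := by push_cast; ring
    rw [e1, e2]
    exact this

end GammaDistribution

/-! ### Resolvents and Euler approximants as averages -/

section Resolvent

variable {X : Type*} [NormedAddCommGroup X] [NormedSpace ℂ X]

theorem IsBoundedInverse.unique {B : X →ₗ.[ℂ] X} {R S : X →L[ℂ] X} (hR : IsBoundedInverse B R)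
    (hS : IsBoundedInverse B S) : R = S := by
  ext x
  obtain ⟨h, hx⟩ := hS.1 x
  have := hR.2 ⟨S x, h⟩
  rwa [hx] at this

theorem boundedInverse_eq {B : X →ₗ.[ℂ] X} {R : X →L[ℂ] X} (hR : IsBoundedInverse B R) :
    boundedInverse B = R := by
  have h : ∃ R, IsBoundedInverse B R := ⟨R, hR⟩
  rw [boundedInverse, dif_pos h]
  exact h.choose_spec.unique hR

namespace BoundedC0Semigroup

theorem op_comm (T : BoundedC0Semigroup X) (s t : ℝ≥0) (x : X) :
    T.op s (T.op t x) = T.op t (T.op s x) := by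
  rw [← ContinuousLinearMap.comp_apply, ← T.map_add, add_comm, T.map_add,
    ContinuousLinearMap.comp_apply]

theorem generator_hasOrbitDeriv (T : BoundedC0Semigroup X) (x : T.generator.domain) :
    T.HasOrbitDeriv x (T.generator x) :=
  Classical.choose_spec x.2

theorem HasOrbitDeriv.generator_eq {T : BoundedC0Semigroup X} {x y : X}
    (h : T.HasOrbitDeriv x y) : T.generator ⟨x, ⟨y, h⟩⟩ = y :=
  (T.generator_hasOrbitDeriv ⟨x, ⟨y, h⟩⟩).unique h

theorem average_expDist (T : BoundedC0Semigroup X) (h : ℝ≥0) (x : X) :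
    T.average (expDist h) x =
      ∫ s in Set.Ioi (0 : ℝ), Real.exp (-s) • T.op (h * s.toNNReal) x := by
  rw [average_apply, expDist, integral_map (by fun_prop)
    (T.strongly_continuous x).aestronglyMeasurable, integral_stdExp]
  exact ((T.strongly_continuous x).comp (by fun_prop)).stronglyMeasurable

variable [CompleteSpace X]

theorem op_average (T : BoundedC0Semigroup X) (p : Measure ℝ≥0) [IsFiniteMeasure p] (s : ℝ≥0)
    (x : X) : T.op s (T.average p x) = T.average p (T.op s x) := by
  rw [average_apply, average_apply, ← (T.op s).integral_comp_comm (T.integrable_op p x)]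
  exact integral_congr_ae (ae_of_all _ fun r => T.op_comm s r x)

/-- In `y = ∫₀^∞ e^{-s} T(hs)x ds`, applying `T(r)` shifts the lower limit to `r/h` and produces a
factor `e^{r/h}`. The formula `shift` is then differentiated at `r = 0` by the fundamental theorem
of calculus. -/
theorem hasOrbitDeriv_average_expDist (T : BoundedC0Semigroup X) {h : ℝ≥0} (hh : 0 < h) (x : X) :
    T.HasOrbitDeriv (T.average (expDist h) x)
      ((h : ℂ)⁻¹ • (T.average (expDist h) x - x)) := by
  have hh' : (0 : ℝ) < h := NNReal.coe_pos.2 hh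
  set y := T.average (expDist h) x with hy
  let u : ℝ → X := fun s => Real.exp (-s) • T.op (h * s.toNNReal) x
  have hu : Continuous u := by
    have := T.strongly_continuous x
    have h1 : Continuous fun s : ℝ => T.op (h * s.toNNReal) x := this.comp (by fun_prop)
    exact (by fun_prop : Continuous fun s : ℝ => Real.exp (-s)).smul h1
  have hui : IntegrableOn u (Set.Ioi 0) := by
    refine ((integrableOn_exp_neg_Ioi 0).const_mul (T.bound * ‖x‖)).mono'
      hu.aestronglyMeasurable (ae_of_all _ fun s => ?_)
    rw [norm_smul, Real.norm_eq_abs, Real.abs_exp, mul_comm]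
    exact mul_le_mul_of_nonneg_right (T.norm_orbit_le _ x) (Real.exp_pos _).le
  have shift : ∀ r : ℝ≥0, T.op r y =
      Real.exp ((r : ℝ) / h) • (y - ∫ s in (0 : ℝ)..((r : ℝ) / h), u s) := by
    intro r
    have hρ : (0 : ℝ) ≤ (r : ℝ) / h := by positivity
    have e1 : T.op r y = ∫ s in Set.Ioi (0 : ℝ), Real.exp (-s) • T.op (r + h * s.toNNReal) x := by
      rw [hy, op_average, average_expDist]
      refine setIntegral_congr_fun measurableSet_Ioi fun s _ => ?_
      rw [add_comm, T.map_add, ContinuousLinearMap.comp_apply]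
    have e2 : ∫ s in Set.Ioi ((r : ℝ) / h), u s =
        ∫ s in Set.Ioi (0 : ℝ), u (s + (r : ℝ) / h) := by
      have := (measurePreserving_add_right (volume : Measure ℝ) ((r : ℝ) / h)).setIntegral_preimage_emb
        (measurableEmbedding_addRight _) u (Set.Ioi ((r : ℝ) / h))
      rw [← this]
      simp
    have e3 : y = (∫ s in (0 : ℝ)..((r : ℝ) / h), u s) + ∫ s in Set.Ioi ((r : ℝ) / h), u s := by
      rw [intervalIntegral.integral_interval_add_Ioi hui
        (hui.mono_set (Set.Ioi_subset_Ioi hρ)), hy, average_expDist]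
    rw [e1]
    nth_rewrite 1 [e3]
    rw [add_sub_cancel_left, e2, ← integral_smul]
    refine setIntegral_congr_fun measurableSet_Ioi fun s hs => ?_
    simp only [u]
    rw [smul_smul, ← Real.exp_add]
    have hs0 : (0 : ℝ) < s := hs
    congr 2
    · ring
    · congr 1
      ext
      push_cast
      rw [Real.coe_toNNReal _ hs0.le, Real.coe_toNNReal _ (by positivity)]
      field_simp
      ring
  have hd : HasDerivAt (fun r : ℝ => Real.exp (r / h) • (y - ∫ s in (0 : ℝ)..(r / h), u s))
      ((h : ℝ)⁻¹ • (y - x)) 0 := by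
    have d1 : HasDerivAt (fun r : ℝ => r / (h : ℝ)) ((h : ℝ)⁻¹) 0 := by
      simpa [div_eq_mul_inv] using (hasDerivAt_id (0 : ℝ)).mul_const ((h : ℝ)⁻¹)
    have d2 : HasDerivAt (fun ρ : ℝ => ∫ s in (0 : ℝ)..ρ, u s) (u 0) (0 / (h : ℝ)) := by
      rw [zero_div]
      exact (hu.integral_hasStrictDerivAt 0 0).hasDerivAt
    have d3 := (d2.scomp (0 : ℝ) d1).const_sub y
    have d4 := d1.exp.smul d3
    suffices e : Real.exp (0 / (h : ℝ)) • -((h : ℝ)⁻¹ • u 0) + (Real.exp (0 / (h : ℝ)) * (h : ℝ)⁻¹) •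
        (y - ∫ s in (0 : ℝ)..(0 / (h : ℝ)), u s) = (h : ℝ)⁻¹ • (y - x) by
      rw [← e]
      exact d4
    simp only [zero_div, Real.exp_zero, one_mul, one_smul,
      intervalIntegral.integral_same, sub_zero, u, neg_zero, Real.toNNReal_zero, mul_zero,
      T.map_zero, ContinuousLinearMap.id_apply]
    rw [smul_sub]
    abel
  have ht := hd.tendsto_slope_zero_right
  have hc : Tendsto (fun r : ℝ≥0 => (r : ℝ)) (𝓝[>] 0) (𝓝[>] 0) := by
    refine tendsto_nhdsWithin_iff.2 ⟨?_, ?_⟩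
    · exact (NNReal.continuous_coe.tendsto 0).mono_left nhdsWithin_le_nhds
    · exact eventually_nhdsWithin_of_forall fun r hr => NNReal.coe_pos.2 hr
  have hfin := ht.comp hc
  have e0 : ((h : ℝ)⁻¹ : ℝ) • (y - x) = (h : ℂ)⁻¹ • (y - x) := by
    rw [← Complex.coe_smul]
    push_cast
    rfl
  rw [HasOrbitDeriv, ← e0]
  refine hfin.congr fun r => ?_
  simp only [Function.comp_apply, zero_add, zero_div, Real.exp_zero,
    intervalIntegral.integral_same, sub_zero, one_smul]
  rw [shift r, ← Complex.coe_smul]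
  push_cast
  rfl

theorem HasOrbitDeriv.average {T : BoundedC0Semigroup X} {x y : X} (h : T.HasOrbitDeriv x y)
    (p : Measure ℝ≥0) [IsFiniteMeasure p] : T.HasOrbitDeriv (T.average p x) (T.average p y) := by
  have := ((T.average p).continuous.tendsto y).comp h
  refine this.congr fun r => ?_
  simp only [Function.comp_apply, _root_.map_smul, _root_.map_sub, T.op_average]

/-- The orbit derivative of `y = ∫ T(s)x` is `-Ay = (y - x)/h`, which is `(1 + hA)y = x`. For the
left inverse, averaging commutes with orbit derivatives, and these are unique. -/
theorem isBoundedInverse_average (T : BoundedC0Semigroup X) {A : X →ₗ.[ℂ] X}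
    (hA : -A = T.generator) {h : ℝ≥0} (hh : 0 < h) :
    IsBoundedInverse (onePlus h A) (T.average (expDist h)) := by
  obtain rfl : A = -T.generator := by rw [← hA, neg_neg]
  have hc : (h : ℂ) ≠ 0 := by exact_mod_cast hh.ne'
  have happ : ∀ (x y : X) (hxy : T.HasOrbitDeriv x y)
      (hx : x ∈ (onePlus (h : ℝ) (-T.generator)).domain),
      onePlus (h : ℝ) (-T.generator) ⟨x, hx⟩ = x + (h : ℂ) • (-y) := by
    intro x y hxy hx
    rw [← hxy.generator_eq]
    rfl
  constructor
  · intro x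
    have hd := T.hasOrbitDeriv_average_expDist hh x
    have hmem : T.average (expDist h) x ∈ (onePlus (h : ℝ) (-T.generator)).domain :=
      ⟨trivial, ⟨_, hd⟩⟩
    refine ⟨hmem, ?_⟩
    rw [happ _ _ hd hmem, smul_neg, smul_smul, mul_inv_cancel₀ hc, one_smul]
    abel
  · rintro ⟨x, hx⟩
    have hx' := hx
    obtain ⟨-, y, hy⟩ := hx'
    rw [happ x y hy, _root_.map_add, _root_.map_smul, _root_.map_neg]
    have := (hy.average (expDist h)).unique (T.hasOrbitDeriv_average_expDist hh x)
    rw [this, smul_neg, smul_smul, mul_inv_cancel₀ hc, one_smul]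
    abel

theorem average_gammaDist (T : BoundedC0Semigroup X) (h : ℝ≥0) (n : ℕ) :
    T.average (gammaDist h n) = T.average (expDist h) ^ n := by
  induction n with
  | zero =>
    ext x
    rw [pow_zero]
    exact (T.average_dirac 0 x).trans (by simp [T.map_zero])
  | succ n ih =>
    ext x
    rw [pow_succ', mul_apply_eq_comp, ← ih]
    exact T.average_conv _ _ x

/-- Averages over exponential distributions are resolvents, so they have a left inverse; no
assumption on the range of `A` enters. -/
theorem average_expDist_injective (T : BoundedC0Semigroup X) {h : ℝ≥0} (hh : 0 < h) :
    Function.Injective (T.average (expDist h)) := by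
  have hinv := T.isBoundedInverse_average (neg_neg T.generator) hh
  intro x y hxy
  obtain ⟨h1, e1⟩ := hinv.1 x
  obtain ⟨h2, e2⟩ := hinv.1 y
  rw [← e1, ← e2]
  congr 1
  exact Subtype.ext hxy

theorem eulerApprox_eq (T : BoundedC0Semigroup X) {A : X →ₗ.[ℂ] X} (hA : -A = T.generator)
    {n : ℕ} {t : ℝ≥0} (hn : 0 < n) (ht : 0 < t) :
    eulerApprox A n t = T.average (gammaDist (t / n) n) := by
  have h := T.isBoundedInverse_average hA (h := t / n) (by positivity)
  rw [average_gammaDist, eulerApprox, ← boundedInverse_eq h]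
  simp

end BoundedC0Semigroup

end Resolvent

/-! ### Taylor remainders of `ℒp - e^{-tz}` as Laplace transforms -/

section TaylorRemainder

variable {p : Measure ℝ≥0} [IsProbabilityMeasure p] {t : ℝ≥0} {v : ℝ}

theorem integrable_coe_sub (hp : HasMeanVariance p t v) :
    Integrable (fun s : ℝ≥0 => (s : ℝ) - t) p :=
  hp.integrable.sub (integrable_const _)

theorem integrable_coe_sub_sq (hp : HasMeanVariance p t v) :
    Integrable (fun s : ℝ≥0 => ((s : ℝ) - t) ^ 2) p := by
  refine ((hp.integrable_sq.sub (hp.integrable.const_mul (2 * (t : ℝ)))).add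
    (integrable_const ((t : ℝ) ^ 2))).congr (ae_of_all _ fun s => ?_)
  simp only [Pi.add_apply, Pi.sub_apply]
  ring

theorem integral_coe_sub (hp : HasMeanVariance p t v) : ∫ s : ℝ≥0, ((s : ℝ) - t) ∂p = 0 := by
  rw [integral_sub hp.integrable (integrable_const _), hp.mean]
  simp

theorem integral_coe_sub_sq (hp : HasMeanVariance p t v) :
    ∫ s : ℝ≥0, ((s : ℝ) - t) ^ 2 ∂p = v := by
  have i1 : Integrable (fun s : ℝ≥0 => (s : ℝ) ^ 2 - 2 * (t : ℝ) * s) p :=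
    hp.integrable_sq.sub (hp.integrable.const_mul _)
  have e : ∀ s : ℝ≥0, ((s : ℝ) - t) ^ 2 = (s : ℝ) ^ 2 - 2 * (t : ℝ) * s + (t : ℝ) ^ 2 :=
    fun s => by ring
  simp only [e]
  rw [integral_add i1 (integrable_const _),
    integral_sub hp.integrable_sq (hp.integrable.const_mul _), integral_const_mul, hp.mean, hp.sq]
  simp
  ring

/-- Cauchy–Schwarz in the form `|d| ≤ δ/2 + d²/(2δ)`, integrated with `∫ d² = δ²`. -/
theorem integral_abs_coe_sub_le (hp : HasMeanVariance p t v) {δ : ℝ} (hδ : 0 < δ)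
    (hv : v = δ ^ 2) : ∫ s : ℝ≥0, |(s : ℝ) - t| ∂p ≤ δ := by
  have h : ∫ s : ℝ≥0, |(s : ℝ) - t| ∂p ≤
      ∫ s : ℝ≥0, (δ / 2 + (2 * δ)⁻¹ * ((s : ℝ) - t) ^ 2) ∂p := by
    refine integral_mono (integrable_coe_sub hp).abs
      ((integrable_const _).add ((integrable_coe_sub_sq hp).const_mul _)) fun s => ?_
    simp only
    rw [← sq_abs ((s : ℝ) - t)]
    have : 0 ≤ (δ - |(s : ℝ) - t|) ^ 2 / (2 * δ) := by positivity
    have e : (δ - |(s : ℝ) - t|) ^ 2 / (2 * δ) =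
        δ / 2 + (2 * δ)⁻¹ * |(s : ℝ) - t| ^ 2 - |(s : ℝ) - t| := by
      field_simp
      ring
    linarith
  rw [integral_add (integrable_const _) ((integrable_coe_sub_sq hp).const_mul _),
    integral_const_mul, integral_coe_sub_sq hp, hv] at h
  refine h.trans (le_of_eq ?_)
  simp
  field_simp
  norm_num

/-- The point at parameter `θ` on the segment from `t` to `s`. -/
noncomputable def segmentPoint (t : ℝ≥0) (ω : ℝ≥0 × ℝ) : ℝ≥0 :=
  ((t : ℝ) + ω.2 * ((ω.1 : ℝ) - t)).toNNReal

theorem measurable_segmentPoint (t : ℝ≥0) : Measurable (segmentPoint t) := by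
  unfold segmentPoint
  fun_prop

theorem coe_segmentPoint {t s : ℝ≥0} {θ : ℝ} (hθ : θ ∈ Set.Ioc (0 : ℝ) 1) :
    (segmentPoint t (s, θ) : ℝ) = t + θ * ((s : ℝ) - t) := by
  refine Real.coe_toNNReal _ ?_
  have h1 : 0 ≤ (1 - θ) * t := mul_nonneg (by linarith [hθ.2]) t.2
  have h2 : 0 ≤ θ * s := mul_nonneg hθ.1.le s.2
  simp only
  linarith

theorem hasDerivAt_exp_segment (t d : ℝ) (z : ℂ) (θ : ℝ) :
    HasDerivAt (fun θ : ℝ => Complex.exp (-(((t : ℂ) + θ * d) * z)))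
      (Complex.exp (-(((t : ℂ) + θ * d) * z)) * (-(d * z))) θ := by
  have h1 : HasDerivAt (fun θ : ℝ => (θ : ℂ)) 1 θ := Complex.ofRealCLM.hasDerivAt
  have h2 : HasDerivAt (fun θ : ℝ => -(((t : ℂ) + θ * d) * z)) (-(1 * d * z)) θ :=
    (((h1.mul_const (d : ℂ)).const_add (t : ℂ)).mul_const z).neg
  exact h2.cexp.congr_deriv (by ring)

/-- First-order Taylor formula with integral remainder along the segment from `t` to `s`: the
difference quotient becomes a signed mixture of exponentials, of mass at most `|t - s|`. -/
theorem integral_exp_segment (t s : ℝ≥0) {z : ℂ} (hz : z ≠ 0) :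
    ∫ θ in Set.Ioc (0 : ℝ) 1,
      (((t : ℝ) - s : ℝ) : ℂ) * Complex.exp (-((segmentPoint t (s, θ) : ℂ) * z)) =
      (Complex.exp (-((s : ℂ) * z)) - Complex.exp (-((t : ℂ) * z))) / z := by
  have hd : ∀ θ : ℝ, HasDerivAt
      (fun θ : ℝ => Complex.exp (-((((t : ℝ) : ℂ) + θ * (((s : ℝ) - t : ℝ) : ℂ)) * z)) / z)
      ((((t : ℝ) - s : ℝ) : ℂ) *
        Complex.exp (-((((t : ℝ) : ℂ) + θ * (((s : ℝ) - t : ℝ) : ℂ)) * z))) θ := by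
    intro θ
    refine ((hasDerivAt_exp_segment t ((s : ℝ) - t) z θ).div_const z).congr_deriv ?_
    push_cast
    field_simp
    ring
  have e : ∫ θ in Set.Ioc (0 : ℝ) 1,
      (((t : ℝ) - s : ℝ) : ℂ) * Complex.exp (-((segmentPoint t (s, θ) : ℂ) * z)) =
      ∫ θ in Set.Ioc (0 : ℝ) 1, (((t : ℝ) - s : ℝ) : ℂ) *
        Complex.exp (-((((t : ℝ) : ℂ) + θ * (((s : ℝ) - t : ℝ) : ℂ)) * z)) := by
    refine setIntegral_congr_fun measurableSet_Ioc fun θ hθ => ?_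
    rw [coe_segmentPoint hθ]
    push_cast
    rfl
  rw [e, ← intervalIntegral.integral_of_le zero_le_one,
    intervalIntegral.integral_eq_sub_of_hasDerivAt (fun θ _ => hd θ)
      ((by fun_prop : Continuous _).intervalIntegrable _ _), sub_div]
  congr 3 <;> · push_cast; ring

/-- Second-order Taylor formula with integral remainder. The last term is linear in `s - t` and
disappears once integrated against a measure of mean `t`. -/
theorem integral_one_sub_mul_exp_segment (t s : ℝ≥0) {z : ℂ} (hz : z ≠ 0) :
    ∫ θ in Set.Ioc (0 : ℝ) 1, (((((s : ℝ) - t) ^ 2 * (1 - θ) : ℝ)) : ℂ) *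
        Complex.exp (-((segmentPoint t (s, θ) : ℂ) * z)) =
      (Complex.exp (-((s : ℂ) * z)) - Complex.exp (-((t : ℂ) * z))) / z ^ 2 +
        ((((s : ℝ) - t : ℝ)) : ℂ) * (Complex.exp (-((t : ℂ) * z)) / z) := by
  have hd : ∀ θ : ℝ, HasDerivAt
      (fun θ : ℝ => Complex.exp (-((((t : ℝ) : ℂ) + θ * (((s : ℝ) - t : ℝ) : ℂ)) * z)) / z ^ 2 -
        (1 - (θ : ℂ)) * Complex.exp (-((((t : ℝ) : ℂ) + θ * (((s : ℝ) - t : ℝ) : ℂ)) * z)) *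
          ((((s : ℝ) - t : ℝ) : ℂ) / z))
      ((((((s : ℝ) - t) ^ 2 * (1 - θ) : ℝ)) : ℂ) *
        Complex.exp (-((((t : ℝ) : ℂ) + θ * (((s : ℝ) - t : ℝ) : ℂ)) * z))) θ := by
    intro θ
    have h0 := hasDerivAt_exp_segment t ((s : ℝ) - t) z θ
    have h1 : HasDerivAt (fun θ : ℝ => 1 - (θ : ℂ)) (-1) θ :=
      Complex.ofRealCLM.hasDerivAt.const_sub 1
    refine ((h0.div_const (z ^ 2)).sub
      ((h1.mul h0).mul_const ((((s : ℝ) - t : ℝ) : ℂ) / z))).congr_deriv ?_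
    push_cast
    field_simp
    ring
  have e : ∫ θ in Set.Ioc (0 : ℝ) 1, (((((s : ℝ) - t) ^ 2 * (1 - θ) : ℝ)) : ℂ) *
        Complex.exp (-((segmentPoint t (s, θ) : ℂ) * z)) =
      ∫ θ in Set.Ioc (0 : ℝ) 1, (((((s : ℝ) - t) ^ 2 * (1 - θ) : ℝ)) : ℂ) *
        Complex.exp (-((((t : ℝ) : ℂ) + θ * (((s : ℝ) - t : ℝ) : ℂ)) * z)) := by
    refine setIntegral_congr_fun measurableSet_Ioc fun θ hθ => ?_
    rw [coe_segmentPoint hθ]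
    push_cast
    rfl
  rw [e, ← intervalIntegral.integral_of_le zero_le_one,
    intervalIntegral.integral_eq_sub_of_hasDerivAt (fun θ _ => hd θ)
      ((by fun_prop : Continuous _).intervalIntegrable _ _)]
  have e1 : ((t : ℝ) : ℂ) + ((1 : ℝ) : ℂ) * (((s : ℝ) - t : ℝ) : ℂ) = (s : ℂ) := by
    push_cast
    ring
  have e0 : ((t : ℝ) : ℂ) + ((0 : ℝ) : ℂ) * (((s : ℝ) - t : ℝ) : ℂ) = (t : ℂ) := by
    push_cast
    ring
  rw [e1, e0]
  push_cast
  ring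

theorem LaplaceBound.laplace_sub_exp (p : Measure ℝ≥0) [IsProbabilityMeasure p] (t : ℝ≥0) :
    LaplaceBound (fun z => laplace p z - Complex.exp (-((t : ℂ) * z))) 2 := by
  refine ⟨p, Measure.dirac t, inferInstance, inferInstance, ?_, fun z _ => ?_⟩
  · simp
    norm_num
  · rw [laplace_dirac]

theorem LaplaceBound.laplace_sub_exp_div (hp : HasMeanVariance p t v) {δ : ℝ} (hδ : 0 < δ)
    (hv : v = δ ^ 2) :
    LaplaceBound (fun z => (laplace p z - Complex.exp (-((t : ℂ) * z))) / z) δ := by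
  have hi : Integrable (fun s : ℝ≥0 => (t : ℝ) - s) p := (integrable_const _).sub hp.integrable
  have hw : Integrable (fun ω : ℝ≥0 × ℝ => (t : ℝ) - ω.1)
    (p.prod (volume.restrict (Set.Ioc (0 : ℝ) 1))) := hi.comp_fst _
  refine ((LaplaceBound.integral_mul_exp (by fun_prop) hw (measurable_segmentPoint t)).mono
    ?_).congr fun z hz => ?_
  · rw [integral_fun_fst (fun s : ℝ≥0 => |(t : ℝ) - s|)]
    simpa [abs_sub_comm] using integral_abs_coe_sub_le hp hδ hv
  · have hz0 : z ≠ 0 := by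
      rintro rfl
      simp at hz
    rw [integral_prod]
    · simp only [integral_exp_segment t _ hz0, integral_div]
      rw [integral_sub (integrable_exp_neg_mul p hz.le) (integrable_const _)]
      simp [laplace]
    · refine hw.norm.mono' (Measurable.aestronglyMeasurable ?_) (ae_of_all _ fun ω => ?_)
      · have := measurable_segmentPoint t
        fun_prop
      · rw [norm_mul, Complex.norm_real]
        exact mul_le_of_le_one_right (norm_nonneg _) (norm_exp_neg_mul_le hz.le _)

/-- The weight `(s - t)²(1 - θ)` has integral `v · 1/2`; the first-order term vanishes because the
mean of `p` is exactly `t`. -/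
theorem LaplaceBound.laplace_sub_exp_div_sq (hp : HasMeanVariance p t v) :
    LaplaceBound (fun z => (laplace p z - Complex.exp (-((t : ℂ) * z))) / z ^ 2) (v / 2) := by
  have hθ : Integrable (fun θ : ℝ => 1 - θ) (volume.restrict (Set.Ioc (0 : ℝ) 1)) :=
    (by fun_prop : Continuous fun θ : ℝ => 1 - θ).integrableOn_Ioc
  have hw : Integrable (fun ω : ℝ≥0 × ℝ => ((ω.1 : ℝ) - t) ^ 2 * (1 - ω.2))
    (p.prod (volume.restrict (Set.Ioc (0 : ℝ) 1))) := (integrable_coe_sub_sq hp).mul_prod hθ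
  refine ((LaplaceBound.integral_mul_exp (by fun_prop) hw (measurable_segmentPoint t)).mono
    ?_).congr fun z hz => ?_
  · simp only [abs_mul]
    rw [integral_prod_mul (fun s : ℝ≥0 => |((s : ℝ) - t) ^ 2|) (fun θ : ℝ => |1 - θ|)]
    have e : ∫ θ in Set.Ioc (0 : ℝ) 1, |1 - θ| = 1 / 2 := by
      have : ∫ θ in Set.Ioc (0 : ℝ) 1, |1 - θ| = ∫ θ in Set.Ioc (0 : ℝ) 1, (1 - θ) :=
        setIntegral_congr_fun measurableSet_Ioc fun θ hθ => abs_of_nonneg (by linarith [hθ.2])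
      rw [this, ← intervalIntegral.integral_of_le zero_le_one, intervalIntegral.integral_sub
        (by simp) (by simp)]
      simp
      norm_num
    simp only [abs_sq]
    rw [e, integral_coe_sub_sq hp]
    linarith
  · have hz0 : z ≠ 0 := by
      rintro rfl
      simp at hz
    rw [integral_prod]
    · simp only [integral_one_sub_mul_exp_segment t _ hz0]
      rw [integral_add, integral_mul_const, integral_complex_ofReal, integral_coe_sub hp,
        integral_div, integral_sub (integrable_exp_neg_mul p hz.le) (integrable_const _)]
      · simp [laplace]
      · exact ((integrable_exp_neg_mul p hz.le).sub (integrable_const _)).div_const _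
      · exact (integrable_coe_sub hp).ofReal.mul_const _
    · refine hw.norm.mono' (Measurable.aestronglyMeasurable ?_) (ae_of_all _ fun ω => ?_)
      · have := measurable_segmentPoint t
        fun_prop
      · rw [norm_mul, Complex.norm_real]
        exact mul_le_of_le_one_right (norm_nonneg _) (norm_exp_neg_mul_le hz.le _)

end TaylorRemainder

/-! ### Stieltjes functions and the mass bound for the rate -/

section Stieltjes

variable {μ : Measure ℝ≥0}

theorem add_ofReal_ne_zero {z : ℂ} (hz : 0 < z.re) (τ : ℝ≥0) : z + ((τ : ℝ) : ℂ) ≠ 0 := by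
  intro h
  have := congrArg Complex.re h
  simp only [Complex.add_re, Complex.ofReal_re, Complex.zero_re] at this
  linarith [τ.2]

theorem exists_le_norm_add {z : ℂ} (hz : z ∈ Complex.slitPlane) :
    ∃ d : ℝ, 0 < d ∧ ∀ τ : ℝ≥0, d ≤ ‖z + ((τ : ℝ) : ℂ)‖ := by
  rcases hz with h | h
  · refine ⟨z.re, h, fun τ => ?_⟩
    have := Complex.re_le_norm (z + ((τ : ℝ) : ℂ))
    simp only [Complex.add_re, Complex.ofReal_re] at this
    linarith [τ.2]
  · refine ⟨|z.im|, abs_pos.2 h, fun τ => ?_⟩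
    have := Complex.abs_im_le_norm (z + ((τ : ℝ) : ℂ))
    simpa using this

/-- Comparison with `(1+τ)⁻¹`: `τ ≤ |z+τ| + |z|`, and the constant `1 + |z|` is absorbed through
`|z+τ| ≥ d`. -/
theorem integrable_inv_add (hμ : Integrable (fun τ : ℝ≥0 => (1 + (τ : ℝ))⁻¹) μ) {z : ℂ}
    (hz : z ∈ Complex.slitPlane) : Integrable (fun τ : ℝ≥0 => (z + ((τ : ℝ) : ℂ))⁻¹) μ := by
  obtain ⟨d, hd, h⟩ := exists_le_norm_add hz
  refine (hμ.const_mul ((1 + ‖z‖) / d + 1)).mono' (Measurable.aestronglyMeasurable (by fun_prop))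
    (ae_of_all _ fun τ => ?_)
  have hpos : 0 < ‖z + ((τ : ℝ) : ℂ)‖ := hd.trans_le (h τ)
  have h1 : (τ : ℝ) ≤ ‖z + ((τ : ℝ) : ℂ)‖ + ‖z‖ := by
    have := norm_sub_le (z + ((τ : ℝ) : ℂ)) z
    rw [add_sub_cancel_left, Complex.norm_real] at this
    exact (le_abs_self _).trans this
  have h2 : 1 + ‖z‖ ≤ (1 + ‖z‖) / d * ‖z + ((τ : ℝ) : ℂ)‖ := by
    rw [div_mul_eq_mul_div, le_div_iff₀ hd]
    exact mul_le_mul_of_nonneg_left (h τ) (by positivity)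
  have h3 : 0 < 1 + (τ : ℝ) := by positivity
  rw [norm_inv, ← div_eq_mul_inv, inv_eq_one_div, div_le_div_iff₀ hpos h3]
  linarith

theorem ofReal_mem_slitPlane {r : ℝ} (hr : 0 < r) : (r : ℂ) ∈ Complex.slitPlane :=
  Or.inl (by simpa using hr)

theorem mem_slitPlane_of_re_pos {z : ℂ} (hz : 0 < z.re) : z ∈ Complex.slitPlane := Or.inl hz

theorem integrable_inv_add_real (hμ : Integrable (fun τ : ℝ≥0 => (1 + (τ : ℝ))⁻¹) μ) {r : ℝ}
    (hr : 0 < r) : Integrable (fun τ : ℝ≥0 => (r + (τ : ℝ))⁻¹) μ := by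
  refine (integrable_inv_add hμ (ofReal_mem_slitPlane hr)).re.congr (ae_of_all _ fun τ => ?_)
  change ((r : ℂ) + ((τ : ℝ) : ℂ))⁻¹.re = _
  rw [← Complex.ofReal_add, ← Complex.ofReal_inv, Complex.ofReal_re]

theorem integral_inv_add_ofReal (μ : Measure ℝ≥0) (r : ℝ) :
    ∫ τ : ℝ≥0, ((r : ℂ) + ((τ : ℝ) : ℂ))⁻¹ ∂μ = ((∫ τ : ℝ≥0, (r + (τ : ℝ))⁻¹ ∂μ : ℝ) : ℂ) := by
  rw [← integral_complex_ofReal]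
  simp

theorem differentiableOn_integral_inv_add
    (hμ : Integrable (fun τ : ℝ≥0 => (1 + (τ : ℝ))⁻¹) μ) :
    DifferentiableOn ℂ (fun z => ∫ τ : ℝ≥0, (z + ((τ : ℝ) : ℂ))⁻¹ ∂μ) Complex.slitPlane := by
  intro z hz
  obtain ⟨d, hd, h⟩ := exists_le_norm_add hz
  -- Within distance `d/2` of `z` one has `|w+τ| ≥ |z+τ|/2`, hence `|w+τ|⁻² ≤ (4/d)|z+τ|⁻¹`, an
  -- integrable majorant of the derivative.
  have near : ∀ w ∈ Metric.ball z (d / 2), ∀ τ : ℝ≥0,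
      ‖z + ((τ : ℝ) : ℂ)‖ / 2 ≤ ‖w + ((τ : ℝ) : ℂ)‖ := by
    intro w hw τ
    have h1 : ‖z + ((τ : ℝ) : ℂ)‖ ≤ ‖w + ((τ : ℝ) : ℂ)‖ + ‖z - w‖ := by
      have e : z + ((τ : ℝ) : ℂ) = (w + ((τ : ℝ) : ℂ)) + (z - w) := by ring
      rw [e]
      exact norm_add_le _ _
    have h2 : ‖z - w‖ < d / 2 := by
      rw [← dist_eq_norm, dist_comm]
      exact hw
    linarith [h τ]
  have hpos : ∀ τ : ℝ≥0, 0 < ‖z + ((τ : ℝ) : ℂ)‖ := fun τ => hd.trans_le (h τ)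
  have key := hasDerivAt_integral_of_dominated_loc_of_deriv_le (μ := μ) (𝕜 := ℂ)
    (F := fun w (τ : ℝ≥0) => (w + ((τ : ℝ) : ℂ))⁻¹)
    (F' := fun w (τ : ℝ≥0) => -1 / (w + ((τ : ℝ) : ℂ)) ^ 2)
    (bound := fun τ : ℝ≥0 => 4 / d * ‖(z + ((τ : ℝ) : ℂ))⁻¹‖)
    (Metric.ball_mem_nhds z (half_pos hd))
    (Eventually.of_forall fun w => Measurable.aestronglyMeasurable (by fun_prop))
    (integrable_inv_add hμ hz) (Measurable.aestronglyMeasurable (by fun_prop))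
    (ae_of_all _ fun τ w hw => ?_) ((integrable_inv_add hμ hz).norm.const_mul _)
    (ae_of_all _ fun τ w hw => ?_)
  · exact key.2.differentiableAt.differentiableWithinAt
  · have h1 := near w hw τ
    have h2 := hpos τ
    have h3 : 0 < ‖w + ((τ : ℝ) : ℂ)‖ := by linarith
    rw [norm_div, norm_neg, norm_one, norm_pow, norm_inv, ← div_eq_mul_inv, div_div,
      div_le_div_iff₀ (by positivity) (by positivity)]
    nlinarith [h τ, mul_le_mul h1 h1 (by positivity) (norm_nonneg _)]
  · have h1 := near w hw τ
    have h2 := hpos τ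
    have h3 : w + ((τ : ℝ) : ℂ) ≠ 0 := norm_pos_iff.1 (by linarith)
    exact ((hasDerivAt_id w).add_const _).inv h3

theorem IsStieltjes.differentiableOn {f : ℂ → ℂ} (hf : IsStieltjes f) :
    DifferentiableOn ℂ f Complex.slitPlane := by
  obtain ⟨a, μ, hμ, h⟩ := hf
  exact ((differentiableOn_integral_inv_add hμ).const_add ((a : ℝ) : ℂ)).congr h

theorem inv_add_re_pos {z : ℂ} (hz : 0 < z.re) (τ : ℝ≥0) : 0 < (z + ((τ : ℝ) : ℂ))⁻¹.re := by
  rw [Complex.inv_re]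
  refine div_pos ?_ (Complex.normSq_pos.2 (add_ofReal_ne_zero hz τ))
  simpa using add_pos_of_pos_of_nonneg hz τ.2

/-- A Stieltjes function that does not vanish identically has positive real part on the right
half-plane. -/
theorem IsStieltjes.re_pos {f : ℂ → ℂ} (hf : IsStieltjes f)
    (hne : ∃ z ∈ Complex.slitPlane, f z ≠ 0) {z : ℂ} (hz : 0 < z.re) : 0 < (f z).re := by
  obtain ⟨a, μ, hμ, h⟩ := hf
  have hi := integrable_inv_add hμ (mem_slitPlane_of_re_pos hz)
  have hre : (f z).re = a + ∫ τ : ℝ≥0, (z + ((τ : ℝ) : ℂ))⁻¹.re ∂μ := by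
    rw [h z (mem_slitPlane_of_re_pos hz), Complex.add_re, Complex.ofReal_re]
    congr 1
    exact (integral_re hi).symm
  have hnn : 0 ≤ ∫ τ : ℝ≥0, (z + ((τ : ℝ) : ℂ))⁻¹.re ∂μ :=
    integral_nonneg fun τ => (inv_add_re_pos hz τ).le
  by_contra hcon
  rw [hre] at hcon
  have ha0 : (a : ℝ) = 0 := by linarith [a.2]
  have hi0 : ∫ τ : ℝ≥0, (z + ((τ : ℝ) : ℂ))⁻¹.re ∂μ = 0 := by linarith [a.2]
  -- The integrand is strictly positive everywhere, so a zero integral forces `μ = 0`.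
  have hμ0 : μ = 0 := by
    rw [integral_eq_zero_iff_of_nonneg (fun τ => (inv_add_re_pos hz τ).le) hi.re] at hi0
    rw [← Measure.measure_univ_eq_zero]
    rw [Filter.EventuallyEq, ae_iff] at hi0
    convert hi0 using 2
    ext τ
    simpa using (inv_add_re_pos hz τ).ne'
  obtain ⟨w, hw, hfw⟩ := hne
  rw [h w hw, ha0, hμ0] at hfw
  simp at hfw

/-- Integrals of `1 / (z + τ)` over a set of `τ > 0`. -/
theorem LaplaceBound.setIntegral_inv_add {S : Set ℝ≥0} (hS : MeasurableSet S) (h0 : 0 ∉ S)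
    (hi : IntegrableOn (fun τ : ℝ≥0 => (τ : ℝ)⁻¹) S μ) :
    LaplaceBound (fun z => ∫ τ in S, (z + ((τ : ℝ) : ℂ))⁻¹ ∂μ) (∫ τ in S, (τ : ℝ)⁻¹ ∂μ) := by
  -- `(z+τ)⁻¹ = τ⁻¹ · τ/(τ+z)`; the factor `τ⁻¹` goes into the measure.
  let P := (μ.restrict S).withDensity fun τ => ((τ⁻¹ : ℝ≥0) : ℝ≥0∞)
  have hm : Measurable fun τ : ℝ≥0 => τ⁻¹ := measurable_inv
  have hP : IsFiniteMeasure P := by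
    refine isFiniteMeasure_withDensity (ne_of_lt ?_)
    have := hi.2
    rw [hasFiniteIntegral_iff_norm] at this
    convert this using 3 with τ
    rw [Real.norm_of_nonneg (by positivity), ← NNReal.coe_inv, ENNReal.ofReal_coe_nnreal]
  have hP0 : P {0} = 0 := by
    refine withDensity_absolutelyContinuous _ _ ?_
    rw [Measure.restrict_apply (measurableSet_singleton 0), Set.singleton_inter_eq_empty.2 h0,
      measure_empty]
  refine ((LaplaceBound.integral_div_add P hP0).mono (le_of_eq ?_)).congr fun z hz => ?_
  · have := integral_withDensity_eq_integral_smul (μ := μ.restrict S) hm (fun _ => (1 : ℝ))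
    simpa [NNReal.smul_def] using this
  · rw [integral_withDensity_eq_integral_smul hm]
    refine setIntegral_congr_fun hS fun τ hτ => ?_
    have hτ0 : ((τ : ℝ) : ℂ) ≠ 0 := by
      intro h
      have : τ = 0 := by exact_mod_cast h
      exact h0 (this ▸ hτ)
    have := add_ofReal_ne_zero hz τ
    rw [NNReal.smul_def, Complex.real_smul, NNReal.coe_inv, Complex.ofReal_inv, add_comm _ z]
    field_simp

theorem measure_Iic_lt_top (hμ : Integrable (fun τ : ℝ≥0 => (1 + (τ : ℝ))⁻¹) μ) (c : ℝ≥0) :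
    μ (Set.Iic c) < ∞ := by
  have hpos : (0 : ℝ) < (1 + (c : ℝ))⁻¹ := by positivity
  refine (measure_mono fun τ hτ => ?_).trans_lt (hμ.measure_ge_lt_top hpos)
  simp only [Set.mem_ofPred_eq]
  have : (τ : ℝ) ≤ c := NNReal.coe_le_coe.2 hτ
  exact inv_anti₀ (by positivity) (by linarith)

/-- Integrals of `z / (z + τ)` over bounded sets of `τ`. -/
theorem LaplaceBound.mul_setIntegral_inv_add
    (hμ : Integrable (fun τ : ℝ≥0 => (1 + (τ : ℝ))⁻¹) μ) (c : ℝ≥0) :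
    LaplaceBound (fun z => z * ∫ τ in Set.Iic c, (z + ((τ : ℝ) : ℂ))⁻¹ ∂μ)
      (2 * μ.real (Set.Iic c)) := by
  have hfin : IsFiniteMeasure (μ.restrict (Set.Iic c)) :=
    ⟨by simpa using measure_Iic_lt_top hμ c⟩
  -- Here `z/(z+τ) = 1 - τ/(τ+z)`, which accounts for the factor `2`. Since `τ/(τ+z)` vanishes at `τ
  -- = 0`, an atom there contributes only to the constant, and the mixture runs over `(0,c]`.
  have hfin' : IsFiniteMeasure (μ.restrict (Set.Ioc 0 c)) :=
    ⟨by simpa using (measure_mono Set.Ioc_subset_Iic_self).trans_lt (measure_Iic_lt_top hμ c)⟩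
  have h0 : (μ.restrict (Set.Ioc 0 c)) {0} = 0 := by
    rw [Measure.restrict_apply (measurableSet_singleton 0), Set.singleton_inter_eq_empty.2 (by simp),
      measure_empty]
  have h1 := LaplaceBound.const (c := μ.real (Set.Iic c)) measureReal_nonneg
  refine ((h1.sub (LaplaceBound.integral_div_add _ h0)).mono ?_).congr fun z hz => ?_
  · rw [measureReal_restrict_apply_univ]
    have : μ.real (Set.Ioc 0 c) ≤ μ.real (Set.Iic c) :=
      measureReal_mono Set.Ioc_subset_Iic_self (measure_Iic_lt_top hμ c).ne
    linarith
  · have hsub : ∫ τ in Set.Ioc 0 c, ((τ : ℝ) : ℂ) / (((τ : ℝ) : ℂ) + z) ∂μ =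
        ∫ τ in Set.Iic c, ((τ : ℝ) : ℂ) / (((τ : ℝ) : ℂ) + z) ∂μ := by
      symm
      refine setIntegral_eq_of_subset_of_forall_sdiff_eq_zero measurableSet_Iic
        Set.Ioc_subset_Iic_self fun τ hτ => ?_
      have : τ = 0 := by
        by_contra hne
        exact hτ.2 ⟨pos_iff_ne_zero.2 hne, hτ.1⟩
      simp [this]
    have hi : IntegrableOn (fun τ : ℝ≥0 => (z + ((τ : ℝ) : ℂ))⁻¹) (Set.Iic c) μ :=
      (integrable_inv_add hμ (mem_slitPlane_of_re_pos hz)).integrableOn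
    have e : ∀ τ : ℝ≥0, ((τ : ℝ) : ℂ) / (((τ : ℝ) : ℂ) + z) = 1 - z * (z + ((τ : ℝ) : ℂ))⁻¹ := by
      intro τ
      have := add_ofReal_ne_zero hz τ
      rw [add_comm _ z]
      field_simp
      ring
    rw [hsub]
    simp only [e]
    rw [integral_sub (integrable_const _) (hi.const_mul z), integral_const_mul]
    simp

/-- Splitting a Stieltjes function at the point `c` of its spectral measure. -/
theorem IsStieltjes.exists_split {f : ℂ → ℂ} (hf : IsStieltjes f) {c : ℝ≥0} (hc : 0 < c) :
    ∃ (u v : ℂ → ℂ) (U V : ℝ), LaplaceBound u (2 * U) ∧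
      LaplaceBound (fun z => z * v z) (4 * c * V) ∧ (∀ z : ℂ, 0 < z.re → f z = u z + v z) ∧
      f ((c : ℝ) : ℂ) = ((U + V : ℝ) : ℂ) := by
  obtain ⟨a, μ, hμ, h⟩ := hf
  have hc' : (0 : ℝ) < c := NNReal.coe_pos.2 hc
  have hr := integrable_inv_add_real hμ hc'
  -- For `τ > c`, `c + τ ≤ 2τ`: the mass of `u` is controlled by its own value at `c`.
  have hcmp : ∀ τ ∈ Set.Ioi c, (τ : ℝ)⁻¹ ≤ 2 * ((c : ℝ) + τ)⁻¹ := by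
    intro τ hτ
    have h1 : (c : ℝ) < τ := NNReal.coe_lt_coe.2 hτ
    rw [← div_eq_mul_inv, inv_eq_one_div, div_le_div_iff₀ (by linarith) (by linarith)]
    linarith
  have hint : IntegrableOn (fun τ : ℝ≥0 => (τ : ℝ)⁻¹) (Set.Ioi c) μ := by
    refine (hr.const_mul 2).integrableOn.mono' (Measurable.aestronglyMeasurable (by fun_prop)) ?_
    refine (ae_restrict_iff' measurableSet_Ioi).2 (ae_of_all _ fun τ hτ => ?_)
    rw [Real.norm_of_nonneg (by positivity)]
    exact hcmp τ hτ
  refine ⟨fun z => ((a : ℝ) : ℂ) + ∫ τ in Set.Ioi c, (z + ((τ : ℝ) : ℂ))⁻¹ ∂μ,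
    fun z => ∫ τ in Set.Iic c, (z + ((τ : ℝ) : ℂ))⁻¹ ∂μ,
    a + ∫ τ in Set.Ioi c, ((c : ℝ) + τ)⁻¹ ∂μ, ∫ τ in Set.Iic c, ((c : ℝ) + τ)⁻¹ ∂μ,
    ?_, ?_, ?_, ?_⟩
  · refine ((LaplaceBound.const a.2).add
      (LaplaceBound.setIntegral_inv_add measurableSet_Ioi (by simp) hint)).mono ?_
    have : ∫ τ in Set.Ioi c, (τ : ℝ)⁻¹ ∂μ ≤ 2 * ∫ τ in Set.Ioi c, ((c : ℝ) + τ)⁻¹ ∂μ := by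
      rw [← integral_const_mul]
      exact setIntegral_mono_on hint (hr.const_mul 2).integrableOn measurableSet_Ioi hcmp
    have ha : (0 : ℝ) ≤ a := a.2
    change (a : ℝ) + _ ≤ _
    linarith
  · refine (LaplaceBound.mul_setIntegral_inv_add hμ c).mono ?_
    have hfin := measure_Iic_lt_top hμ c
    -- For `τ ≤ c`, `c + τ ≤ 2c`, so the mass `2μ[0,c]` of `z v` is at most `4cV`.
    have : (2 * (c : ℝ))⁻¹ * μ.real (Set.Iic c) ≤ ∫ τ in Set.Iic c, ((c : ℝ) + τ)⁻¹ ∂μ := by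
      have h1 : ∫ _ in Set.Iic c, (2 * (c : ℝ))⁻¹ ∂μ = (2 * (c : ℝ))⁻¹ * μ.real (Set.Iic c) := by
        simp [mul_comm]
      rw [← h1]
      refine setIntegral_mono_on (integrableOn_const hfin.ne) hr.integrableOn measurableSet_Iic
        fun τ hτ => ?_
      have h2 : (τ : ℝ) ≤ c := NNReal.coe_le_coe.2 hτ
      gcongr
      linarith
    calc 2 * μ.real (Set.Iic c) = 4 * c * ((2 * (c : ℝ))⁻¹ * μ.real (Set.Iic c)) := by
          field_simp
          ring
      _ ≤ _ := by gcongr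
  · intro z hz
    have hi := integrable_inv_add hμ (mem_slitPlane_of_re_pos hz)
    rw [h z (mem_slitPlane_of_re_pos hz), ← integral_add_compl measurableSet_Iic hi,
      Set.compl_Iic]
    ring
  · rw [h _ (ofReal_mem_slitPlane hc'), integral_inv_add_ofReal,
      ← integral_add_compl (measurableSet_Iic (a := c)) hr, Set.compl_Iic]
    push_cast
    ring

/-- The rate of the Euler approximation against a product of two Stieltjes functions: if `p` has
mean `t` and variance `c⁻²`, then `(ℒ p - e^{-t·}) f` is the Laplace transform of a measure of mass
at most `8 f(c)`. -/
theorem IsStieltjesProduct.laplaceBound {f : ℂ → ℂ} (hf : IsStieltjesProduct f)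
    {p : Measure ℝ≥0} [IsProbabilityMeasure p] {t c : ℝ≥0} (hc : 0 < c)
    (hp : HasMeanVariance p t ((c : ℝ)⁻¹ ^ 2)) :
    LaplaceBound (fun z => (laplace p z - Complex.exp (-((t : ℂ) * z))) * f z)
      (8 * (f ((c : ℝ) : ℂ)).re) := by
  obtain ⟨f₁, f₂, h₁, h₂, hf⟩ := hf
  obtain ⟨u₁, v₁, U₁, V₁, hu₁, hv₁, e₁, c₁⟩ := h₁.exists_split hc
  obtain ⟨u₂, v₂, U₂, V₂, hu₂, hv₂, e₂, c₂⟩ := h₂.exists_split hc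
  have hc' : (0 : ℝ) < c := NNReal.coe_pos.2 hc
  have b0 := LaplaceBound.laplace_sub_exp p t
  have b1 := LaplaceBound.laplace_sub_exp_div hp (inv_pos.2 hc') rfl
  have b2 := LaplaceBound.laplace_sub_exp_div_sq hp
  -- Each factor `v` carries its own power of `z`, taken from the Taylor quotient. The constants
  -- agree: `2·(2U₁)(2U₂)`, `c⁻¹·(2U₁)(4cV₂)`, `c⁻¹·(4cV₁)(2U₂)` and `(c⁻²/2)(4cV₁)(4cV₂)` are all
  -- `8` times a product of the `U`s and `V`s, with sum `8(U₁+V₁)(U₂+V₂)`.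
  refine (((b0.mul (hu₁.mul hu₂)).add ((b1.mul ((hu₁.mul hv₂).add (hv₁.mul hu₂))).add
    (b2.mul (hv₁.mul hv₂)))).mono (le_of_eq ?_)).congr fun z hz => ?_
  · rw [hf _ (ofReal_mem_slitPlane hc'), c₁, c₂, ← Complex.ofReal_mul, Complex.ofReal_re]
    field_simp
    ring
  · have hz0 : z ≠ 0 := by
      rintro rfl
      simp at hz
    rw [hf z (mem_slitPlane_of_re_pos hz), e₁ z hz, e₂ z hz]
    field_simp
    ring

end Stieltjes

/-! ### The operator estimate -/

namespace BoundedC0Semigroup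

variable {X : Type*} [NormedAddCommGroup X] [NormedSpace ℂ X]

theorem norm_average_sub_le (T : BoundedC0Semigroup X) (p q : Measure ℝ≥0) [IsFiniteMeasure p]
    [IsFiniteMeasure q] {C : ℝ} (hC : p.real Set.univ + q.real Set.univ ≤ C) (y : X) :
    ‖(T.average p - T.average q) y‖ ≤ T.bound * C * ‖y‖ := by
  rw [sub_apply]
  refine (norm_sub_le _ _).trans ((add_le_add (T.norm_average_apply_le p y)
    (T.norm_average_apply_le q y)).trans ?_)
  rw [← add_mul, ← mul_add]
  have := T.bound_nonneg
  gcongr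

/-- The relation `f g = 1` is needed only on `(0,∞)`, where Laplace transforms are already
determined. -/
theorem norm_eulerApprox_sub_le [CompleteSpace X] (T : BoundedC0Semigroup X) {A : X →ₗ.[ℂ] X}
    (hA : -A = T.generator) {f g : ℂ → ℂ} (hf : IsStieltjesProduct f)
    (hfg : ∀ r : ℝ, 0 < r → f r * g r = 1) (R : T.Regularizer g) (x : R.apply.domain) {n : ℕ}
    {t : ℝ≥0} (hn : 0 < n) (ht : 0 < t) :
    ‖eulerApprox A n t x - T.op t x‖ ≤
      12 * T.bound * (‖R.apply x‖ * (f ((Real.sqrt n / (t : ℝ) : ℝ) : ℂ)).re) := by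
  have hn' : (0 : ℝ) < n := Nat.cast_pos.2 hn
  have ht' : (0 : ℝ) < t := NNReal.coe_pos.2 ht
  obtain ⟨c, hc⟩ : ∃ c : ℝ≥0, (c : ℝ) = Real.sqrt n / (t : ℝ) :=
    ⟨⟨Real.sqrt n / (t : ℝ), by positivity⟩, rfl⟩
  have hc0 : 0 < c := by
    rw [← NNReal.coe_pos, hc]
    positivity
  have hp : HasMeanVariance (gammaDist (t / n) n) t ((c : ℝ)⁻¹ ^ 2) := by
    have := hasMeanVariance_gammaDist (t / n) n
    have e1 : (n : ℝ) * ((t / n : ℝ≥0) : ℝ) = t := by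
      push_cast
      field_simp
    -- The variance `t²/n` is `c⁻²` for `c = √n/t`; this fixes the splitting point and the argument
    -- of `g` in the rate.
    have e2 : (n : ℝ) * ((t / n : ℝ≥0) : ℝ) ^ 2 = (c : ℝ)⁻¹ ^ 2 := by
      rw [hc, inv_div, div_pow, Real.sq_sqrt hn'.le]
      push_cast
      field_simp
    rwa [e1, e2] at this
  have hb := hf.laplaceBound hc0 hp
  rw [hc] at hb
  have hF := hb.nonneg
  obtain ⟨p, q, _, _, hC, hpq⟩ := hb
  rw [T.eulerApprox_eq hA hn ht, ← T.average_dirac t,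
    R.average_apply_eq p q (gammaDist (t / n) n) (Measure.dirac t) (fun r hr => ?_) x]
  -- The mass bound gives the constant `8`, which is relaxed to `12` using that the value of `f` is
  -- nonnegative.
  · refine (T.norm_average_sub_le p q hC _).trans ?_
    have := T.bound_nonneg
    have h1 : 0 ≤ T.bound * (‖R.apply x‖ * (f ((Real.sqrt n / (t : ℝ) : ℝ) : ℂ)).re) :=
      mul_nonneg this (mul_nonneg (norm_nonneg _) (by linarith))
    linarith
  · rw [← hpq r (by simpa using hr), mul_assoc, hfg r hr, mul_one, laplace_dirac]

end BoundedC0Semigroup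

/-! ### Kaluza's theorem on reciprocals of log-convex power series -/

section Kaluza

/-- Log-convexity says that the ratios `u (n+1) / u n` increase. -/
theorem mul_le_mul_of_logConvex {u : ℕ → ℝ} (hpos : ∀ n, 0 < u n)
    (hlog : ∀ n, u (n + 1) ^ 2 ≤ u n * u (n + 2)) {i j : ℕ} (hij : i ≤ j) :
    u (i + 1) * u j ≤ u i * u (j + 1) := by
  induction j, hij using Nat.le_induction with
  | base => rw [mul_comm]
  | succ j _ ih =>
    refine le_of_mul_le_mul_right ?_ (hpos j)
    calc u (i + 1) * u (j + 1) * u j = (u (i + 1) * u j) * u (j + 1) := by ring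
      _ ≤ (u i * u (j + 1)) * u (j + 1) := mul_le_mul_of_nonneg_right ih (hpos _).le
      _ = u i * u (j + 1) ^ 2 := by ring
      _ ≤ u i * (u j * u (j + 2)) := mul_le_mul_of_nonneg_left (hlog j) (hpos i).le
      _ = u i * u (j + 1 + 1) * u j := by ring

/-- Every sequence with `u 0 ≠ 0` solves a renewal equation. -/
theorem exists_renewal {u : ℕ → ℝ} (h0 : u 0 ≠ 0) : ∃ ψ : ℕ → ℝ,
    ∀ n, u (n + 1) = ∑ k ∈ Finset.range (n + 1), ψ k * u (n - k) := by
  let U : PowerSeries ℝ := PowerSeries.mk u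
  have hU : PowerSeries.constantCoeff U ≠ 0 := by simpa [U] using h0
  -- The renewal equation is `U · U⁻¹ = 1` read off in degree `n + 1`, so `ψ` consists of the higher
  -- coefficients of `-u 0 · U⁻¹`.
  refine ⟨fun k => -u 0 * PowerSeries.coeff (k + 1) U⁻¹, fun n => ?_⟩
  have h1 := congrArg (PowerSeries.coeff (n + 1)) (PowerSeries.inv_mul_cancel U hU)
  rw [PowerSeries.coeff_mul, Finset.Nat.sum_antidiagonal_succ, PowerSeries.coeff_one] at h1
  have h2 : PowerSeries.coeff 0 U⁻¹ = (u 0)⁻¹ := by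
    rw [PowerSeries.coeff_zero_eq_constantCoeff_apply, PowerSeries.constantCoeff_inv]
    simp [U]
  simp only [h2, U, PowerSeries.coeff_mk, Nat.succ_ne_zero, if_false] at h1
  rw [Finset.Nat.sum_antidiagonal_eq_sum_range_succ_mk] at h1
  have h3 : u (n + 1) = -u 0 * ∑ k ∈ Finset.range (n + 1),
      PowerSeries.coeff (k + 1) (PowerSeries.mk u)⁻¹ * u (n - k) := by
    have : u 0 * ((u 0)⁻¹ * u (n + 1) + ∑ k ∈ Finset.range (n + 1),
      PowerSeries.coeff (k + 1) (PowerSeries.mk u)⁻¹ * u (n - k)) = 0 := by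
      rw [Finset.range_eq_Ico] at h1 ⊢
      simpa using Or.inr h1
    field_simp at this
    linarith
  rw [h3, Finset.mul_sum]
  exact Finset.sum_congr rfl fun k _ => by ring

/-- **Kaluza's theorem**: the coefficients of the renewal equation of a positive log-convex sequence
are nonnegative. -/
theorem renewal_nonneg {u ψ : ℕ → ℝ} (hpos : ∀ n, 0 < u n)
    (hlog : ∀ n, u (n + 1) ^ 2 ≤ u n * u (n + 2))
    (hψ : ∀ n, u (n + 1) = ∑ k ∈ Finset.range (n + 1), ψ k * u (n - k)) (n : ℕ) : 0 ≤ ψ n := by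
  induction n using Nat.strong_induction_on with
  | _ n ih =>
    have h1 := hψ n
    rw [Finset.sum_range_succ, Nat.sub_self] at h1
    rcases Nat.eq_zero_or_pos n with rfl | hn
    · simp only [Finset.range_zero, Finset.sum_empty, zero_add] at h1
      exact le_of_lt (pos_of_mul_pos_left (h1 ▸ hpos 1) (hpos 0).le)
    obtain ⟨m, rfl⟩ : ∃ m, n = m + 1 := ⟨n - 1, by omega⟩
    have h2 := hψ m
    -- The equation for `u (m+1)` is compared with that for `u (m+2)`. As ratios increase, `u
    -- (m+1-k) u (m+1) ≤ u (m-k) u (m+2)`, so the terms with already nonnegative `ψ k` sum to at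
    -- most `u (m+2)`; the rest is `ψ (m+1) * u 0`.
    have h3 : (∑ k ∈ Finset.range (m + 1), ψ k * u (m + 1 - k)) * u (m + 1) ≤
        u (m + 1) * u (m + 1 + 1) := by
      nth_rewrite 2 [h2]
      rw [Finset.sum_mul, Finset.sum_mul]
      refine Finset.sum_le_sum fun k hk => ?_
      have hk' : k ≤ m := Nat.lt_succ_iff.1 (Finset.mem_range.1 hk)
      have h4 := mul_le_mul_of_logConvex hpos hlog (i := m - k) (j := m + 1) (by omega)
      rw [show m - k + 1 = m + 1 - k by omega] at h4
      have := mul_le_mul_of_nonneg_left h4 (ih k (by omega))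
      linarith
    have h5 : 0 ≤ (ψ (m + 1) * u 0) * u (m + 1) := by
      have : ψ (m + 1) * u 0 =
          u (m + 1 + 1) - ∑ k ∈ Finset.range (m + 1), ψ k * u (m + 1 - k) := by linarith
      rw [this]
      linarith
    exact nonneg_of_mul_nonneg_left (nonneg_of_mul_nonneg_left h5 (hpos _)) (hpos _)

/-- As `u` decreases, the renewal equation gives `u (n+1) ≥ (∑_{k≤n} ψ k) u (n+1)`. -/
theorem renewal_sum_le_one {u ψ : ℕ → ℝ} (hpos : ∀ n, 0 < u n) (hanti : Antitone u)
    (hψ0 : ∀ k, 0 ≤ ψ k)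
    (hψ : ∀ n, u (n + 1) = ∑ k ∈ Finset.range (n + 1), ψ k * u (n - k)) (n : ℕ) :
    ∑ k ∈ Finset.range n, ψ k ≤ 1 := by
  refine (Finset.sum_le_sum_of_subset_of_nonneg (Finset.range_subset_range.2 n.le_succ)
    fun k _ _ => hψ0 k).trans ?_
  have h : (∑ k ∈ Finset.range (n + 1), ψ k) * u (n + 1) ≤ 1 * u (n + 1) := by
    rw [one_mul, Finset.sum_mul]
    nth_rewrite 2 [hψ n]
    exact Finset.sum_le_sum fun k _ => mul_le_mul_of_nonneg_left (hanti (by omega)) (hψ0 k)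
  exact le_of_mul_le_mul_right h (hpos _)

/-- The renewal equation in generating functions, `U = u 0 + w Ψ U`, via the Cauchy product on `|w|
< 1`. -/
theorem exists_kaluza {u : ℕ → ℝ} (hpos : ∀ n, 0 < u n) (hanti : Antitone u)
    (hlog : ∀ n, u (n + 1) ^ 2 ≤ u n * u (n + 2)) :
    ∃ ψ : ℕ → ℝ, (∀ k, 0 ≤ ψ k) ∧ Summable ψ ∧ ∑' k, ψ k ≤ 1 ∧ ∀ w : ℂ, ‖w‖ < 1 →
      (∑' n, (u n : ℂ) * w ^ n) * (1 - ∑' k, (ψ k : ℂ) * w ^ (k + 1)) = u 0 := by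
  obtain ⟨ψ, hψ⟩ := exists_renewal (hpos 0).ne'
  have h0 := renewal_nonneg hpos hlog hψ
  have h1 := renewal_sum_le_one hpos hanti h0 hψ
  have hs : Summable ψ := summable_of_sum_range_le h0 h1
  refine ⟨ψ, h0, hs, hs.tsum_le_of_sum_range_le h1, fun w hw => ?_⟩
  have hg : Summable fun n => u 0 * ‖w‖ ^ n :=
    (summable_geometric_of_lt_one (norm_nonneg w) hw).mul_left _
  have su : Summable fun n => ‖(u n : ℂ) * w ^ n‖ := by
    refine hg.of_nonneg_of_le (fun _ => norm_nonneg _) fun n => ?_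
    rw [norm_mul, norm_pow, Complex.norm_real, Real.norm_of_nonneg (hpos n).le]
    exact mul_le_mul_of_nonneg_right (hanti n.zero_le) (by positivity)
  have sψ : Summable fun n => ‖(ψ n : ℂ) * w ^ n‖ := by
    refine hs.of_nonneg_of_le (fun _ => norm_nonneg _) fun n => ?_
    rw [norm_mul, norm_pow, Complex.norm_real, Real.norm_of_nonneg (h0 n)]
    exact mul_le_of_le_one_right (h0 n) (pow_le_one₀ (norm_nonneg _) hw.le)
  have prod := tsum_mul_tsum_eq_tsum_sum_range_of_summable_norm sψ su
  have conv : ∀ n, ∑ k ∈ Finset.range (n + 1), (ψ k : ℂ) * w ^ k * ((u (n - k) : ℂ) * w ^ (n - k)) =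
      (u (n + 1) : ℂ) * w ^ n := by
    intro n
    rw [hψ n, Complex.ofReal_sum, Finset.sum_mul]
    refine Finset.sum_congr rfl fun k hk => ?_
    have hk' : k ≤ n := Nat.lt_succ_iff.1 (Finset.mem_range.1 hk)
    have : w ^ n = w ^ k * w ^ (n - k) := by rw [← pow_add, Nat.add_sub_of_le hk']
    rw [this]
    push_cast
    ring
  simp only [conv] at prod
  have e1 : ∑' k, (ψ k : ℂ) * w ^ (k + 1) = (∑' k, (ψ k : ℂ) * w ^ k) * w := by
    rw [← tsum_mul_right]
    exact tsum_congr fun k => by ring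
  have e2 : ∑' n, (u n : ℂ) * w ^ n = u 0 + (∑' n, (u (n + 1) : ℂ) * w ^ n) * w := by
    rw [su.of_norm.tsum_eq_zero_add, ← tsum_mul_right]
    congr 1
    · simp
    · exact tsum_congr fun k => by ring
  rw [e1]
  linear_combination (-w) * prod + e2

end Kaluza

/-! ### Hausdorff moment sequences -/

section HausdorffMoments

variable {Ω : Type*} [MeasurableSpace Ω] {P : Measure Ω} [IsFiniteMeasure P] {q : Ω → ℝ}

theorem integrable_pow_of_unit (hq : Measurable q) (h01 : ∀ᵐ ω ∂P, q ω ∈ Set.Icc (0 : ℝ) 1)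
    (n : ℕ) : Integrable (fun ω => q ω ^ n) P :=
  Integrable.of_bound (hq.pow_const n).aestronglyMeasurable 1 (h01.mono fun ω hω => by
    rw [Real.norm_of_nonneg (pow_nonneg hω.1 n)]
    exact pow_le_one₀ hω.1 hω.2)

theorem moment_antitone (hq : Measurable q) (h01 : ∀ᵐ ω ∂P, q ω ∈ Set.Icc (0 : ℝ) 1) :
    Antitone fun n : ℕ => ∫ ω, q ω ^ n ∂P := fun m n hmn =>
  integral_mono_ae (integrable_pow_of_unit hq h01 n) (integrable_pow_of_unit hq h01 m)
    (h01.mono fun _ hω => pow_le_pow_of_le_one hω.1 hω.2 hmn)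

theorem moment_logConvex (hq : Measurable q) (h01 : ∀ᵐ ω ∂P, q ω ∈ Set.Icc (0 : ℝ) 1) (n : ℕ)
    (hpos : 0 < ∫ ω, q ω ^ (n + 2) ∂P) :
    (∫ ω, q ω ^ (n + 1) ∂P) ^ 2 ≤ (∫ ω, q ω ^ n ∂P) * ∫ ω, q ω ^ (n + 2) ∂P := by
  have i := integrable_pow_of_unit hq h01
  set m0 := ∫ ω, q ω ^ n ∂P
  set m1 := ∫ ω, q ω ^ (n + 1) ∂P with hm1
  set m2 := ∫ ω, q ω ^ (n + 2) ∂P with hm2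
  -- Cauchy–Schwarz through its discriminant: the integral equals `m2 (m0 m2 - m1²)`, and `m2 > 0`
  -- is cancelled.
  have h : 0 ≤ ∫ ω, q ω ^ n * (m2 - m1 * q ω) ^ 2 ∂P :=
    integral_nonneg_of_ae (h01.mono fun ω hω => mul_nonneg (pow_nonneg hω.1 n) (sq_nonneg _))
  have e : ∀ ω, q ω ^ n * (m2 - m1 * q ω) ^ 2 =
      m2 ^ 2 * q ω ^ n - 2 * m2 * m1 * q ω ^ (n + 1) + m1 ^ 2 * q ω ^ (n + 2) := fun ω => by ring
  simp only [e] at h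
  have i1 : Integrable (fun ω => m2 ^ 2 * q ω ^ n - 2 * m2 * m1 * q ω ^ (n + 1)) P :=
    ((i n).const_mul _).sub ((i (n + 1)).const_mul _)
  rw [integral_add i1 ((i _).const_mul _), integral_sub ((i _).const_mul _) ((i _).const_mul _),
    integral_const_mul, integral_const_mul, integral_const_mul, ← hm1, ← hm2] at h
  have h2 : 0 ≤ m2 * (m0 * m2 - m1 ^ 2) := by
    refine h.trans (le_of_eq ?_)
    ring
  linarith [nonneg_of_mul_nonneg_right h2 hpos]

theorem hasSum_moment_mul_pow (hq : Measurable q) (h01 : ∀ᵐ ω ∂P, q ω ∈ Set.Icc (0 : ℝ) 1) {w : ℂ}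
    (hw : ‖w‖ < 1) :
    HasSum (fun n : ℕ => ((∫ ω, q ω ^ n ∂P : ℝ) : ℂ) * w ^ n) (∫ ω, (1 - (q ω : ℂ) * w)⁻¹ ∂P) := by
  have hF : ∀ n, AEStronglyMeasurable (fun ω => ((q ω : ℂ) * w) ^ n) P := fun n =>
    Measurable.aestronglyMeasurable (by fun_prop)
  have hb : ∀ᵐ ω ∂P, ‖(q ω : ℂ) * w‖ ≤ ‖w‖ := h01.mono fun ω hω => by
    rw [norm_mul, Complex.norm_real, Real.norm_of_nonneg hω.1]
    exact mul_le_of_le_one_left (norm_nonneg _) hω.2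
  have := hasSum_integral_of_dominated_convergence (μ := P) (F := fun n ω => ((q ω : ℂ) * w) ^ n)
    (f := fun ω => (1 - (q ω : ℂ) * w)⁻¹) (fun n _ => ‖w‖ ^ n) hF
    (fun n => hb.mono fun ω hω => by
      rw [norm_pow]
      exact pow_le_pow_left₀ (norm_nonneg _) hω n)
    (ae_of_all _ fun _ => summable_geometric_of_lt_one (norm_nonneg w) hw)
    (integrable_const _)
    (hb.mono fun ω hω => hasSum_geometric_of_norm_lt_one (hω.trans_lt hw))
  refine this.congr_fun fun n => ?_
  rw [← integral_complex_ofReal, ← integral_mul_const]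
  refine integral_congr_ae (ae_of_all _ fun ω => ?_)
  simp only
  push_cast
  ring

end HausdorffMoments

/-! ### Mass bounds for powers of `N / (N + z)` -/

section ResolventPowers

theorem one_add_mul_ne_zero (h : ℝ≥0) {z : ℂ} (hz : 0 < z.re) : 1 + (h : ℂ) * z ≠ 0 := by
  intro h0
  have := congrArg Complex.re h0
  have h1 : ((h : ℂ) * z).re = h * z.re := Complex.re_ofReal_mul _ _
  rw [Complex.add_re, h1] at this
  have : 0 ≤ (h : ℝ) * z.re := mul_nonneg h.2 hz.le
  simp only [Complex.one_re, Complex.zero_re] at *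
  linarith

theorem one_add_ne_zero {z : ℂ} (hz : 0 < z.re) : 1 + z ≠ 0 := by
  simpa using one_add_mul_ne_zero 1 hz

theorem LaplaceBound.inv_one_add_mul (h : ℝ≥0) : LaplaceBound (fun z => (1 + (h : ℂ) * z)⁻¹) 1 := by
  refine ⟨expDist h, 0, inferInstance, inferInstance, by simp, fun z hz => ?_⟩
  rw [laplace_expDist h hz.le]
  simp [laplace]

theorem LaplaceBound.inv_one_add : LaplaceBound (fun z => (1 + z)⁻¹) 1 := by
  simpa using LaplaceBound.inv_one_add_mul 1

variable {N : ℝ≥0}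

theorem add_ne_zero_of_re_pos (N : ℝ≥0) {z : ℂ} (hz : 0 < z.re) : ((N : ℝ) : ℂ) + z ≠ 0 := by
  rw [add_comm]
  exact add_ofReal_ne_zero hz N

theorem LaplaceBound.div_add (hN : 1 ≤ N) :
    LaplaceBound (fun z => ((N : ℝ) : ℂ) / (((N : ℝ) : ℂ) + z)) 1 := by
  refine (LaplaceBound.inv_one_add_mul N⁻¹).congr fun z hz => ?_
  have h0 : ((N : ℝ) : ℂ) ≠ 0 := by
    have : N ≠ 0 := (one_pos.trans_le hN).ne'
    exact_mod_cast this
  have := add_ne_zero_of_re_pos N hz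
  push_cast
  rw [inv_eq_iff_eq_inv, inv_div]
  field_simp

/-- With `w = N/(N+z)`, `1 - w = z/(N+z) = N⁻¹ z w`, and `z/(1+z) = 1 - (1+z)⁻¹` has mass at most
`2`. -/
theorem LaplaceBound.inv_one_add_mul_sub (hN : 1 ≤ N) :
    LaplaceBound (fun z => (1 + z)⁻¹ * (1 - ((N : ℝ) : ℂ) / (((N : ℝ) : ℂ) + z))) (2 / N) := by
  have h := ((LaplaceBound.one.sub LaplaceBound.inv_one_add).mul
    (LaplaceBound.div_add hN)).smul_of_nonneg (c := (N : ℝ)⁻¹) (by positivity)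
  refine (h.mono (le_of_eq (by ring))).congr fun z hz => ?_
  have h0 : ((N : ℝ) : ℂ) ≠ 0 := by
    have : N ≠ 0 := (one_pos.trans_le hN).ne'
    exact_mod_cast this
  have := add_ne_zero_of_re_pos N hz
  have := one_add_ne_zero hz
  push_cast
  field_simp
  ring

/-- Bernoulli's inequality for `(1 + 1/N)^k`. Here `N/(N+1)` is the value of `N/(N+z)` at `z = 1`,
so masses become comparable with values at `1`. -/
theorem div_add_one_le_one_sub_pow (hN : 1 ≤ N) (k : ℕ) :
    ((k : ℝ) / N) / (1 + (k : ℝ) / N) ≤ 1 - ((N : ℝ) / (N + 1)) ^ k := by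
  have hN0 : (0 : ℝ) < N := NNReal.coe_pos.2 (one_pos.trans_le hN)
  have h1 : 1 + (k : ℝ) * (N : ℝ)⁻¹ ≤ (1 + (N : ℝ)⁻¹) ^ k :=
    one_add_mul_le_pow (by have := inv_pos.2 hN0; linarith) k
  have h2 : (N : ℝ) / (N + 1) = (1 + (N : ℝ)⁻¹)⁻¹ := by
    field_simp
  have h3 : ((N : ℝ) / (N + 1)) ^ k ≤ (1 + (k : ℝ) * (N : ℝ)⁻¹)⁻¹ := by
    rw [h2, inv_pow]
    exact inv_anti₀ (by positivity) h1
  have h4 : ((k : ℝ) / N) / (1 + (k : ℝ) / N) = 1 - (1 + (k : ℝ) * (N : ℝ)⁻¹)⁻¹ := by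
    field_simp
    ring
  rw [h4]
  linarith

/-- Let `x = k/N`. For `x ≤ 1` the geometric sum `1 - w^k = (1 - w)∑ w^j` gives mass `2x`; for `x ≥
1` the trivial bound is `2`. Both are at most `4x/(1+x)`. -/
theorem LaplaceBound.inv_one_add_mul_one_sub_pow (hN : 1 ≤ N) (k : ℕ) :
    LaplaceBound (fun z => (1 + z)⁻¹ * (1 - (((N : ℝ) : ℂ) / (((N : ℝ) : ℂ) + z)) ^ k))
      (4 * (1 - ((N : ℝ) / (N + 1)) ^ k)) := by
  have hN0 : (0 : ℝ) < N := NNReal.coe_pos.2 (one_pos.trans_le hN)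
  have hk := div_add_one_le_one_sub_pow hN k
  have hx0 : 0 ≤ (k : ℝ) / N := by positivity
  rcases le_total ((k : ℝ) / N) 1 with hx | hx
  · have h := (LaplaceBound.inv_one_add_mul_sub hN).mul
      (LaplaceBound.finset_sum (Finset.range k) fun j _ => (LaplaceBound.div_add hN).pow j)
    refine (h.mono ?_).congr fun z _ => ?_
    · have h1 : (k : ℝ) / N / 2 ≤ (k : ℝ) / N / (1 + k / N) :=
        div_le_div_of_nonneg_left hx0 (by positivity) (by linarith)
      simp only [one_pow, Finset.sum_const, Finset.card_range, nsmul_eq_mul, mul_one]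
      have e : 2 / (N : ℝ) * k = 2 * ((k : ℝ) / N) := by ring
      linarith
    · rw [← mul_neg_geom_sum (((N : ℝ) : ℂ) / (((N : ℝ) : ℂ) + z)) k]
      ring
  · refine (LaplaceBound.inv_one_add.mul
      (LaplaceBound.one.sub ((LaplaceBound.div_add hN).pow k))).mono ?_
    have h1 : 1 / 2 ≤ (k : ℝ) / N / (1 + k / N) := by
      rw [div_le_div_iff₀ (by norm_num) (by positivity)]
      linarith
    rw [one_pow]
    linarith

theorem LaplaceBound.inv_one_add_mul_one_add_div (hN : 1 ≤ N) :
    LaplaceBound (fun z => (1 + z)⁻¹ * (1 + z / ((N : ℝ) : ℂ))) 3 := by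
  have hN1 : (1 : ℝ) ≤ N := by exact_mod_cast hN
  have h := LaplaceBound.inv_one_add.add
    ((LaplaceBound.one.sub LaplaceBound.inv_one_add).smul_of_nonneg (c := (N : ℝ)⁻¹)
      (by positivity))
  refine (h.mono ?_).congr fun z hz => ?_
  · have := inv_le_one_of_one_le₀ hN1
    linarith
  · have := one_add_ne_zero hz
    have h0 : ((N : ℝ) : ℂ) ≠ 0 := by
      have : (N : ℝ) ≠ 0 := by linarith
      exact_mod_cast this
    push_cast
    field_simp
    ring

/-- Since `(1+z)⁻¹(1 + z/N) = (1+z)⁻¹ + N⁻¹(1 - (1+z)⁻¹)`, an extra mass `4/N` appears. The exponent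
is at least `1`, so this is at most `8` times `1 - (N/(N+1))^(k+1)`, and `12 = 4 + 8`. -/
theorem LaplaceBound.one_add_div_mul_one_sub_pow (hN : 1 ≤ N) (k : ℕ) :
    LaplaceBound (fun z => (1 + z)⁻¹ * (1 + z / ((N : ℝ) : ℂ)) *
      (1 - (((N : ℝ) : ℂ) / (((N : ℝ) : ℂ) + z)) ^ (k + 1)))
      (12 * (1 - ((N : ℝ) / (N + 1)) ^ (k + 1))) := by
  have hN1 : (1 : ℝ) ≤ N := by exact_mod_cast hN
  have hN0 : (0 : ℝ) < N := by linarith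
  have h := (LaplaceBound.inv_one_add_mul_one_sub_pow hN (k + 1)).add
    (((LaplaceBound.one.sub LaplaceBound.inv_one_add).mul
      (LaplaceBound.one.sub ((LaplaceBound.div_add hN).pow (k + 1)))).smul_of_nonneg
        (c := (N : ℝ)⁻¹) (by positivity))
  refine (h.mono ?_).congr fun z hz => ?_
  · have h1 := div_add_one_le_one_sub_pow hN (k + 1)
    have h2 : (N : ℝ)⁻¹ / 2 ≤ ((k + 1 : ℕ) : ℝ) / N / (1 + ((k + 1 : ℕ) : ℝ) / N) := by
      push_cast
      have e : (k + 1 : ℝ) / N / (1 + (k + 1) / N) = (k + 1) / (N + (k + 1)) := by field_simp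
      have e2 : (N : ℝ)⁻¹ / 2 = 1 / (2 * N) := by field_simp
      rw [e, e2, div_le_div_iff₀ (by positivity) (by positivity)]
      nlinarith [mul_le_mul_of_nonneg_right hN1 (Nat.cast_nonneg k : (0 : ℝ) ≤ k)]
    rw [one_pow]
    linarith
  · have := one_add_ne_zero hz
    have h0 : ((N : ℝ) : ℂ) ≠ 0 := by exact_mod_cast hN0.ne'
    have e : (1 + z)⁻¹ * (1 + z / ((N : ℝ) : ℂ)) =
        (1 + z)⁻¹ + ((N : ℝ) : ℂ)⁻¹ * (1 - (1 + z)⁻¹) := by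
      field_simp
      ring
    rw [e]
    push_cast
    ring

theorem norm_div_add_lt_one (hN : 1 ≤ N) {z : ℂ} (hz : 0 < z.re) :
    ‖((N : ℝ) : ℂ) / (((N : ℝ) : ℂ) + z)‖ < 1 := by
  have hN0 : (0 : ℝ) < N := NNReal.coe_pos.2 (one_pos.trans_le hN)
  rw [norm_div, div_lt_one (norm_pos_iff.2 (add_ne_zero_of_re_pos N hz)), Complex.norm_real,
    Real.norm_of_nonneg hN0.le]
  refine lt_of_lt_of_le ?_ (Complex.re_le_norm _)
  simpa using hz

theorem summable_mul_pow {ψ : ℕ → ℝ} (h0 : ∀ k, 0 ≤ ψ k) (hs : Summable ψ) {w : ℂ}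
    (hw : ‖w‖ ≤ 1) : Summable fun k => (ψ k : ℂ) * w ^ (k + 1) := by
  refine Summable.of_norm (hs.of_nonneg_of_le (fun _ => norm_nonneg _) fun k => ?_)
  rw [norm_mul, norm_pow, Complex.norm_real, Real.norm_of_nonneg (h0 k)]
  exact mul_le_of_le_one_right (h0 k) (pow_le_one₀ (norm_nonneg _) hw)

/-- Write `1 - ∑ ψ_k w^{k+1} = (1 - ∑ ψ_k) + ∑ ψ_k (1 - w^{k+1})`; all coefficients are nonnegative,
so the mass is at most `12` times the same expression at `z = 1`. -/
theorem LaplaceBound.one_sub_tsum {ψ : ℕ → ℝ} (hN : 1 ≤ N) (h0 : ∀ k, 0 ≤ ψ k) (hs : Summable ψ)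
    (h1 : ∑' k, ψ k ≤ 1) :
    LaplaceBound (fun z => (1 + z)⁻¹ * (1 + z / ((N : ℝ) : ℂ)) *
      (1 - ∑' k, (ψ k : ℂ) * (((N : ℝ) : ℂ) / (((N : ℝ) : ℂ) + z)) ^ (k + 1)))
      (12 * (1 - ∑' k, ψ k * ((N : ℝ) / (N + 1)) ^ (k + 1))) := by
  have hω0 : 0 ≤ (N : ℝ) / (N + 1) := by positivity
  have hω1 : (N : ℝ) / (N + 1) ≤ 1 := by
    rw [div_le_one (by positivity)]
    linarith
  have hsω : Summable fun k => ψ k * ((N : ℝ) / (N + 1)) ^ (k + 1) :=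
    hs.of_nonneg_of_le (fun k => mul_nonneg (h0 k) (by positivity)) fun k =>
      mul_le_of_le_one_right (h0 k) (pow_le_one₀ hω0 hω1)
  have hsum := LaplaceBound.hasSum
    (G := fun z => (1 + z)⁻¹ * (1 + z / ((N : ℝ) : ℂ)) *
      (((∑' k, ψ k : ℝ) : ℂ) - ∑' k, (ψ k : ℂ) * (((N : ℝ) : ℂ) / (((N : ℝ) : ℂ) + z)) ^ (k + 1)))
    (fun k => (LaplaceBound.one_add_div_mul_one_sub_pow hN k).smul_of_nonneg (h0 k))
    (by
      refine ((hs.sub hsω).mul_left 12).congr fun k => ?_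
      ring)
    (fun z hz => by
      have s1 : HasSum (fun k => (ψ k : ℂ)) ((∑' k, ψ k : ℝ) : ℂ) :=
        Complex.hasSum_ofReal.2 hs.hasSum
      have s2 := (summable_mul_pow h0 hs (norm_div_add_lt_one hN hz).le).hasSum
      refine ((s1.sub s2).mul_left ((1 + z)⁻¹ * (1 + z / ((N : ℝ) : ℂ)))).congr_fun fun k => ?_
      ring)
  have h := ((LaplaceBound.inv_one_add_mul_one_add_div hN).smul_of_nonneg
    (sub_nonneg.2 h1)).add hsum
  refine (h.mono ?_).congr fun z _ => ?_
  · have e : ∑' k, ψ k * (12 * (1 - ((N : ℝ) / (N + 1)) ^ (k + 1))) =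
        12 * (∑' k, ψ k - ∑' k, ψ k * ((N : ℝ) / (N + 1)) ^ (k + 1)) := by
      rw [← hs.tsum_sub hsω, ← tsum_mul_left]
      exact tsum_congr fun k => by ring
    rw [e]
    linarith
  · push_cast
    ring

end ResolventPowers

/-! ### Reciprocals of truncated Stieltjes functions -/

section TruncatedStieltjes

variable {μ : Measure ℝ≥0} {N : ℝ≥0}

/-- The Stieltjes function `f_N = a N / (N + z) + ∫_{[0,N]} μ(dτ) / (z + τ)`. -/
noncomputable def truncatedStieltjes (a : ℝ≥0) (μ : Measure ℝ≥0) (N : ℝ≥0) (z : ℂ) : ℂ :=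
  ((a : ℝ) : ℂ) * (((N : ℝ) : ℂ) / (((N : ℝ) : ℂ) + z)) +
    ∫ τ in Set.Iic N, (z + ((τ : ℝ) : ℂ))⁻¹ ∂μ

theorem truncatedStieltjes_one (a : ℝ≥0) (μ : Measure ℝ≥0) (N : ℝ≥0) :
    truncatedStieltjes a μ N 1 =
      ((a * ((N : ℝ) / (N + 1)) + ∫ τ in Set.Iic N, (1 + (τ : ℝ))⁻¹ ∂μ : ℝ) : ℂ) := by
  have := integral_inv_add_ofReal (μ.restrict (Set.Iic N)) 1
  rw [Complex.ofReal_one] at this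
  rw [truncatedStieltjes, this]
  push_cast
  rfl

/-- The bound depends on the truncation only through its value at `1`, so it stays uniform as `N →
∞`. Mass in `[0,N)` keeps every moment of `1 - τ/N` positive, as Kaluza's theorem requires. -/
theorem truncatedStieltjes_laplaceBound
    (hμ : Integrable (fun τ : ℝ≥0 => (1 + (τ : ℝ))⁻¹) μ) (a : ℝ≥0) (hN : 1 ≤ N)
    (hpos : 0 < μ (Set.Iio N)) :
    (∀ z : ℂ, 0 < z.re → truncatedStieltjes a μ N z ≠ 0) ∧
    LaplaceBound (fun z => (1 + z)⁻¹ / truncatedStieltjes a μ N z)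
      (12 / (a * ((N : ℝ) / (N + 1)) + ∫ τ in Set.Iic N, (1 + (τ : ℝ))⁻¹ ∂μ)) := by
  have hN1 : (1 : ℝ) ≤ N := by exact_mod_cast hN
  have hN0 : (0 : ℝ) < N := by linarith
  have hNc : ((N : ℝ) : ℂ) ≠ 0 := by exact_mod_cast hN0.ne'
  have hfin : IsFiniteMeasure (μ.restrict (Set.Iic N)) :=
    ⟨by simpa using measure_Iic_lt_top hμ N⟩
  let q : ℝ≥0 → ℝ := fun τ => 1 - (τ : ℝ) / N
  have hq : Measurable q := by fun_prop
  have h01 : ∀ᵐ τ ∂(μ.restrict (Set.Iic N)), q τ ∈ Set.Icc (0 : ℝ) 1 := by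
    refine (ae_restrict_iff' measurableSet_Iic).2 (ae_of_all _ fun τ hτ => ?_)
    have h1 : (τ : ℝ) ≤ N := NNReal.coe_le_coe.2 hτ
    have h2 : (τ : ℝ) / N ≤ 1 := (div_le_one hN0).2 h1
    have h3 : 0 ≤ (τ : ℝ) / N := by positivity
    exact ⟨by simp only [q]; linarith, by simp only [q]; linarith⟩
  let m : ℕ → ℝ := fun n => ∫ τ in Set.Iic N, q τ ^ n ∂μ
  have hm : ∀ n, 0 < m n := by
    intro n
    refine (integral_pos_iff_support_of_nonneg_ae (h01.mono fun τ hτ => pow_nonneg hτ.1 n)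
      (integrable_pow_of_unit hq h01 n)).2 (hpos.trans_le ?_)
    rw [Measure.restrict_apply' measurableSet_Iic]
    refine measure_mono fun τ hτ => ⟨?_, (Set.mem_Iio.1 hτ).le⟩
    have h1 : (τ : ℝ) < N := NNReal.coe_lt_coe.2 hτ
    have h2 : (τ : ℝ) / N < 1 := (div_lt_one hN0).2 h1
    exact pow_ne_zero n (by simp only [q]; linarith)
  -- The constant `a`, truncated to `aN/(N+z)`, only raises the zeroth coefficient, which preserves
  -- both monotonicity and log-convexity.
  let u : ℕ → ℝ := fun n => m n + if n = 0 then (a : ℝ) * N else 0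
  have haN : 0 ≤ (a : ℝ) * N := by positivity
  have hu : ∀ n, m n ≤ u n := fun n => by
    simp only [u]
    split_ifs <;> linarith
  have hu' : ∀ n, u (n + 1) = m (n + 1) := fun n => by simp [u]
  have hupos : ∀ n, 0 < u n := fun n => (hm n).trans_le (hu n)
  have hanti : Antitone u := antitone_nat_of_succ_le fun n => by
    rw [hu']
    exact (moment_antitone hq h01 n.le_succ).trans (hu n)
  have hlog : ∀ n, u (n + 1) ^ 2 ≤ u n * u (n + 2) := fun n => by
    rw [hu', hu']
    exact (moment_logConvex hq h01 n (hm (n + 2))).trans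
      (mul_le_mul_of_nonneg_right (hu n) (hm (n + 2)).le)
  obtain ⟨ψ, hψ0, hψs, hψ1, hψ⟩ := exists_kaluza hupos hanti hlog
  have hU : ∀ z : ℂ, 0 < z.re → truncatedStieltjes a μ N z =
      (((N : ℝ) : ℂ) + z)⁻¹ * ∑' n, (u n : ℂ) * (((N : ℝ) : ℂ) / (((N : ℝ) : ℂ) + z)) ^ n := by
    intro z hz
    have hNz := add_ne_zero_of_re_pos N hz
    have s1 := hasSum_moment_mul_pow hq h01 (norm_div_add_lt_one hN hz)
    have s2 : HasSum (fun n : ℕ => ((if n = 0 then (a : ℝ) * N else 0 : ℝ) : ℂ) *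
        (((N : ℝ) : ℂ) / (((N : ℝ) : ℂ) + z)) ^ n) (((a : ℝ) * N : ℝ) : ℂ) := by
      convert hasSum_single (f := fun n : ℕ => ((if n = 0 then (a : ℝ) * N else 0 : ℝ) : ℂ) *
        (((N : ℝ) : ℂ) / (((N : ℝ) : ℂ) + z)) ^ n) 0 (fun n hn => by simp [hn]) using 1
      simp
    have s3 := (s1.add s2).tsum_eq
    have e : ∀ n : ℕ, (u n : ℂ) * (((N : ℝ) : ℂ) / (((N : ℝ) : ℂ) + z)) ^ n =
        ((∫ τ in Set.Iic N, q τ ^ n ∂μ : ℝ) : ℂ) * (((N : ℝ) : ℂ) / (((N : ℝ) : ℂ) + z)) ^ n +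
        ((if n = 0 then (a : ℝ) * N else 0 : ℝ) : ℂ) *
          (((N : ℝ) : ℂ) / (((N : ℝ) : ℂ) + z)) ^ n := by
      intro n
      simp only [u, m]
      rw [Complex.ofReal_add, add_mul]
    simp only [e]
    rw [s3, mul_add, truncatedStieltjes, add_comm]
    congr 1
    · rw [← integral_const_mul]
      refine integral_congr_ae (ae_of_all _ fun τ => ?_)
      have := add_ofReal_ne_zero hz τ
      -- This identity gives `(z+τ)⁻¹ = (N+z)⁻¹ (1 - q w)⁻¹`, whose geometric expansion produces the
      -- moments.
      have h3 : 1 - (q τ : ℂ) * (((N : ℝ) : ℂ) / (((N : ℝ) : ℂ) + z)) =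
          (z + ((τ : ℝ) : ℂ)) / (((N : ℝ) : ℂ) + z) := by
        simp only [q]
        push_cast
        field_simp
        ring
      simp only
      rw [h3, inv_div]
      field_simp
    · push_cast
      field_simp
  have hne : ∀ z : ℂ, 0 < z.re → truncatedStieltjes a μ N z ≠ 0 := by
    intro z hz h0
    have h1 := hψ _ (norm_div_add_lt_one hN hz)
    rw [hU z hz, mul_eq_zero, or_iff_right (inv_ne_zero (add_ne_zero_of_re_pos N hz))] at h0
    rw [h0, zero_mul] at h1
    have : u 0 = 0 := by exact_mod_cast h1.symm
    exact (hupos 0).ne' this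
  refine ⟨hne, ?_⟩
  have hb := (LaplaceBound.one_sub_tsum hN hψ0 hψs hψ1).smul_of_nonneg
    (c := (N : ℝ) / u 0) (div_nonneg hN0.le (hupos 0).le)
  have hu0 : (u 0 : ℂ) ≠ 0 := by exact_mod_cast (hupos 0).ne'
  refine (hb.mono ?_).congr fun z hz => ?_
  · set F : ℝ := a * ((N : ℝ) / (N + 1)) + ∫ τ in Set.Iic N, (1 + (τ : ℝ))⁻¹ ∂μ with hF
    have hF0 : 0 ≤ F :=
      add_nonneg (by positivity) (integral_nonneg fun τ => by positivity)
    have hFne : F ≠ 0 := by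
      have := hne 1 (by simp)
      rw [truncatedStieltjes_one] at this
      exact_mod_cast this
    -- Kaluza's identity at `z = 1` evaluates the mass bound: `1 - ∑ ψ_k (N/(N+1))^{k+1} = u 0 /
    -- ((N+1)F)`.
    have h1 := hψ _ (norm_div_add_lt_one hN (z := 1) (by simp))
    have h2 := hU 1 (by simp)
    rw [truncatedStieltjes_one, ← hF] at h2
    have hN1c : ((N : ℝ) : ℂ) + 1 ≠ 0 := add_ne_zero_of_re_pos N (by simp)
    have h3 : ∑' n, (u n : ℂ) * (((N : ℝ) : ℂ) / (((N : ℝ) : ℂ) + 1)) ^ n =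
        (((N : ℝ) : ℂ) + 1) * F := by
      rw [h2]
      field_simp
    rw [h3] at h1
    have h4 : ((N : ℝ) + 1) * F * (1 - ∑' k, ψ k * ((N : ℝ) / (N + 1)) ^ (k + 1)) = u 0 := by
      exact_mod_cast h1
    have h5 : 1 - ∑' k, ψ k * ((N : ℝ) / (N + 1)) ^ (k + 1) = u 0 / (((N : ℝ) + 1) * F) := by
      rw [eq_div_iff (by positivity), ← h4]
      ring
    rw [h5]
    have hFpos : 0 < F := lt_of_le_of_ne hF0 hFne.symm
    have hu0' := hupos 0
    have e : (N : ℝ) / u 0 * (12 * (u 0 / ((N + 1) * F))) = 12 / F * (N / (N + 1)) := by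
      field_simp
    rw [e]
    refine mul_le_of_le_one_right (by positivity) ?_
    rw [div_le_one (by positivity)]
    linarith
  · have h1 := hψ _ (norm_div_add_lt_one hN hz)
    have hNz := add_ne_zero_of_re_pos N hz
    have hz1 := one_add_ne_zero hz
    have hf := hne z hz
    rw [eq_div_iff hf, hU z hz]
    calc _ = (((N : ℝ) / u 0 : ℝ) : ℂ) * ((1 + z)⁻¹ * (1 + z / ((N : ℝ) : ℂ))) *
          (((N : ℝ) : ℂ) + z)⁻¹ *
          ((∑' n, (u n : ℂ) * (((N : ℝ) : ℂ) / (((N : ℝ) : ℂ) + z)) ^ n) *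
          (1 - ∑' k, (ψ k : ℂ) * (((N : ℝ) : ℂ) / (((N : ℝ) : ℂ) + z)) ^ (k + 1))) := by ring
      _ = _ := by
        rw [h1]
        push_cast
        field_simp

end TruncatedStieltjes

/-! ### Reciprocals of Stieltjes functions by approximation -/

section StieltjesReciprocal

/-- Reciprocals of approximants converge, after multiplication with a power of a common factor. -/
theorem LaplaceBound.of_approx {J f : ℂ → ℂ} {F : ℕ → ℂ → ℂ} {B : ℝ} (hJ : LaplaceBound J 1)
    (hf : ∀ z : ℂ, 0 < z.re → f z ≠ 0) (hF : ∀ j, ∀ z : ℂ, 0 < z.re → F j z ≠ 0)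
    (hB : ∀ j, LaplaceBound (fun z => J z / F j z) B)
    (hd : ∀ j, LaplaceBound (fun z => J z * (f z - F j z)) ((1 / 2) ^ j)) :
    ∃ C, LaplaceBound (fun z => J z ^ 3 / f z) C := by
  -- A difference of reciprocals is `(J/F_{j+1})(J/F_j) · J(F_j - F_{j+1})`: each of the three
  -- factors uses up one `J`.
  have hdiff : ∀ j, LaplaceBound (fun z => J z ^ 3 / F (j + 1) z - J z ^ 3 / F j z)
      (B * B * ((1 / 2) ^ (j + 1) + (1 / 2) ^ j)) := fun j =>
    (((hB (j + 1)).mul (hB j)).mul ((hd (j + 1)).sub (hd j))).congr fun z hz => by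
      have h1 := hF j z hz
      have h2 := hF (j + 1) z hz
      field_simp
      ring
  have hs : Summable fun j : ℕ => ((1 / 2) ^ j : ℝ) := summable_geometric_two
  have hC : Summable fun j : ℕ => B * B * ((1 / 2) ^ (j + 1) + (1 / 2) ^ j) :=
    (((summable_nat_add_iff 1).2 hs).add hs).mul_left _
  have hlim : ∀ z : ℂ, 0 < z.re → Tendsto (fun j => J z ^ 3 / F j z) atTop (𝓝 (J z ^ 3 / f z)) := by
    intro z hz
    rw [tendsto_iff_norm_sub_tendsto_zero]
    have h0 : Tendsto (fun j : ℕ => B * ‖J z / f z‖ * (1 / 2) ^ j) atTop (𝓝 0) := by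
      simpa using (tendsto_pow_atTop_nhds_zero_of_lt_one (r := (1 / 2 : ℝ)) (by norm_num)
        (by norm_num)).const_mul (B * ‖J z / f z‖)
    refine squeeze_zero (fun _ => norm_nonneg _) (fun j => ?_) h0
    have e : J z ^ 3 / F j z - J z ^ 3 / f z =
        J z / F j z * (J z / f z) * (J z * (f z - F j z)) := by
      have h1 := hF j z hz
      have h2 := hf z hz
      field_simp
    rw [e, norm_mul, norm_mul]
    have hb := (hB j).norm_le hz
    have hB0 := (hB j).nonneg
    exact mul_le_mul (mul_le_mul_of_nonneg_right hb (norm_nonneg _)) ((hd j).norm_le hz)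
      (norm_nonneg _) (by positivity)
  -- The series telescopes to the limit of `J³/F_j` minus its initial term.
  have hG := LaplaceBound.hasSum (G := fun z => J z ^ 3 / f z - J z ^ 3 / F 0 z) hdiff hC
    fun z hz => by
      rw [(Summable.of_norm_bounded hC fun j => (hdiff j).norm_le hz).hasSum_iff_tendsto_nat]
      simp only [Finset.sum_range_sub (fun j => J z ^ 3 / F j z)]
      exact (hlim z hz).sub_const _
  exact ⟨_, (hG.add ((hJ.pow 2).mul (hB 0))).congr fun z _ => by ring⟩

variable {μ : Measure ℝ≥0}

theorem tendsto_setIntegral_Ioi_zero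
    (hμ : Integrable (fun τ : ℝ≥0 => (1 + (τ : ℝ))⁻¹) μ) :
    Tendsto (fun n : ℕ => ∫ τ in Set.Ioi (n : ℝ≥0), (1 + (τ : ℝ))⁻¹ ∂μ) atTop (𝓝 0) := by
  have h := Antitone.tendsto_setIntegral (μ := μ) (s := fun n : ℕ => Set.Ioi (n : ℝ≥0))
    (fun _ => measurableSet_Ioi) (fun m n hmn => Set.Ioi_subset_Ioi (Nat.cast_le.2 hmn))
    hμ.integrableOn
  have he : ⋂ n : ℕ, Set.Ioi (n : ℝ≥0) = ∅ := by
    refine Set.eq_empty_of_forall_notMem fun x hx => ?_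
    obtain ⟨n, hn⟩ := exists_nat_ge x
    exact not_lt.2 hn (Set.mem_iInter.1 hx n)
  rwa [he, setIntegral_empty] at h

/-- The error is `a(1 - N/(N+z))`, small only after multiplication with `(1+z)⁻¹`, plus the tail of
`μ`, where `τ > 1` gives `τ⁻¹ ≤ 2(1+τ)⁻¹`. -/
theorem LaplaceBound.inv_one_add_mul_sub_truncatedStieltjes {f : ℂ → ℂ} {a N : ℝ≥0}
    (hμ : Integrable (fun τ : ℝ≥0 => (1 + (τ : ℝ))⁻¹) μ)
    (hf : ∀ z ∈ Complex.slitPlane, f z = ((a : ℝ) : ℂ) + ∫ τ : ℝ≥0, (z + ((τ : ℝ) : ℂ))⁻¹ ∂μ)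
    (hN : 1 ≤ N) :
    LaplaceBound (fun z => (1 + z)⁻¹ * (f z - truncatedStieltjes a μ N z))
      (2 * a / N + 2 * ∫ τ in Set.Ioi N, (1 + (τ : ℝ))⁻¹ ∂μ) := by
  have hN1 : (1 : ℝ) ≤ N := by exact_mod_cast hN
  have hle : ∀ τ ∈ Set.Ioi N, (τ : ℝ)⁻¹ ≤ 2 * (1 + (τ : ℝ))⁻¹ := fun τ hτ => by
    have : (N : ℝ) < τ := NNReal.coe_lt_coe.2 hτ
    have h0 : (0 : ℝ) < τ := by linarith
    rw [← div_eq_mul_inv, inv_eq_one_div, div_le_div_iff₀ h0 (by linarith)]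
    linarith
  have hi2 : IntegrableOn (fun τ : ℝ≥0 => 2 * (1 + (τ : ℝ))⁻¹) (Set.Ioi N) μ :=
    (hμ.const_mul 2).integrableOn
  have hi : IntegrableOn (fun τ : ℝ≥0 => (τ : ℝ)⁻¹) (Set.Ioi N) μ := by
    refine hi2.mono' (Measurable.aestronglyMeasurable (by fun_prop))
      ((ae_restrict_iff' measurableSet_Ioi).2 (ae_of_all _ fun τ hτ => ?_))
    rw [Real.norm_of_nonneg (by positivity)]
    exact hle τ hτ
  have htail := (LaplaceBound.setIntegral_inv_add measurableSet_Ioi (by simp) hi).mono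
    (setIntegral_mono_on hi hi2 measurableSet_Ioi hle)
  rw [integral_const_mul] at htail
  refine ((((LaplaceBound.inv_one_add_mul_sub hN).smul_of_nonneg a.2).add
    (LaplaceBound.inv_one_add.mul htail)).mono (le_of_eq ?_)).congr fun z hz => ?_
  · change (a : ℝ) * _ + _ = _
    ring
  · have hsp := integral_add_compl (μ := μ) (measurableSet_Iic (a := N))
      (integrable_inv_add hμ (mem_slitPlane_of_re_pos hz))
    rw [Set.compl_Iic] at hsp
    rw [hf z (mem_slitPlane_of_re_pos hz), ← hsp, truncatedStieltjes]
    change ((a : ℝ) : ℂ) * _ + _ = _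
    ring

/-- Every nonzero Stieltjes function has a reciprocal that becomes a Laplace transform when
multiplied with `(1 + z)⁻³`. -/
theorem IsStieltjes.exists_laplaceBound {f : ℂ → ℂ} (hf : IsStieltjes f)
    (hne : ∃ z ∈ Complex.slitPlane, f z ≠ 0) :
    ∃ C, LaplaceBound (fun z => (1 + z)⁻¹ ^ 3 / f z) C := by
  have hf0 : ∀ z : ℂ, 0 < z.re → f z ≠ 0 := fun z hz h0 => by
    have := hf.re_pos hne hz
    simp [h0] at this
  obtain ⟨a, μ, hμ, h⟩ := hf
  rcases eq_or_ne μ 0 with rfl | hμ0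
  · refine ⟨_, ((LaplaceBound.inv_one_add.pow 3).smul_of_nonneg
      (c := (a : ℝ)⁻¹) (by positivity)).congr fun z hz => ?_⟩
    rw [h z (mem_slitPlane_of_re_pos hz), integral_zero_measure, add_zero, Complex.ofReal_inv]
    ring
  -- All truncations are taken beyond this `k`, so their values at `1` stay above one positive
  -- constant.
  obtain ⟨k, hk⟩ : ∃ k : ℕ, 0 < μ (Set.Iio (k : ℝ≥0)) := by
    by_contra! hcon
    refine hμ0 (Measure.measure_univ_eq_zero.1 ?_)
    have : (Set.univ : Set ℝ≥0) = ⋃ k : ℕ, Set.Iio (k : ℝ≥0) :=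
      (Set.eq_univ_of_forall fun x => Set.mem_iUnion.2 (exists_nat_gt x)).symm
    rw [this]
    exact measure_iUnion_null fun k => le_antisymm (hcon k) zero_le
  have hF0 : 0 < ∫ τ in Set.Iic (k : ℝ≥0), (1 + (τ : ℝ))⁻¹ ∂μ := by
    rw [setIntegral_pos_iff_support_of_nonneg_ae (ae_of_all _ fun τ => by positivity)
      hμ.integrableOn]
    refine hk.trans_le (measure_mono fun τ hτ => ⟨?_, Set.Iio_subset_Iic_self hτ⟩)
    rw [Function.mem_support]
    positivity
  have herr : Tendsto (fun n : ℕ => 2 * (a : ℝ) / (n : ℝ) +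
      2 * ∫ τ in Set.Ioi (n : ℝ≥0), (1 + (τ : ℝ))⁻¹ ∂μ) atTop (𝓝 0) := by
    simpa using (tendsto_const_div_atTop_nhds_zero_nat (2 * (a : ℝ))).add
      ((tendsto_setIntegral_Ioi_zero hμ).const_mul 2)
  have hex : ∀ j : ℕ, ∃ n : ℕ, 1 ≤ n ∧ k ≤ n ∧ 2 * (a : ℝ) / (n : ℝ) +
      2 * ∫ τ in Set.Ioi (n : ℝ≥0), (1 + (τ : ℝ))⁻¹ ∂μ ≤ (1 / 2) ^ j := fun j =>
    ((eventually_ge_atTop 1).and ((eventually_ge_atTop k).and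
      (herr.eventually (Iic_mem_nhds (by positivity : (0 : ℝ) < (1 / 2) ^ j))))).exists
  choose n hn1 hnk hn using hex
  have hn1' : ∀ j, (1 : ℝ≥0) ≤ (n j : ℝ≥0) := fun j => by exact_mod_cast hn1 j
  have hnk' : ∀ j, (k : ℝ≥0) ≤ (n j : ℝ≥0) := fun j => by exact_mod_cast hnk j
  have hT := fun j => truncatedStieltjes_laplaceBound hμ a (hn1' j)
    (hk.trans_le (measure_mono (Set.Iio_subset_Iio (hnk' j))))
  refine LaplaceBound.of_approx (F := fun j => truncatedStieltjes a μ (n j))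
    (B := 12 / ∫ τ in Set.Iic (k : ℝ≥0), (1 + (τ : ℝ))⁻¹ ∂μ)
    LaplaceBound.inv_one_add hf0 (fun j => (hT j).1) (fun j => (hT j).2.mono ?_)
    fun j => (LaplaceBound.inv_one_add_mul_sub_truncatedStieltjes hμ h (hn1' j)).mono ?_
  · refine div_le_div_of_nonneg_left (by norm_num) hF0 ?_
    have hmono : ∫ τ in Set.Iic (k : ℝ≥0), (1 + (τ : ℝ))⁻¹ ∂μ ≤
        ∫ τ in Set.Iic (n j : ℝ≥0), (1 + (τ : ℝ))⁻¹ ∂μ :=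
      setIntegral_mono_set hμ.integrableOn (ae_of_all _ fun τ => by positivity)
        (LE.le.eventuallyLE (Set.Iic_subset_Iic.2 (hnk' j)))
    have : 0 ≤ (a : ℝ) * (((n j : ℝ≥0) : ℝ) / ((n j : ℝ≥0) + 1)) := by positivity
    linarith
  · simpa using hn j

end StieltjesReciprocal

/-! ### Regularizability of the reciprocal -/

section Regularizable

variable {X : Type*} [NormedAddCommGroup X] [NormedSpace ℂ X]

theorem IsStieltjesProduct.exists_ofReal {f : ℂ → ℂ} (hf : IsStieltjesProduct f) {r : ℝ}
    (hr : 0 < r) : ∃ c : ℝ, f r = c := by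
  obtain ⟨f₁, f₂, h₁, h₂, h⟩ := hf
  obtain ⟨c₁, -, e₁⟩ := h₁.eq_nonneg_ofReal hr
  obtain ⟨c₂, -, e₂⟩ := h₂.eq_nonneg_ofReal hr
  exact ⟨c₁ * c₂, by rw [h _ (ofReal_mem_slitPlane hr), e₁, e₂, Complex.ofReal_mul]⟩

theorem IsStieltjesProduct.ne_zero {f : ℂ → ℂ} (hf : IsStieltjesProduct f)
    (hne : ∃ z ∈ Complex.slitPlane, f z ≠ 0) {z : ℂ} (hz : 0 < z.re) : f z ≠ 0 := by
  obtain ⟨f₁, f₂, h₁, h₂, h⟩ := hf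
  obtain ⟨w, hw, hw0⟩ := hne
  rw [h w hw] at hw0
  have p₁ := h₁.re_pos ⟨w, hw, left_ne_zero_of_mul hw0⟩ hz
  have p₂ := h₂.re_pos ⟨w, hw, right_ne_zero_of_mul hw0⟩ hz
  rw [h z (mem_slitPlane_of_re_pos hz)]
  refine mul_ne_zero (fun h0 => ?_) fun h0 => ?_
  · simp [h0] at p₁
  · simp [h0] at p₂

theorem IsStieltjesProduct.differentiableOn {f : ℂ → ℂ} (hf : IsStieltjesProduct f) :
    DifferentiableOn ℂ f Complex.slitPlane := by
  obtain ⟨f₁, f₂, h₁, h₂, h⟩ := hf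
  exact (h₁.differentiableOn.mul h₂.differentiableOn).congr h

theorem IsStieltjesProduct.exists_laplaceBound {f : ℂ → ℂ} (hf : IsStieltjesProduct f)
    (hne : ∃ z ∈ Complex.slitPlane, f z ≠ 0) :
    ∃ C, LaplaceBound (fun z => (1 + z)⁻¹ ^ 6 / f z) C := by
  obtain ⟨f₁, f₂, h₁, h₂, h⟩ := hf
  obtain ⟨w, hw, hw0⟩ := hne
  rw [h w hw] at hw0
  obtain ⟨C₁, b₁⟩ := h₁.exists_laplaceBound ⟨w, hw, left_ne_zero_of_mul hw0⟩
  obtain ⟨C₂, b₂⟩ := h₂.exists_laplaceBound ⟨w, hw, right_ne_zero_of_mul hw0⟩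
  refine ⟨_, (b₁.mul b₂).congr fun z hz => ?_⟩
  rw [h z (mem_slitPlane_of_re_pos hz)]
  ring

/-- The regularizer is `(1+z)⁻⁶`, the transform of `gammaDist 1 6`; at `A` it is the sixth power of
an injective resolvent. -/
theorem BoundedC0Semigroup.nonempty_regularizer [CompleteSpace X] (T : BoundedC0Semigroup X)
    {f g : ℂ → ℂ} (hf : IsStieltjesProduct f) (hne : ∃ z ∈ Complex.slitPlane, f z ≠ 0)
    (hg : ∀ z ∈ Complex.slitPlane, g z = 1 / f z) : Nonempty (T.Regularizer g) := by
  obtain ⟨C, q₁, q₂, _, _, -, hq⟩ := hf.exists_laplaceBound hne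
  refine ⟨Regularizer.ofMeasures T ?_ (gammaDist 1 6) 0 q₁ q₂ (fun z hz => ?_) ?_⟩
  · refine DifferentiableOn.congr (f := fun z => (1 : ℂ) / f z)
      ((differentiableOn_const 1).div (hf.differentiableOn.mono fun z hz => Or.inl hz)
      fun z hz => hf.ne_zero hne hz) fun z hz => hg z (Or.inl hz)
  · rw [← hq z hz, laplace_gammaDist 1 6 hz.le, hg z (Or.inl hz)]
    simp [laplace, div_eq_mul_inv]
  · have h0 : ∀ x, T.average (0 : Measure ℝ≥0) x = 0 := fun x => by
      rw [T.average_apply, integral_zero_measure]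
    simp only [h0, sub_zero, average_gammaDist, FunLike.coe_pow_eq_iterate]
    exact (T.average_expDist_injective one_pos).iterate 6

end Regularizable

/-! ### Fractional powers -/

section FractionalPowers

/-- The Stieltjes measure of `z ^ (p - 1)`, for `0 < p < 1`. -/
noncomputable def rpowMeasure (p : ℝ) : Measure ℝ≥0 :=
  ((volume.restrict (Set.Ioi (0 : ℝ))).withDensity fun t =>
    (Real.toNNReal ((∫ s in Set.Ioi 0, Real.rpowIntegrand₀₁ p s 1)⁻¹ * t ^ (p - 1)) : ℝ≥0∞)).map
    Real.toNNReal

theorem rpowMeasure_integrable_and_integral {p : ℝ} (hp : p ∈ Set.Ioo 0 1) {r : ℝ} (hr : 0 < r) :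
    Integrable (fun τ : ℝ≥0 => (r + (τ : ℝ))⁻¹) (rpowMeasure p) ∧
      ∫ τ : ℝ≥0, (r + (τ : ℝ))⁻¹ ∂rpowMeasure p = r ^ (p - 1) := by
  set c := (∫ s in Set.Ioi 0, Real.rpowIntegrand₀₁ p s 1)⁻¹ with hc
  have hc0 : 0 ≤ c := inv_nonneg.2 (Real.integral_rpowIntegrand₀₁_one_pos hp).le
  have hm : Measurable fun t : ℝ => Real.toNNReal (c * t ^ (p - 1)) := by fun_prop
  have hf : Measurable fun τ : ℝ≥0 => (r + (τ : ℝ))⁻¹ := by fun_prop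
  -- The integrand is `t^(p-1) r/(t+r)`; dividing by `r` turns the integral formula for `r^p` into a
  -- Stieltjes representation of `r^(p-1)`.
  have key : ∀ t ∈ Set.Ioi (0 : ℝ), c * r⁻¹ * Real.rpowIntegrand₀₁ p t r =
      Real.toNNReal (c * t ^ (p - 1)) • (r + (Real.toNNReal t : ℝ))⁻¹ := fun t ht => by
    have ht' : 0 < t := ht
    rw [Real.rpowIntegrand₀₁_eq_pow_div hp ht'.le hr.le, NNReal.smul_def,
      Real.coe_toNNReal _ ht'.le, Real.coe_toNNReal _ (by positivity), smul_eq_mul]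
    have : t + r ≠ 0 := by positivity
    have : r + t ≠ 0 := by positivity
    field_simp
    ring
  constructor
  · rw [rpowMeasure, integrable_map_measure hf.aestronglyMeasurable
      measurable_real_toNNReal.aemeasurable, integrable_withDensity_iff_integrable_smul hm]
    exact (((Real.integrableOn_rpowIntegrand₀₁_Ioi hp hr.le).const_mul (c * r⁻¹)).congr
      ((ae_restrict_iff' measurableSet_Ioi).2 (ae_of_all _ key)))
  · rw [rpowMeasure, integral_map measurable_real_toNNReal.aemeasurable hf.aestronglyMeasurable,
      integral_withDensity_eq_integral_smul hm, ← setIntegral_congr_fun measurableSet_Ioi key,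
      integral_const_mul, mul_right_comm, hc, ← Real.rpow_eq_const_mul_integral hp hr.le,
      Real.rpow_sub_one hr.ne', div_eq_mul_inv]

theorem isStieltjes_inv : IsStieltjes fun z => z⁻¹ := by
  refine ⟨0, Measure.dirac 0, integrable_dirac (by simp), fun z _ => ?_⟩
  rw [integral_dirac]
  simp

/-- The representation holds on `(0,∞)`. Both sides are analytic on the connected slit plane, so the
identity theorem, applied at `1`, extends it. -/
theorem isStieltjes_cpow {p : ℝ} (hp : p ∈ Set.Ioo 0 1) :
    IsStieltjes fun z => z ^ ((p - 1 : ℝ) : ℂ) := by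
  have hi := (rpowMeasure_integrable_and_integral hp one_pos).1
  refine ⟨0, rpowMeasure p, hi, ?_⟩
  have h1 : AnalyticOnNhd ℂ (fun z : ℂ => z ^ ((p - 1 : ℝ) : ℂ)) Complex.slitPlane := by
    refine DifferentiableOn.analyticOnNhd (fun z hz => ?_) Complex.isOpen_slitPlane
    exact (differentiableAt_id.cpow_const hz).differentiableWithinAt
  have h2 := (differentiableOn_integral_inv_add hi).analyticOnNhd Complex.isOpen_slitPlane
  have heq := h1.eqOn_of_preconnected_of_frequently_eq h2
    (Complex.starConvex_one_slitPlane.isPathConnected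
      Complex.one_mem_slitPlane).isConnected.isPreconnected
    Complex.one_mem_slitPlane ?_
  · intro z hz
    simpa using heq hz
  · have hreal : ∀ r : ℝ, 0 < r → (r : ℂ) ^ ((p - 1 : ℝ) : ℂ) =
        ∫ τ : ℝ≥0, ((r : ℂ) + ((τ : ℝ) : ℂ))⁻¹ ∂rpowMeasure p := fun r hr => by
      rw [integral_inv_add_ofReal, (rpowMeasure_integrable_and_integral hp hr).2,
        Complex.ofReal_cpow hr.le]
    have hT : Tendsto (fun r : ℝ => (r : ℂ)) (𝓝[≠] 1) (𝓝[≠] 1) :=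
      tendsto_nhdsWithin_iff.2 ⟨Complex.continuous_ofReal.continuousAt.tendsto.mono_left
        nhdsWithin_le_nhds, eventually_nhdsWithin_of_forall fun r hr h => hr (by simpa using h)⟩
    exact hT.frequently (((eventually_gt_nhds (zero_lt_one (α := ℝ))).filter_mono
      nhdsWithin_le_nhds).mono fun r hr => hreal r hr).frequently

theorem isStieltjesProduct_cpow {α : ℝ} (h0 : 0 < α) (h2 : α ≤ 2) :
    IsStieltjesProduct fun z => z ^ (-α : ℂ) := by
  have hS : IsStieltjes fun z => z ^ (-(α / 2) : ℂ) := by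
    -- At `α = 2` the half power is `z⁻¹`, whose measure is a unit mass at `0`; the density
    -- representation covers only exponents strictly between `-1` and `0`.
    rcases h2.eq_or_lt with rfl | h2
    · simpa [Complex.cpow_neg_one] using isStieltjes_inv
    · have := isStieltjes_cpow (p := 1 - α / 2) ⟨by linarith, by linarith⟩
      simpa using this
  refine ⟨_, _, hS, hS, fun z hz => ?_⟩
  rw [← Complex.cpow_add _ _ (Complex.slitPlane_ne_zero hz)]
  ring_nf

end FractionalPowers

/-! ### The rate of the Euler approximation -/

theorem corollary5p3 {X : Type*} [NormedAddCommGroup X] [NormedSpace ℂ X] [CompleteSpace X]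
    (T : BoundedC0Semigroup X) (A : X →ₗ.[ℂ] X) (hA : -A = T.generator) :
    (∀ (n : ℕ) (t : ℝ≥0), 0 < n → 0 < t →
      IsBoundedInverse (onePlus ((t : ℝ) / n) A) (boundedInverse (onePlus ((t : ℝ) / n) A))) ∧
    (∀ f g : ℂ → ℂ, IsStieltjesProduct f → (∃ z ∈ Complex.slitPlane, f z ≠ 0) →
      (∀ z ∈ Complex.slitPlane, g z = 1 / f z) →
      Nonempty (T.Regularizer g) ∧
      ∀ (R : T.Regularizer g) (x : R.apply.domain) (n : ℕ) (t : ℝ≥0), 0 < n → 0 < t →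
        ‖eulerApprox A n t x - T.op t x‖ ≤
          12 * T.bound * (‖R.apply x‖ / (g ((Real.sqrt n / (t : ℝ) : ℝ) : ℂ)).re)) ∧
    (∀ α : ℝ, 0 < α → α ≤ 2 →
      Nonempty (T.Regularizer fun z => z ^ (α : ℂ)) ∧
      ∀ (R : T.Regularizer fun z => z ^ (α : ℂ)) (x : R.apply.domain) (n : ℕ) (t : ℝ≥0),
        0 < n → 0 < t →
        ‖eulerApprox A n t x - T.op t x‖ ≤
          12 * T.bound * ‖R.apply x‖ * ((t : ℝ) / Real.sqrt n) ^ α) := by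
  have hpos : ∀ (n : ℕ) (t : ℝ≥0), 0 < n → 0 < t → 0 < Real.sqrt n / (t : ℝ) := fun n t hn ht =>
    div_pos (Real.sqrt_pos.2 (Nat.cast_pos.2 hn)) (NNReal.coe_pos.2 ht)
  have main : ∀ f g : ℂ → ℂ, IsStieltjesProduct f → (∃ z ∈ Complex.slitPlane, f z ≠ 0) →
      (∀ z ∈ Complex.slitPlane, g z = 1 / f z) →
      Nonempty (T.Regularizer g) ∧
      ∀ (R : T.Regularizer g) (x : R.apply.domain) (n : ℕ) (t : ℝ≥0), 0 < n → 0 < t →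
        ‖eulerApprox A n t x - T.op t x‖ ≤
          12 * T.bound * (‖R.apply x‖ / (g ((Real.sqrt n / (t : ℝ) : ℝ) : ℂ)).re) := by
    intro f g hf hne hg
    refine ⟨T.nonempty_regularizer hf hne hg, fun R x n t hn ht => ?_⟩
    have hfg : ∀ r : ℝ, 0 < r → f r * g r = 1 := fun r hr => by
      rw [hg _ (ofReal_mem_slitPlane hr), mul_one_div,
        div_self (hf.ne_zero hne (by simpa using hr))]
    refine (T.norm_eulerApprox_sub_le hA hf hfg R x hn ht).trans_eq ?_
    obtain ⟨c, hc⟩ := hf.exists_ofReal (hpos n t hn ht)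
    rw [hg _ (ofReal_mem_slitPlane (hpos n t hn ht)), hc, ← Complex.ofReal_one,
      ← Complex.ofReal_div, Complex.ofReal_re, Complex.ofReal_re, one_div, div_inv_eq_mul]
  refine ⟨fun n t hn ht => ?_, main, fun α h0 h2 => ?_⟩
  · have h := T.isBoundedInverse_average hA (h := t / n)
      (div_pos ht (Nat.cast_pos.2 hn))
    rw [NNReal.coe_div, NNReal.coe_natCast] at h
    rwa [boundedInverse_eq h]
  · obtain ⟨hN, hE⟩ := main (fun z => z ^ (-α : ℂ)) (fun z => z ^ (α : ℂ))
      (isStieltjesProduct_cpow h0 h2) ⟨1, Complex.one_mem_slitPlane, by simp⟩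
      fun z _ => by rw [Complex.cpow_neg, one_div, inv_inv]
    refine ⟨hN, fun R x n t hn ht => (hE R x n t hn ht).trans_eq ?_⟩
    have hp := hpos n t hn ht
    rw [← Complex.ofReal_cpow hp.le, Complex.ofReal_re, div_eq_mul_inv,
      ← Real.inv_rpow hp.le, inv_div, mul_assoc (12 * T.bound)]
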